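/- Let $n\ge 1$ and let $M=(\mu_1,\dots,\mu_n)$ with all $\mu_j>0$. Put $\mu_*=\min_j\mu_j$, $\langle\xi\rangle_M=\bigl(1+\sum_{j=1}^n|\xi_j|^{2\mu_j}\bigr)^{1/2}$ for $\xi\in\mathbb R^n$, and $\langle\alpha,1/M\rangle=\sum_{j=1}^n\alpha_j/\mu_j$ for a multi-index $\alpha$. The Fourier transform is $\hat u(\xi)=\int e^{-ix\cdot\xi}u(x)\,dx$, extended to tempered distributions by $\langle\hat u,\varphi\rangle=\langle u,\hat\varphi\rangle$. For $s\in\mathbb R$ and $p\in[1,\infty]$ let $\mathcal FL^p_{s,M}$ be the space of $u\in\mathcal S'(\mathbb R^n)$ such that $\hat u$ is a measurable function and $\|u\|_{\mathcal FL^p_{s,M}}:=\|\langle\cdot\rangle_M^s\hat u\|_{L^p(\mathbb R^n)}<\infty$; let $\mathcal FL^1$ be the space of those $u$ with $\hat u\in L^1(\mathbb R^n)$, normed by $\|u\|_{\mathcal FL^1}=\|\hat u\|_{L^1}$. Let $p\in[1,\infty]$, let $q$ be its conjugate exponent, and let $m,r\in\mathbb R$, $\delta\in[0,1]$ and $N$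 a positive integer. The class $\mathcal FL^p_{r,M}S^m_{M,\delta}(N)$ consists of all $a(x,\xi)\in\mathcal S'(\mathbb R^{2n})$ for which there is $C>0$ such that for every multi-index $\alpha$ with $|\alpha|\le N$ the (distributional) derivative $\partial_\xi^\alpha a$ is given by a measurable map $\xi\mapsto\partial_\xi^\alpha a(\cdot,\xi)$ with values in $\mathcal FL^p_{r,M}\cap\mathcal FL^1$ and, for all $\xi\in\mathbb R^n$, $$\|\partial_\xi^\alpha a(\cdot,\xi)\|_{\mathcal FL^1}\le C\langle\xi\rangle_M^{m-\langle\alpha,1/M\rangle},\qquad \|\partial_\xi^\alpha a(\cdot,\xi)\|_{\mathcal FL^p_{r,M}}\le C\langle\xi\rangle_M^{m-\langle\alpha,1/M\rangle+\delta\left(r-\frac{n}{\mu_* q}\right)}.$$ For $a\in\mathcal S'(\mathbb R^{2n})$ the operator $a(x,D):\mathcal S(\mathbb R^n)\to\mathcal S'(\mathbb R^n)$ is $a(x,D)u(x)=(2\pi)^{-n}\int e^{ix\cdot\xi}a(x,\xi)\hat u(\xi)\,d\xi$ in the sense of distributions. **Theorem.** Let $p\in[1,\infty]$, $q$ its conjugate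 exponent, $r>\frac{n}{\mu_* q}$, $\delta\in[0,1]$, $m\in\mathbb R$, $N>n+1$, and $a\in\mathcal FL^p_{r,M}S^m_{M,\delta}(N)$. Then for every $s\in\left](\delta-1)\left(r-\frac{n}{\mu_* q}\right),\,r\right[$ the operator $a(x,D)$ extends to a bounded linear operator $$a(x,D):\mathcal FL^p_{s+m,M}\to\mathcal FL^p_{s,M}.$$ If $\delta<1$, the same holds for $s=r$. -/

import Mathlib

open MeasureTheory Complex FourierTransform LineDeriv
open scoped SchwartzMap ENNReal Real ContDiff

noncomputable section

namespace QuasiHom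

/-- Euclidean space `ℝⁿ`. -/
abbrev Rn (n : ℕ) : Type := EuclideanSpace ℝ (Fin n)

/-! ### Weights -/

/-- The `M`-norm `|ξ|_M = (∑ⱼ |ξⱼ|^{2 μⱼ})^{1/2}` for `M = (μ₁, …, μₙ)`. -/
def mNorm {n : ℕ} (M : Fin n → ℝ) (ξ : Rn n) : ℝ :=
  Real.sqrt (∑ j, |ξ j| ^ (2 * M j))

/-- The `M`-weight `⟨ξ⟩_M = (1 + |ξ|_M²)^{1/2}`. -/
def mWeight {n : ℕ} (M : Fin n → ℝ) (ξ : Rn n) : ℝ :=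
  Real.sqrt (1 + mNorm M ξ ^ 2)

/-- The `M`-order `⟨α, 1/M⟩ = ∑ⱼ αⱼ / μⱼ` of a multi-index. -/
def mOrder {n : ℕ} (M : Fin n → ℝ) (α : Fin n → ℕ) : ℝ :=
  ∑ j, (α j : ℝ) / M j

/-- The minimum order `μ_* = minⱼ μⱼ` (meaningful for `n ≥ 1`). -/
def muMin {n : ℕ} (M : Fin n → ℝ) : ℝ := ⨅ j, M j

theorem mWeight_pos {n : ℕ} (M : Fin n → ℝ) (ξ : Rn n) : 0 < mWeight M ξ :=
  Real.sqrt_pos.2 (by positivity)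

/-! ### The Fourier transform `û(ξ) = ∫ e^{-i x·ξ} u(x) dx` -/

/-- The dilation `ξ ↦ (2π)⁻¹ ξ`. -/
def dil (n : ℕ) : Rn n ≃L[ℝ] Rn n :=
  ContinuousLinearEquiv.smulLeft (Units.mk0 ((2 * π)⁻¹ : ℝ) (by positivity))

/-- The Fourier transform `û(ξ) = ∫ e^{-i x·ξ} u(x) dx` on Schwartz functions: Mathlib's transform
(whose kernel is `e^{-2π i x·ξ}`) followed by a dilation. -/
def fourierS (n : ℕ) : 𝓢(Rn n, ℂ) →L[ℂ] 𝓢(Rn n, ℂ) :=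
  (SchwartzMap.compCLMOfContinuousLinearEquiv ℂ (dil n)).comp
    (SchwartzMap.fourierTransformCLM ℂ)

theorem fourierS_apply {n : ℕ} (u : 𝓢(Rn n, ℂ)) (ξ : Rn n) :
    fourierS n u ξ = ∫ x, exp (-(I * (inner ℝ x ξ : ℝ))) * u x := by
  have h : fourierS n u ξ = 𝓕 (u : Rn n → ℂ) ((2 * π)⁻¹ • ξ) := rfl
  rw [h, Real.fourier_eq']
  refine integral_congr_ae (Filter.Eventually.of_forall fun x => ?_)
  simp only [inner_smul_right, smul_eq_mul]
  congr 2
  have : (π : ℂ) ≠ 0 := by exact_mod_cast Real.pi_ne_zero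
  push_cast
  field_simp

/-- The Fourier transform of a tempered distribution, `⟨û, φ⟩ = ⟨u, φ̂⟩`. -/
def fourierD (n : ℕ) : 𝓢'(Rn n, ℂ) →L[ℂ] 𝓢'(Rn n, ℂ) :=
  PointwiseConvergenceCLM.precomp ℂ (fourierS n)

theorem fourierD_apply {n : ℕ} (u : 𝓢'(Rn n, ℂ)) (φ : 𝓢(Rn n, ℂ)) :
    fourierD n u φ = u (fourierS n φ) := rfl

/-! ### Fourier–Lebesgue spaces -/

/-- The tempered distribution `v` is the measurable function `f`. -/
def IsFunction {n : ℕ} (v : 𝓢'(Rn n, ℂ)) (f : Rn n → ℂ) : Prop :=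
  AEStronglyMeasurable f volume ∧
    ∀ φ : 𝓢(Rn n, ℂ), Integrable (fun ξ => f ξ * φ ξ) ∧ v φ = ∫ ξ, f ξ * φ ξ

theorem IsFunction.locallyIntegrable {n : ℕ} {v : 𝓢'(Rn n, ℂ)} {f : Rn n → ℂ}
    (h : IsFunction v f) : LocallyIntegrable f := by
  intro x
  let b : ContDiffBump x := ⟨1, 2, one_pos, one_lt_two⟩
  have hc : HasCompactSupport (fun y => ((b y : ℝ) : ℂ)) :=
    b.hasCompactSupport.comp_left (g := fun t : ℝ => (t : ℂ)) rfl
  have hs : ContDiff ℝ ∞ (fun y => ((b y : ℝ) : ℂ)) :=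
    Complex.ofRealCLM.contDiff.comp b.contDiff
  have hi := (h.2 (hc.toSchwartzMap hs)).1
  refine ⟨Metric.closedBall x 1, Metric.closedBall_mem_nhds x one_pos, ?_⟩
  refine (hi.integrableOn (s := Metric.closedBall x 1)).congr_fun ?_
    Metric.isClosed_closedBall.measurableSet
  intro y hy
  have : b y = 1 := b.one_of_mem_closedBall hy
  change f y * ((b y : ℝ) : ℂ) = f y
  simp [this]

theorem IsFunction.unique {n : ℕ} {v : 𝓢'(Rn n, ℂ)} {f g : Rn n → ℂ}
    (hf : IsFunction v f) (hg : IsFunction v g) : f =ᵐ[volume] g := by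
  refine ae_eq_of_integral_contDiff_smul_eq hf.locallyIntegrable hg.locallyIntegrable ?_
  intro φ hφ hc
  have hc' : HasCompactSupport (fun y => ((φ y : ℝ) : ℂ)) :=
    hc.comp_left (g := fun t : ℝ => (t : ℂ)) rfl
  have hs : ContDiff ℝ ∞ (fun y => ((φ y : ℝ) : ℂ)) := Complex.ofRealCLM.contDiff.comp hφ
  have h1 := (hf.2 (hc'.toSchwartzMap hs)).2
  have h2 := (hg.2 (hc'.toSchwartzMap hs)).2
  have h3 : ∫ ξ, f ξ * ((φ ξ : ℝ) : ℂ) = ∫ ξ, g ξ * ((φ ξ : ℝ) : ℂ) := h1.symm.trans h2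
  simpa [mul_comm] using h3

theorem IsFunction.zero {n : ℕ} : IsFunction (0 : 𝓢'(Rn n, ℂ)) 0 :=
  ⟨aestronglyMeasurable_zero, fun φ => ⟨by simp, by simp⟩⟩

theorem IsFunction.add {n : ℕ} {v w : 𝓢'(Rn n, ℂ)} {f g : Rn n → ℂ}
    (hf : IsFunction v f) (hg : IsFunction w g) : IsFunction (v + w) (f + g) := by
  refine ⟨hf.1.add hg.1, fun φ => ⟨?_, ?_⟩⟩
  · have := (hf.2 φ).1.add (hg.2 φ).1
    simpa only [Pi.add_apply, add_mul] using! this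
  · have := integral_add (hf.2 φ).1 (hg.2 φ).1
    simp only [Pi.add_apply, add_mul]
    rw [this, ← (hf.2 φ).2, ← (hg.2 φ).2]
    rfl

theorem IsFunction.smul {n : ℕ} {v : 𝓢'(Rn n, ℂ)} {f : Rn n → ℂ} (c : ℂ)
    (hf : IsFunction v f) : IsFunction (c • v) (c • f) := by
  refine ⟨hf.1.const_smul c, fun φ => ⟨?_, ?_⟩⟩
  · simpa [mul_assoc] using (hf.2 φ).1.const_mul c
  · simp only [Pi.smul_apply, smul_eq_mul, mul_assoc]
    rw [integral_const_mul, ← (hf.2 φ).2]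
    rfl

/-- `f` is the Fourier transform of `u`, and `⟨·⟩_M^s f ∈ L^p`. -/
def IsFLTransform {n : ℕ} (p : ℝ≥0∞) (s : ℝ) (M : Fin n → ℝ) (u : 𝓢'(Rn n, ℂ))
    (f : Rn n → ℂ) : Prop :=
  IsFunction (fourierD n u) f ∧ MemLp (fun ξ => ((mWeight M ξ ^ s : ℝ) : ℂ) * f ξ) p volume

/-- The space `FL^p_{s,M}` as a linear subspace of the tempered distributions: `û` is a measurable
function and `⟨·⟩_M^s û ∈ L^p`. -/
def flSubmodule {n : ℕ} (p : ℝ≥0∞) (s : ℝ) (M : Fin n → ℝ) : Submodule ℂ 𝓢'(Rn n, ℂ) where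
  carrier := {u | ∃ f, IsFLTransform p s M u f}
  zero_mem' := ⟨0, by simpa using IsFunction.zero, by simp⟩
  add_mem' := by
    rintro u v ⟨f, hf, hf'⟩ ⟨g, hg, hg'⟩
    refine ⟨f + g, by simpa using hf.add hg, ?_⟩
    simpa only [Pi.add_apply, mul_add] using! hf'.add hg'
  smul_mem' := by
    rintro c u ⟨f, hf, hf'⟩
    refine ⟨c • f, by simpa using hf.smul c, ?_⟩
    have := hf'.const_smul c
    refine this.congr_norm ?_ (Filter.Eventually.of_forall fun ξ => ?_)
    · have e : (fun ξ => ((mWeight M ξ ^ s : ℝ) : ℂ) * (c • f) ξ)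
          = c • (fun ξ => ((mWeight M ξ ^ s : ℝ) : ℂ) * f ξ) := by
        ext ξ; simp only [Pi.smul_apply, smul_eq_mul]; ring
      rw [e]; exact this.1
    · simp only [Pi.smul_apply, smul_eq_mul]; congr 1; ring

/-- The `M`-homogeneous Fourier–Lebesgue space `FL^p_{s,M}`, with the norm
`‖u‖ = ‖⟨·⟩_M^s û‖_{L^p}` given below (and not the topology induced by the distributions). -/
def FL {n : ℕ} (p : ℝ≥0∞) (s : ℝ) (M : Fin n → ℝ) : Type := ↥(flSubmodule p s M)

namespace FL

variable {n : ℕ} {p : ℝ≥0∞} {s : ℝ} {M : Fin n → ℝ}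

instance : AddCommGroup (FL p s M) := inferInstanceAs (AddCommGroup ↥(flSubmodule p s M))

instance : Module ℂ (FL p s M) := inferInstanceAs (Module ℂ ↥(flSubmodule p s M))

/-- The inclusion of `FL^p_{s,M}` into the tempered distributions. -/
def toDist : FL p s M →ₗ[ℂ] 𝓢'(Rn n, ℂ) := (flSubmodule p s M).subtype

theorem toDist_injective : Function.Injective (toDist : FL p s M → 𝓢'(Rn n, ℂ)) :=
  Subtype.val_injective

theorem exists_toDist_eq_iff {u : 𝓢'(Rn n, ℂ)} :
    (∃ w : FL p s M, w.toDist = u) ↔ ∃ f, IsFLTransform p s M u f :=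
  ⟨fun ⟨w, hw⟩ => hw ▸ w.2, fun h => ⟨⟨u, h⟩, rfl⟩⟩

/-- The function `û`, unique up to null sets. -/
def hat (u : FL p s M) : Rn n → ℂ := u.2.choose

theorem hat_spec (u : FL p s M) : IsFLTransform p s M u.toDist u.hat := u.2.choose_spec

theorem hat_unique (u : FL p s M) {f : Rn n → ℂ} (hf : IsFunction (fourierD n u.toDist) f) :
    u.hat =ᵐ[volume] f :=
  u.hat_spec.1.unique hf

/-- The linear map `u ↦ ⟨·⟩_M^s û` into `L^p`. -/
def toLp : FL p s M →ₗ[ℂ] Lp ℂ p (volume : Measure (Rn n)) where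
  toFun u := u.hat_spec.2.toLp _
  map_add' u v := by
    rw [← MemLp.toLp_add, MemLp.toLp_eq_toLp_iff]
    have : IsFunction (fourierD n (u + v).toDist) (u.hat + v.hat) := by
      simpa using u.hat_spec.1.add v.hat_spec.1
    filter_upwards [hat_unique _ this] with ξ hξ
    simp [hξ, mul_add]
  map_smul' c u := by
    rw [RingHom.id_apply, ← MemLp.toLp_const_smul, MemLp.toLp_eq_toLp_iff]
    have : IsFunction (fourierD n (c • u).toDist) (c • u.hat) := by
      simpa using u.hat_spec.1.smul c
    filter_upwards [hat_unique _ this] with ξ hξ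
    simp only [hξ, Pi.smul_apply, smul_eq_mul]
    ring

theorem toLp_injective : Function.Injective (toLp : FL p s M → Lp ℂ p volume) := by
  rw [← LinearMap.ker_eq_bot, LinearMap.ker_eq_bot']
  intro u hu
  have h0 : u.hat =ᵐ[volume] 0 := by
    have h1 := u.hat_spec.2.coeFn_toLp
    have h2 : (u.hat_spec.2.toLp _ : Rn n → ℂ) =ᵐ[volume] 0 := by
      have : u.hat_spec.2.toLp _ = 0 := hu
      rw [this]; exact Lp.coeFn_zero _ _ _
    filter_upwards [h1, h2] with ξ e1 e2
    rw [e1] at e2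
    have := (Real.rpow_pos_of_pos (mWeight_pos M ξ) s).ne'
    simpa [this] using e2
  have hF : fourierD n u.toDist = 0 := by
    ext φ
    rw [(u.hat_spec.1.2 φ).2]
    have : (fun ξ => u.hat ξ * φ ξ) =ᵐ[volume] 0 := by
      filter_upwards [h0] with ξ e; simp [e]
    rw [integral_congr_ae this]; simp
  apply toDist_injective
  rw [map_zero]
  ext φ
  -- every Schwartz function is a Fourier transform
  let e := SchwartzMap.compCLMOfContinuousLinearEquiv ℂ (F := ℂ) (dil n).symm
  have hφ : φ = fourierS n (𝓕⁻ (e φ)) := by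
    have h1 : fourierS n (𝓕⁻ (e φ))
        = SchwartzMap.compCLMOfContinuousLinearEquiv ℂ (dil n) (𝓕 (𝓕⁻ (e φ))) := rfl
    rw [h1, FourierTransform.fourier_fourierInv_eq]
    ext x
    simp [e]
  rw [hφ, ← fourierD_apply, hF]
  rfl

/-- The norm `‖u‖_{FL^p_{s,M}} = ‖⟨·⟩_M^s û‖_{L^p}`. -/
instance [Fact (1 ≤ p)] : NormedAddCommGroup (FL p s M) :=
  NormedAddCommGroup.induced (FL p s M) (Lp ℂ p (volume : Measure (Rn n))) toLp toLp_injective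

instance [Fact (1 ≤ p)] : NormedSpace ℂ (FL p s M) :=
  NormedSpace.induced ℂ (FL p s M) (Lp ℂ p (volume : Measure (Rn n))) toLp

theorem norm_eq [Fact (1 ≤ p)] (u : FL p s M) {f : Rn n → ℂ}
    (hf : IsFunction (fourierD n u.toDist) f) :
    ‖u‖ = (eLpNorm (fun ξ => ((mWeight M ξ ^ s : ℝ) : ℂ) * f ξ) p volume).toReal := by
  have h : ‖u‖ = ‖u.hat_spec.2.toLp _‖ := rfl
  rw [h, Lp.norm_toLp]
  congr 1
  refine eLpNorm_congr_ae ?_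
  filter_upwards [hat_unique u hf] with ξ e
  simp [e]

end FL

/-! ### Symbols and pseudodifferential operators

Symbols are tempered distributions on `ℝⁿ × ℝⁿ ∋ (x, ξ)`. -/

/-- The function `x ↦ Φ(x, ξ)` for fixed `ξ`. -/
def slice {n : ℕ} (ξ : Rn n) : 𝓢(Rn n × Rn n, ℂ) →L[ℂ] 𝓢(Rn n, ℂ) :=
  SchwartzMap.compCLM ℂ (g := fun x => (x, ξ))
    (by
      have : (fun x : Rn n => (x, ξ))
          = (fun x => ContinuousLinearMap.inl ℝ (Rn n) (Rn n) x + (0, ξ)) := by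
        ext x <;> simp
      rw [this]
      exact (ContinuousLinearMap.hasTemperateGrowth _).add
        (Function.HasTemperateGrowth.const _))
    ⟨1, 1, fun x => by
      have : ‖x‖ ≤ ‖(x, ξ)‖ := le_max_left _ _
      simp only [pow_one, one_mul]; linarith⟩

theorem slice_apply {n : ℕ} (ξ : Rn n) (Φ : 𝓢(Rn n × Rn n, ℂ)) (x : Rn n) :
    slice ξ Φ x = Φ (x, ξ) := rfl

/-- The phase `e^{i x·ξ}`. -/
def phase (n : ℕ) (z : Rn n × Rn n) : ℂ := exp (I * (inner ℝ z.1 z.2 : ℝ))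

theorem hasTemperateGrowth_exp_I : Function.HasTemperateGrowth (fun t : ℝ => exp (I * t)) := by
  have hd : ∀ k : ℕ, iteratedDeriv k (fun t : ℝ => exp (I * t)) = fun t : ℝ => I ^ k * exp (I * t) := by
    intro k
    induction k with
    | zero => simp
    | succ k ih =>
      rw [iteratedDeriv_succ, ih]
      ext t
      have h1 : HasDerivAt (fun t : ℝ => I * (t : ℂ)) (I * 1) t :=
        (Complex.ofRealCLM.hasDerivAt (x := t)).const_mul I
      have h2 := (h1.cexp).const_mul (I ^ k)
      rw [h2.deriv]; ring
  refine ⟨?_, fun k => ⟨0, 1, fun t => ?_⟩⟩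
  · exact (contDiff_const.mul Complex.ofRealCLM.contDiff).cexp
  · rw [norm_iteratedFDeriv_eq_norm_iteratedDeriv, hd]
    simp [Complex.norm_exp]

theorem hasTemperateGrowth_phase (n : ℕ) : Function.HasTemperateGrowth (phase n) := by
  have h : Function.HasTemperateGrowth (fun z : Rn n × Rn n => (inner ℝ z.1 z.2 : ℝ)) :=
    (innerSL ℝ (E := Rn n)).bilinear_hasTemperateGrowth
      (ContinuousLinearMap.fst ℝ (Rn n) (Rn n)).hasTemperateGrowth
      (ContinuousLinearMap.snd ℝ (Rn n) (Rn n)).hasTemperateGrowth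
  exact hasTemperateGrowth_exp_I.comp h

/-- The tensor product `v ↦ ((x, ξ) ↦ v(x) w(ξ))` with a fixed Schwartz function `w`. -/
def tensor {n : ℕ} (w : 𝓢(Rn n, ℂ)) : 𝓢(Rn n, ℂ) →L[ℂ] 𝓢(Rn n × Rn n, ℂ) :=
  SchwartzMap.mkCLM (σ := RingHom.id ℂ) (fun v z => v z.1 * w z.2)
    (fun v v' z => by simp [add_mul])
    (fun c v z => by simp [mul_assoc])
    (fun v => ((v.smooth ⊤).comp contDiff_fst).mul ((w.smooth ⊤).comp contDiff_snd)) <| by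
  rintro ⟨k, m⟩
  let S := (Finset.Iic (k, m)).sup (schwartzSeminormFamily ℂ (Rn n) ℂ)
  refine ⟨Finset.Iic (k, m),
    ∑ i ∈ Finset.range (m + 1), (m.choose i : ℝ) * (2 ^ k * (2 ^ k * S w)), by positivity, ?_⟩
  intro v z
  have hfst : ∀ i ≤ m, ‖iteratedFDeriv ℝ i (fun y : Rn n × Rn n => v y.1) z‖
      ≤ ‖iteratedFDeriv ℝ i v z.1‖ := by
    intro i _
    have h := (ContinuousLinearMap.fst ℝ (Rn n) (Rn n)).iteratedFDeriv_comp_right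
      (v.smooth ⊤) z (i := i) (mod_cast le_top)
    change ‖iteratedFDeriv ℝ i (v ∘ (ContinuousLinearMap.fst ℝ (Rn n) (Rn n))) z‖ ≤ _
    rw [h]
    refine (ContinuousMultilinearMap.norm_compContinuousLinearMap_le _ _).trans ?_
    refine mul_le_of_le_one_right (norm_nonneg _) ?_
    exact Finset.prod_le_one (fun _ _ => norm_nonneg _)
      (fun _ _ => ContinuousLinearMap.norm_fst_le ℝ (Rn n) (Rn n))
  have hsnd : ∀ i ≤ m, ‖iteratedFDeriv ℝ i (fun y : Rn n × Rn n => w y.2) z‖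
      ≤ ‖iteratedFDeriv ℝ i w z.2‖ := by
    intro i _
    have h := (ContinuousLinearMap.snd ℝ (Rn n) (Rn n)).iteratedFDeriv_comp_right
      (w.smooth ⊤) z (i := i) (mod_cast le_top)
    change ‖iteratedFDeriv ℝ i (w ∘ (ContinuousLinearMap.snd ℝ (Rn n) (Rn n))) z‖ ≤ _
    rw [h]
    refine (ContinuousMultilinearMap.norm_compContinuousLinearMap_le _ _).trans ?_
    refine mul_le_of_le_one_right (norm_nonneg _) ?_
    exact Finset.prod_le_one (fun _ _ => norm_nonneg _)
      (fun _ _ => ContinuousLinearMap.norm_snd_le ℝ (Rn n) (Rn n))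
  have hz : ‖z‖ ^ k ≤ (1 + ‖z.1‖) ^ k * (1 + ‖z.2‖) ^ k := by
    rw [← mul_pow]
    refine pow_le_pow_left₀ (norm_nonneg _) ?_ k
    have h1 := norm_nonneg z.1
    have h2 := norm_nonneg z.2
    rw [Prod.norm_def]
    exact max_le (by nlinarith) (by nlinarith)
  have hmul := norm_iteratedFDeriv_mul_le (𝕜 := ℝ) (N := ∞)
    (f := fun y : Rn n × Rn n => v y.1) (g := fun y : Rn n × Rn n => w y.2)
    ((v.smooth ⊤).comp contDiff_fst) ((w.smooth ⊤).comp contDiff_snd) z (n := m)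
    (mod_cast le_top)
  calc ‖z‖ ^ k * ‖iteratedFDeriv ℝ m (fun z : Rn n × Rn n => v z.1 * w z.2) z‖
      ≤ ((1 + ‖z.1‖) ^ k * (1 + ‖z.2‖) ^ k) * ∑ i ∈ Finset.range (m + 1), (m.choose i : ℝ) *
          ‖iteratedFDeriv ℝ i (fun y : Rn n × Rn n => v y.1) z‖ *
          ‖iteratedFDeriv ℝ (m - i) (fun y : Rn n × Rn n => w y.2) z‖ := by gcongr
    _ ≤ ∑ i ∈ Finset.range (m + 1), (m.choose i : ℝ) * (2 ^ k * (2 ^ k * S w)) * S v := by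
        rw [Finset.mul_sum]
        refine Finset.sum_le_sum fun i hi => ?_
        have him : i ≤ m := Nat.lt_succ_iff.1 (Finset.mem_range.1 hi)
        have e1 : (1 + ‖z.1‖) ^ k * ‖iteratedFDeriv ℝ i v z.1‖ ≤ 2 ^ k * S v :=
          SchwartzMap.one_add_le_sup_seminorm_apply (𝕜 := ℂ) (m := (k, m)) le_rfl him v z.1
        have e2 : (1 + ‖z.2‖) ^ k * ‖iteratedFDeriv ℝ (m - i) w z.2‖ ≤ 2 ^ k * S w :=
          SchwartzMap.one_add_le_sup_seminorm_apply (𝕜 := ℂ) (m := (k, m)) le_rfl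
            (Nat.sub_le m i) w z.2
        have hSv : 0 ≤ S v := apply_nonneg S v
        calc _ ≤ ((1 + ‖z.1‖) ^ k * (1 + ‖z.2‖) ^ k) * ((m.choose i : ℝ) *
              ‖iteratedFDeriv ℝ i v z.1‖ * ‖iteratedFDeriv ℝ (m - i) w z.2‖) := by
              gcongr
              · exact hfst i him
              · exact hsnd _ (Nat.sub_le m i)
          _ = (m.choose i : ℝ) * (((1 + ‖z.1‖) ^ k * ‖iteratedFDeriv ℝ i v z.1‖) *
              ((1 + ‖z.2‖) ^ k * ‖iteratedFDeriv ℝ (m - i) w z.2‖)) := by ring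
          _ ≤ (m.choose i : ℝ) * ((2 ^ k * S v) * (2 ^ k * S w)) := by gcongr
          _ = _ := by ring
    _ = _ := by rw [Finset.sum_mul]

theorem tensor_apply {n : ℕ} (w v : 𝓢(Rn n, ℂ)) (z : Rn n × Rn n) :
    tensor w v z = v z.1 * w z.2 := rfl

/-- The pseudodifferential operator `a(x, D) : 𝓢 → 𝓢'`,
`a(x, D) u (x) = (2π)⁻ⁿ ∫ e^{i x·ξ} a(x, ξ) û(ξ) dξ` in the sense of distributions, that is,
`⟨a(x, D) u, v⟩ = (2π)⁻ⁿ ⟨a, e^{i x·ξ} v(x) û(ξ)⟩`. -/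
def psdo {n : ℕ} (a : 𝓢'(Rn n × Rn n, ℂ)) (u : 𝓢(Rn n, ℂ)) : 𝓢'(Rn n, ℂ) :=
  (((2 * π) ^ n : ℝ) : ℂ)⁻¹ • PointwiseConvergenceCLM.precomp ℂ
    ((SchwartzMap.smulLeftCLM ℂ (phase n)).comp (tensor (fourierS n u))) a

theorem psdo_testFunction_apply {n : ℕ} (u v : 𝓢(Rn n, ℂ)) (z : Rn n × Rn n) :
    SchwartzMap.smulLeftCLM ℂ (phase n) (tensor (fourierS n u) v) z
      = exp (I * (inner ℝ z.1 z.2 : ℝ)) * (v z.1 * fourierS n u z.2) := by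
  rw [SchwartzMap.smulLeftCLM_apply_apply (hasTemperateGrowth_phase n)]
  rfl

theorem psdo_apply {n : ℕ} (a : 𝓢'(Rn n × Rn n, ℂ)) (u v : 𝓢(Rn n, ℂ)) :
    psdo a u v = (((2 * π) ^ n : ℝ) : ℂ)⁻¹ *
      a (SchwartzMap.smulLeftCLM ℂ (phase n) (tensor (fourierS n u) v)) := rfl

/-- The derivative `∂_ξ^α a` of a symbol, in the sense of distributions. -/
def dXi {n : ℕ} (α : Fin n → ℕ) (a : 𝓢'(Rn n × Rn n, ℂ)) : 𝓢'(Rn n × Rn n, ℂ) :=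
  (List.finRange n).foldr
    (fun j b => (fun c => ∂_{((0, EuclideanSpace.single j 1) : Rn n × Rn n)} c)^[α j] b) a

/-- The tempered distribution `b(x, ξ)` is the family `ξ ↦ A ξ = b(·, ξ)` of tempered distributions
in `x`: `⟨b, Φ⟩ = ∫ ⟨b(·, ξ), Φ(·, ξ)⟩ dξ`. -/
def IsFamily {n : ℕ} (b : 𝓢'(Rn n × Rn n, ℂ)) (A : Rn n → 𝓢'(Rn n, ℂ)) : Prop :=
  ∀ Φ : 𝓢(Rn n × Rn n, ℂ),
    Integrable (fun ξ => A ξ (slice ξ Φ)) ∧ b Φ = ∫ ξ, A ξ (slice ξ Φ)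

/-- The symbol class `FL^p_{r,M} S^m_{M,δ}(N)`, where `q` is the conjugate exponent of `p`: for
`|α| ≤ N` the derivative `∂_ξ^α a(·, ξ)` is a measurable function of `ξ` with values in
`FL^p_{r,M} ∩ FL^1`, with
`‖∂_ξ^α a(·, ξ)‖_{FL^1} ≤ C ⟨ξ⟩_M^{m - ⟨α, 1/M⟩}` and
`‖∂_ξ^α a(·, ξ)‖_{FL^p_{r,M}} ≤ C ⟨ξ⟩_M^{m - ⟨α, 1/M⟩ + δ (r - n/(μ_* q))}`.

The values are recorded twice, as elements `A₁ ξ` of `FL^1` (the space of order `0`) and `A ξ` of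
`FL^p_{r,M}`. Measurability is asked for the separable space `FL^1`; this follows from
measurability with respect to any finer norm. -/
def IsSymbol {n : ℕ} (p q : ℝ≥0∞) [Fact (1 ≤ p)] (r m δ : ℝ) (M : Fin n → ℝ) (N : ℕ)
    (a : 𝓢'(Rn n × Rn n, ℂ)) : Prop :=
  ∃ C : ℝ, 0 < C ∧ ∀ α : Fin n → ℕ, ∑ j, α j ≤ N →
    ∃ (A₁ : Rn n → FL (n := n) 1 0 (fun _ => 1)) (A : Rn n → FL p r M),
      (∀ ξ, (A₁ ξ).toDist = (A ξ).toDist) ∧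
      IsFamily (dXi α a) (fun ξ => (A ξ).toDist) ∧
      StronglyMeasurable A₁ ∧
      (∀ ξ, ‖A₁ ξ‖ ≤ C * mWeight M ξ ^ (m - mOrder M α)) ∧
      (∀ ξ, ‖A ξ‖ ≤ C * mWeight M ξ ^
        (m - mOrder M α + δ * (r - n / muMin M * (q⁻¹).toReal)))

end QuasiHom

end

open MeasureTheory Complex FourierTransform LineDeriv
open scoped SchwartzMap ENNReal Real ContDiff

noncomputable section

namespace QuasiHom

/-! ### The weight: quasi-triangle inequalities, volumes of sublevel sets, sums over dyadic shells.
-/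

section

variable {n : ℕ} {M : Fin n → ℝ}

/-! Let f(·, ξ) be the Fourier transform of a(·, ξ) in x, and write ⟨·⟩ for the weight. The
transform of a(x, D)u is (2π)⁻ⁿ ∫ f(η - ξ, ξ) û(ξ) dξ (`fourierD_psdo_apply`). Since u ↦ ⟨·⟩^s û is
an isometry onto L^p (`FL.equivLp`), the theorem amounts to the boundedness on L^p of the operator
with kernel ⟨η⟩^s ⟨ξ⟩^{-(s+m)} f(η - ξ, ξ), which is `exists_eLpNorm_lintegral_kernel_le`. The bound
holds for the absolute value of the kernel, so the operator is defined on all of L^p and no density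
of Schwartz functions is needed; p = ∞ is included.

The quasi-triangle inequality between ⟨η⟩, ⟨ξ⟩ and ⟨η - ξ⟩ splits the kernel pointwise
(`exists_weight_split`). Put κ = n/(μ_* q). Either ⟨η⟩^s ⟨ξ⟩^{-s} is bounded by a power ε > 0 of the
smaller of the two ratios of ⟨η⟩ and ⟨ξ⟩, or the frequency η - ξ is large and ⟨η - ξ⟩^r can be
spent.

In the second case Hölder in ξ applies (`eLpNorm_lintegral_mul_le`). One factor, ⟨ξ⟩^{-κ} times a
kernel decaying geometrically away from one dyadic shell, is uniformly in L^q because a shell of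
radius R has volume at most a constant times R^{n/μ_*}. The other factor, as a function of η, is a
translate of ⟨·⟩^r f(·, ξ), whose L^p norm the symbol class controls.

In the first case the Schur test applies (`exists_eLpNorm_nearKernel_le`). Integration in η is the
FL^1 bound. Integration in ξ runs along the antidiagonal (η - ξ, ξ), where a bound for each separate
ξ says nothing. This is where the ξ-derivatives enter: an averaged Sobolev inequality
(`enorm_le_cubeAverage`) bounds f(ζ, ξ) by means of the mixed derivatives ∂_ξ^S f, S ⊆ {1, …, n},
over a box with sides of order R^{1/μ_j}. The extra average decouples the two variables, and the
gain R^{-1/μ_j} of each derivative cancels the side of the box, so each shell of radius R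
contributes at most a constant times R^m (`exists_lintegral_shell_le`). The factor with exponent ε
makes the sum over shells converge. -/

theorem one_le_mWeight (M : Fin n → ℝ) (ξ : Rn n) : 1 ≤ mWeight M ξ := by
  unfold mWeight
  rw [Real.one_le_sqrt]
  nlinarith [sq_nonneg (mNorm M ξ)]

theorem mWeight_sq (M : Fin n → ℝ) (ξ : Rn n) :
    mWeight M ξ ^ 2 = 1 + ∑ j, |ξ j| ^ (2 * M j) := by
  unfold mWeight mNorm
  rw [Real.sq_sqrt (by positivity), Real.sq_sqrt]
  exact Finset.sum_nonneg fun j _ => Real.rpow_nonneg (abs_nonneg _) _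

theorem continuous_mWeight (hM : ∀ j, 0 < M j) : Continuous (mWeight M) := by
  unfold mWeight mNorm
  refine Real.continuous_sqrt.comp (continuous_const.add ((Real.continuous_sqrt.comp
    (continuous_finsetSum _ fun j _ => ?_)).pow 2))
  exact Continuous.rpow_const (by fun_prop) fun x => Or.inr (by have := hM j; positivity)

theorem measurable_mWeight (hM : ∀ j, 0 < M j) : Measurable (mWeight M) :=
  (continuous_mWeight hM).measurable

theorem mWeight_neg (M : Fin n → ℝ) (ξ : Rn n) : mWeight M (-ξ) = mWeight M ξ := by
  simp [mWeight, mNorm]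

theorem abs_apply_le_mWeight_rpow (hM : ∀ j, 0 < M j) (ξ : Rn n) (j : Fin n) :
    |ξ j| ≤ mWeight M ξ ^ (1 / M j) := by
  have h1 : |ξ j| ^ (2 * M j) ≤ mWeight M ξ ^ 2 := by
    rw [mWeight_sq]
    have := Finset.single_le_sum (f := fun j => |ξ j| ^ (2 * M j))
      (fun j _ => Real.rpow_nonneg (abs_nonneg _) _) (Finset.mem_univ j)
    simp only at this
    linarith
  have hMj := hM j
  have h2 := Real.rpow_le_rpow (by positivity) h1 (z := 1 / (2 * M j)) (by positivity)
  rw [← Real.rpow_mul (abs_nonneg _), mul_one_div_cancel (by positivity), Real.rpow_one,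
    ← Real.rpow_natCast, ← Real.rpow_mul (mWeight_pos M ξ).le] at h2
  convert h2 using 2
  push_cast
  field_simp

/-- A sum of powers is controlled up to a factor. -/
theorem add_rpow_le_two_rpow_mul {x y a : ℝ} (hx : 0 ≤ x) (hy : 0 ≤ y) (ha : 0 ≤ a) :
    (x + y) ^ a ≤ 2 ^ a * (x ^ a + y ^ a) := by
  have h : x + y ≤ 2 * max x y := by
    have := le_max_left x y
    have := le_max_right x y
    linarith
  refine (Real.rpow_le_rpow (by positivity) h ha).trans ?_
  rw [Real.mul_rpow (by norm_num) (by positivity)]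
  gcongr
  have h1 := Real.rpow_nonneg hx a
  have h2 := Real.rpow_nonneg hy a
  rcases max_choice x y with h | h <;> rw [h] <;> linarith

/-- The quasi-triangle inequality for the weight, with the homogeneous part of the second vector. -/
theorem exists_mWeight_add_sq_le (hM : ∀ j, 0 < M j) :
    ∃ K : ℝ, 1 ≤ K ∧ ∀ ξ t : Rn n,
      mWeight M (ξ + t) ^ 2 ≤ K * (mWeight M ξ ^ 2 + ∑ j, |t j| ^ (2 * M j)) := by
  -- The sum dominates the constant `2 ^ (2 * M j)` of every coordinate at once; the summand `1`
  -- makes `K ≥ 1`, which covers the constant term of the squared weight.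
  refine ⟨1 + ∑ j, (2 : ℝ) ^ (2 * M j), ?_, fun ξ t => ?_⟩
  · have : 0 ≤ ∑ j, (2 : ℝ) ^ (2 * M j) := Finset.sum_nonneg fun j _ => by positivity
    linarith
  set K := 1 + ∑ j, (2 : ℝ) ^ (2 * M j) with hK
  have hK1 : 1 ≤ K := by
    have : 0 ≤ ∑ j, (2 : ℝ) ^ (2 * M j) := Finset.sum_nonneg fun j _ => by positivity
    linarith
  rw [mWeight_sq, mWeight_sq]
  have hj : ∀ j, |(ξ + t) j| ^ (2 * M j) ≤ K * (|ξ j| ^ (2 * M j) + |t j| ^ (2 * M j)) := by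
    intro j
    have hMj := hM j
    calc |(ξ + t) j| ^ (2 * M j) ≤ (|ξ j| + |t j|) ^ (2 * M j) := by
          refine Real.rpow_le_rpow (abs_nonneg _) ?_ (by positivity)
          simpa using abs_add_le (ξ j) (t j)
      _ ≤ 2 ^ (2 * M j) * (|ξ j| ^ (2 * M j) + |t j| ^ (2 * M j)) :=
          add_rpow_le_two_rpow_mul (abs_nonneg _) (abs_nonneg _) (by positivity)
      _ ≤ _ := by
          gcongr
          have : (2 : ℝ) ^ (2 * M j) ≤ ∑ j, (2 : ℝ) ^ (2 * M j) :=
            Finset.single_le_sum (f := fun j => (2 : ℝ) ^ (2 * M j))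
              (fun j _ => by positivity) (Finset.mem_univ j)
          linarith
  have := Finset.sum_le_sum fun j (_ : j ∈ Finset.univ) => hj j
  rw [← Finset.mul_sum, Finset.sum_add_distrib] at this
  nlinarith

theorem exists_mWeight_add_le (hM : ∀ j, 0 < M j) :
    ∃ K : ℝ, 1 ≤ K ∧ ∀ ξ t : Rn n, mWeight M (ξ + t) ≤ K * (mWeight M ξ + mWeight M t) := by
  obtain ⟨K, hK, h⟩ := exists_mWeight_add_sq_le hM
  refine ⟨K, hK, fun ξ t => ?_⟩
  have h1 := h ξ t
  have h2 := mWeight_sq M t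
  have p1 := one_le_mWeight M ξ
  have p2 := one_le_mWeight M t
  refine abs_le_of_sq_le_sq' ?_ (by positivity) |>.2
  calc mWeight M (ξ + t) ^ 2 ≤ K * (mWeight M ξ ^ 2 + mWeight M t ^ 2) := by
        refine h1.trans ?_
        gcongr
        linarith
    _ ≤ K ^ 2 * (mWeight M ξ + mWeight M t) ^ 2 := by
        gcongr
        · nlinarith
        · nlinarith
    _ = _ := by ring

/-- The weight grows at most polynomially. -/
theorem exists_mWeight_le_one_add_norm_pow (hM : ∀ j, 0 < M j) :
    ∃ k : ℕ, ∃ C : ℝ, 0 < C ∧ ∀ ξ : Rn n, mWeight M ξ ≤ C * (1 + ‖ξ‖) ^ k := by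
  obtain ⟨k, hk⟩ : ∃ k : ℕ, ∀ j, 2 * M j ≤ k := by
    obtain ⟨k, hk⟩ := exists_nat_ge (∑ j, 2 * M j)
    refine ⟨k, fun j => le_trans ?_ hk⟩
    exact Finset.single_le_sum (f := fun j => 2 * M j)
      (fun j _ => by have := hM j; positivity) (Finset.mem_univ j)
  refine ⟨k, 1 + n, by positivity, fun ξ => ?_⟩
  have hb : 1 ≤ (1 + ‖ξ‖) ^ k := one_le_pow₀ (by linarith [norm_nonneg ξ])
  have hs : mWeight M ξ ^ 2 ≤ (1 + n) * (1 + ‖ξ‖) ^ k := by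
    rw [mWeight_sq]
    have : ∑ j, |ξ j| ^ (2 * M j) ≤ ∑ j : Fin n, (1 + ‖ξ‖) ^ k := by
      refine Finset.sum_le_sum fun j _ => ?_
      have hMj := hM j
      have h1 : |ξ j| ≤ 1 + ‖ξ‖ := by
        have := PiLp.norm_apply_le ξ j
        rw [Real.norm_eq_abs] at this
        linarith
      calc |ξ j| ^ (2 * M j) ≤ (1 + ‖ξ‖) ^ (2 * M j) :=
            Real.rpow_le_rpow (abs_nonneg _) h1 (by positivity)
        _ ≤ (1 + ‖ξ‖) ^ (k : ℝ) :=
            Real.rpow_le_rpow_of_exponent_le (by linarith [norm_nonneg ξ]) (hk j)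
        _ = _ := Real.rpow_natCast _ _
    simp only [Finset.sum_const, Finset.card_univ, Fintype.card_fin, nsmul_eq_mul] at this
    nlinarith
  -- A number at least `1` is at most its square, so the bound on the square suffices.
  have := one_le_mWeight M ξ
  nlinarith

/-- Powers of the weight grow at most polynomially. -/
theorem exists_mWeight_rpow_le_one_add_norm_pow (hM : ∀ j, 0 < M j) (s : ℝ) :
    ∃ k : ℕ, ∃ C : ℝ, 0 < C ∧ ∀ ξ : Rn n, mWeight M ξ ^ s ≤ C * (1 + ‖ξ‖) ^ k := by
  obtain ⟨k, C, hC, h⟩ := exists_mWeight_le_one_add_norm_pow hM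
  obtain ⟨l, hl⟩ := exists_nat_ge s
  refine ⟨k * l, C ^ l, by positivity, fun ξ => ?_⟩
  calc mWeight M ξ ^ s ≤ mWeight M ξ ^ (l : ℝ) :=
        Real.rpow_le_rpow_of_exponent_le (one_le_mWeight M ξ) hl
    _ = mWeight M ξ ^ l := Real.rpow_natCast _ _
    _ ≤ (C * (1 + ‖ξ‖) ^ k) ^ l := by gcongr; exacts [(mWeight_pos M ξ).le, h ξ]
    _ = _ := by rw [mul_pow, pow_mul]

/-- The homogeneous dimension `∑ⱼ 1/μⱼ`. -/
def homDim (M : Fin n → ℝ) : ℝ := ∑ j, 1 / M j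

/-- Volumes grow with the exponent ∑ 1/μ_j, whereas the thresholds are stated with n/μ_*; this
comparison is all that the estimates use about n/μ_*. -/
theorem homDim_le (hn : 0 < n) (hM : ∀ j, 0 < M j) : homDim M ≤ n / muMin M := by
  have : Nonempty (Fin n) := ⟨⟨0, hn⟩⟩
  obtain ⟨i, hi⟩ := exists_eq_ciInf_of_finite (f := M)
  have hpos : 0 < muMin M := by unfold muMin; rw [← hi]; exact hM i
  unfold homDim
  calc ∑ j, 1 / M j ≤ ∑ j : Fin n, 1 / muMin M := by
        refine Finset.sum_le_sum fun j _ => ?_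
        exact one_div_le_one_div_of_le hpos (ciInf_le (Finite.bddBelow_range M) j)
    _ = n / muMin M := by simp [div_eq_mul_inv]

theorem volume_abs_le_eq (b : Fin n → ℝ) (hb : ∀ j, 0 ≤ b j) :
    volume {ξ : Rn n | ∀ j, |ξ j| ≤ b j} = ENNReal.ofReal (∏ j, (2 * b j)) := by
  have hs : {ξ : Rn n | ∀ j, |ξ j| ≤ b j}
      = (MeasurableEquiv.toLp 2 (Fin n → ℝ)).symm ⁻¹'
        (Set.univ.pi fun j => Set.Icc (-b j) (b j)) := by
    ext ξ
    simp only [Set.mem_ofPred_eq, abs_le, Set.mem_preimage, Set.mem_pi, Set.mem_univ,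
      forall_true_left, Set.mem_Icc]
    rfl
  rw [hs, (EuclideanSpace.volume_preserving_symm_measurableEquiv_toLp
    (Fin n)).measure_preimage_equiv, Set.pi_univ_Icc, Real.volume_Icc_pi,
    ENNReal.ofReal_prod_of_nonneg]
  · congr! 2 with j
    ring
  · intro j _
    have := hb j
    positivity

/-- The sublevel set lies in the box with half-sides R^{1/μ_j}. -/
theorem volume_mWeight_le (hM : ∀ j, 0 < M j) {R : ℝ} (hR : 0 < R) :
    volume {ξ : Rn n | mWeight M ξ ≤ R} ≤ ENNReal.ofReal (2 ^ n * R ^ homDim M) := by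
  refine (measure_mono (t := {ξ : Rn n | ∀ j, |ξ j| ≤ R ^ (1 / M j)}) fun ξ hξ j => ?_).trans ?_
  · refine (abs_apply_le_mWeight_rpow hM ξ j).trans ?_
    have := hM j
    exact Real.rpow_le_rpow (mWeight_pos M ξ).le hξ (by positivity)
  · rw [volume_abs_le_eq _ fun j => by positivity, Finset.prod_mul_distrib, homDim,
      Real.rpow_sum_of_pos hR]
    simp

theorem min_two_pow_le {R : ℝ} {k : ℤ} (h1 : (2 : ℝ) ^ k ≤ R) (h2 : R < (2 : ℝ) ^ (k + 1))
    (i : ℕ) : min ((2 : ℝ) ^ i / R) (R / 2 ^ i) ≤ 2 * (2⁻¹ : ℝ) ^ ((i : ℤ) - k).natAbs := by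
  have hR : 0 < R := lt_of_lt_of_le (by positivity) h1
  have e : (2⁻¹ : ℝ) ^ ((i : ℤ) - k).natAbs = (2 : ℝ) ^ (-|(i : ℤ) - k|) := by
    rw [zpow_neg, ← inv_zpow, Int.abs_eq_natAbs, zpow_natCast]
  rw [e]
  rcases le_total k i with hik | hik
  · refine (min_le_right _ _).trans ?_
    rw [abs_of_nonneg (by linarith), neg_sub, zpow_sub₀ two_ne_zero, zpow_natCast, ← mul_div_assoc]
    gcongr
    rw [zpow_add_one₀ two_ne_zero] at h2
    linarith
  · refine (min_le_left _ _).trans ?_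
    rw [abs_of_nonpos (by linarith), neg_neg, zpow_sub₀ two_ne_zero, zpow_natCast,
      ← mul_div_assoc]
    have : (0 : ℝ) < 2 ^ k := by positivity
    have h0 : (2 : ℝ) ^ i / R ≤ 2 ^ i / 2 ^ k := by gcongr
    refine h0.trans ?_
    gcongr
    linarith [pow_pos (two_pos (α := ℝ)) i]

/-- The terms decay geometrically on both sides of the dyadic index `k` of `R`. Extending the sum
over `i - k` to all integers gives a bound that does not depend on `k`. -/
theorem exists_tsum_min_rpow_le {ε : ℝ} (hε : 0 < ε) : ∃ C : ℝ≥0∞, C ≠ ⊤ ∧ ∀ R : ℝ, 0 < R →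
    ∑' i : ℕ, ENNReal.ofReal (min ((2 : ℝ) ^ i / R) (R / 2 ^ i) ^ ε) ≤ C := by
  have ha : ((2⁻¹ : ℝ) ^ ε) < 1 := Real.rpow_lt_one (by norm_num) (by norm_num) hε
  have hsum : Summable fun j : ℤ => (2 : ℝ) ^ ε * ((2⁻¹ : ℝ) ^ ε) ^ j.natAbs := by
    refine Summable.mul_left _ ?_
    rw [summable_int_iff_summable_nat_and_neg]
    simpa using summable_geometric_of_lt_one (by positivity) ha
  refine ⟨∑' j : ℤ, ENNReal.ofReal ((2 : ℝ) ^ ε * ((2⁻¹ : ℝ) ^ ε) ^ j.natAbs),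
    hsum.tsum_ofReal_ne_top, fun R hR => ?_⟩
  obtain ⟨k, h1, h2⟩ := exists_mem_Ico_zpow hR one_lt_two
  have hinj : Function.Injective fun i : ℕ => (i : ℤ) - k := fun a b h => by
    simpa using h
  refine le_trans (ENNReal.tsum_le_tsum fun i => ?_) (ENNReal.tsum_comp_le_tsum_of_injective hinj _)
  refine ENNReal.ofReal_le_ofReal ?_
  rw [← Real.rpow_natCast ((2⁻¹ : ℝ) ^ ε), ← Real.rpow_mul (by norm_num), mul_comm ε,
    Real.rpow_mul (by norm_num),
    Real.rpow_natCast, ← Real.mul_rpow (by norm_num) (by positivity)]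
  exact Real.rpow_le_rpow (by positivity) (min_two_pow_le h1 h2 i) hε.le

/-- Uniform bounds over dyadic shells of the weight give bounds for integrals with the kernel
`min (w / R) (R / w) ^ ε`. -/
theorem exists_lintegral_min_rpow_mul_le (hM : ∀ j, 0 < M j) {ε : ℝ} (hε : 0 < ε) :
    ∃ C : ℝ≥0∞, C ≠ ⊤ ∧ ∀ (g : Rn n → ℝ≥0∞) (A : ℝ≥0∞),
      (∀ i : ℕ, ∫⁻ ξ in {ξ | mWeight M ξ ∈ Set.Ico ((2 : ℝ) ^ i) (2 ^ (i + 1))}, g ξ ≤ A) →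
      ∀ R : ℝ, 0 < R →
        ∫⁻ ξ, ENNReal.ofReal (min (mWeight M ξ / R) (R / mWeight M ξ) ^ ε) * g ξ ≤ C * A := by
  obtain ⟨C, hC, h⟩ := exists_tsum_min_rpow_le hε
  refine ⟨ENNReal.ofReal (2 ^ ε) * C, ENNReal.mul_ne_top ENNReal.ofReal_ne_top hC,
    fun g A hg R hR => ?_⟩
  have hU : (⋃ i : ℕ, {ξ : Rn n | mWeight M ξ ∈ Set.Ico ((2 : ℝ) ^ i) (2 ^ (i + 1))})
      = Set.univ := by
    rw [Set.eq_univ_iff_forall]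
    intro ξ
    obtain ⟨i, hi⟩ := exists_nat_pow_near (one_le_mWeight M ξ) one_lt_two
    exact Set.mem_iUnion.2 ⟨i, hi⟩
  rw [← setLIntegral_univ, ← hU]
  refine (lintegral_iUnion_le _ _).trans ?_
  -- On one shell the weight may be replaced by `2 ^ i` in both ratios at the cost of a factor 2,
  -- which makes the kernel constant there.
  have hi : ∀ i : ℕ, ∫⁻ ξ in {ξ | mWeight M ξ ∈ Set.Ico ((2 : ℝ) ^ i) (2 ^ (i + 1))},
      ENNReal.ofReal (min (mWeight M ξ / R) (R / mWeight M ξ) ^ ε) * g ξ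
        ≤ ENNReal.ofReal (2 ^ ε) * A * ENNReal.ofReal (min ((2 : ℝ) ^ i / R) (R / 2 ^ i) ^ ε) := by
    intro i
    calc _ ≤ ∫⁻ ξ in {ξ | mWeight M ξ ∈ Set.Ico ((2 : ℝ) ^ i) (2 ^ (i + 1))},
          ENNReal.ofReal ((2 * min ((2 : ℝ) ^ i / R) (R / 2 ^ i)) ^ ε) * g ξ := by
          refine setLIntegral_mono' (measurable_mWeight hM measurableSet_Ico) fun ξ hξ => ?_
          have hw := mWeight_pos M ξ
          gcongr
          have h2i : (0 : ℝ) < 2 ^ i := by positivity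
          rw [mul_min_of_nonneg _ _ two_pos.le]
          obtain ⟨hl, hu⟩ := hξ
          refine min_le_min ?_ ?_
          · rw [← mul_div_assoc]
            gcongr
            rw [pow_succ] at hu
            linarith
          · have : R / mWeight M ξ ≤ R / 2 ^ i := by gcongr
            have : 0 ≤ R / 2 ^ i := by positivity
            linarith
      _ = ENNReal.ofReal ((2 * min ((2 : ℝ) ^ i / R) (R / 2 ^ i)) ^ ε) *
          ∫⁻ ξ in {ξ | mWeight M ξ ∈ Set.Ico ((2 : ℝ) ^ i) (2 ^ (i + 1))}, g ξ :=
          lintegral_const_mul' _ _ ENNReal.ofReal_ne_top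
      _ ≤ ENNReal.ofReal ((2 * min ((2 : ℝ) ^ i / R) (R / 2 ^ i)) ^ ε) * A := by
          gcongr; exact hg i
      _ = _ := by
          rw [Real.mul_rpow two_pos.le (by positivity), ENNReal.ofReal_mul (by positivity)]
          ring
  refine (ENNReal.tsum_le_tsum hi).trans ?_
  rw [ENNReal.tsum_mul_left]
  calc _ ≤ ENNReal.ofReal (2 ^ ε) * A * C := by gcongr; exact h R hR
    _ = _ := by ring

end

/-! ### Hölder–Schur tests and the pointwise comparison of weights. -/

section

/-- **Hölder–Schur test**: a kernel that factors as `b * W`, with `b x` bounded in `L^q` and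
`W · y` bounded in `L^p`, acts boundedly on `L^p`. -/
theorem eLpNorm_lintegral_mul_le {X Y : Type*} [MeasurableSpace X] [MeasurableSpace Y]
    {μ : Measure X} {ν : Measure Y} [SFinite μ] [SFinite ν] {p q : ℝ≥0∞}
    (hpq : p⁻¹ + q⁻¹ = 1) {b W : X → Y → ℝ≥0∞}
    (hb : ∀ x, Measurable (b x)) (hW : Measurable (Function.uncurry W)) {C₁ C₂ : ℝ≥0∞}
    (h1 : ∀ᵐ x ∂μ, eLpNorm (b x) q ν ≤ C₁) (h2 : ∀ᵐ y ∂ν, eLpNorm (fun x => W x y) p μ ≤ C₂)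
    {V : Y → ℝ≥0∞} (hV : Measurable V) :
    eLpNorm (fun x => ∫⁻ y, b x y * W x y * V y ∂ν) p μ ≤ C₁ * C₂ * eLpNorm V p ν := by
  have hWx : ∀ x, Measurable (W x) := fun x => hW.comp measurable_prodMk_left
  have hWy : ∀ y, Measurable fun x => W x y := fun y => hW.comp measurable_prodMk_right
  rcases eq_or_ne p ⊤ with rfl | hp
  · obtain rfl : q = 1 := by simpa using hpq
    simp only [eLpNorm_one_eq_lintegral_enorm, enorm_eq_self, eLpNorm_exponent_top,
      eLpNormEssSup] at h1 h2 ⊢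
    -- The hypothesis bounds `W` for almost every `y` first; joint measurability permits the
    -- exchange of the two quantifiers.
    have h3 : ∀ᵐ x ∂μ, ∀ᵐ y ∂ν, W x y ≤ C₂ := by
      have hm : MeasurableSet {z : X × Y | W z.1 z.2 ≤ C₂} := measurableSet_le hW measurable_const
      rw [Measure.ae_ae_comm hm]
      filter_upwards [h2] with y hy
      filter_upwards [ENNReal.ae_le_essSup fun x => W x y] with x hx
      exact hx.trans hy
    refine essSup_le_of_ae_le _ ?_
    filter_upwards [h1, h3] with x hx1 hx3
    calc ∫⁻ y, b x y * W x y * V y ∂ν ≤ ∫⁻ y, b x y * (C₂ * essSup V ν) ∂ν := by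
          refine lintegral_mono_ae ?_
          filter_upwards [hx3, ENNReal.ae_le_essSup V] with y e1 e2
          rw [mul_assoc]
          gcongr
      _ = (∫⁻ y, b x y ∂ν) * (C₂ * essSup V ν) := lintegral_mul_const _ (hb x)
      _ ≤ C₁ * (C₂ * essSup V ν) := by gcongr
      _ = _ := by ring
  · have hp0 : p ≠ 0 := by
      rintro rfl; simp at hpq
    have hP : 0 < p.toReal := ENNReal.toReal_pos hp0 hp
    -- Hölder in `y` for fixed `x`. After raising to the power `p`, Tonelli lets `W ^ p` be
    -- integrated in `x` first, which is the quantity in `h2`.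
    have key : ∀ᵐ x ∂μ, ∫⁻ y, b x y * W x y * V y ∂ν
        ≤ C₁ * (∫⁻ y, (W x y * V y) ^ p.toReal ∂ν) ^ (1 / p.toReal) := by
      filter_upwards [h1] with x hx
      rcases eq_or_ne q ⊤ with rfl | hq
      · obtain rfl : p = 1 := by simpa using hpq
        simp only [ENNReal.toReal_one, ENNReal.rpow_one, one_div_one]
        rw [← lintegral_const_mul C₁ (f := fun y => W x y * V y) ((hWx x).mul hV)]
        refine lintegral_mono_ae ?_
        simp only [eLpNorm_exponent_top, eLpNormEssSup, enorm_eq_self] at hx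
        filter_upwards [ENNReal.ae_le_essSup (b x)] with y e
        rw [mul_assoc]
        gcongr
        exact e.trans hx
      · have hq0 : q ≠ 0 := by
          rintro rfl; simp at hpq
        have hPQ : q.toReal.HolderConjugate p.toReal := by
          have : ENNReal.HolderConjugate q p := by
            rw [ENNReal.holderConjugate_iff, add_comm, hpq]
          exact ENNReal.HolderConjugate.toReal_of_ne_top hq hp
        have := ENNReal.lintegral_mul_le_Lp_mul_Lq ν hPQ (hb x).aemeasurable
          ((hWx x).mul hV).aemeasurable
        simp only [Pi.mul_apply] at this
        simp only [mul_assoc]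
        refine this.trans ?_
        gcongr
        rw [eLpNorm_eq_lintegral_rpow_enorm_toReal hq0 hq] at hx
        simpa using hx
    rw [eLpNorm_eq_lintegral_rpow_enorm_toReal hp0 hp, eLpNorm_eq_lintegral_rpow_enorm_toReal hp0 hp]
    simp only [enorm_eq_self]
    have hmm : Measurable fun z : X × Y => (W z.1 z.2 * V z.2) ^ p.toReal :=
      (Measurable.mul hW (hV.comp measurable_snd)).pow_const _
    calc (∫⁻ x, (∫⁻ y, b x y * W x y * V y ∂ν) ^ p.toReal ∂μ) ^ (1 / p.toReal)
        ≤ (∫⁻ x, C₁ ^ p.toReal * ∫⁻ y, (W x y * V y) ^ p.toReal ∂ν ∂μ) ^ (1 / p.toReal) := by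
          gcongr 1
          refine lintegral_mono_ae ?_
          filter_upwards [key] with x hx
          refine (ENNReal.rpow_le_rpow hx hP.le).trans_eq ?_
          rw [ENNReal.mul_rpow_of_nonneg _ _ hP.le, ← ENNReal.rpow_mul, one_div_mul_cancel hP.ne',
            ENNReal.rpow_one]
      _ = (C₁ ^ p.toReal * ∫⁻ y, ∫⁻ x, (W x y * V y) ^ p.toReal ∂μ ∂ν) ^ (1 / p.toReal) := by
          rw [lintegral_const_mul _ hmm.lintegral_prod_right', lintegral_lintegral_swap]
          exact hmm.aemeasurable
      _ ≤ (C₁ ^ p.toReal * ∫⁻ y, C₂ ^ p.toReal * V y ^ p.toReal ∂ν) ^ (1 / p.toReal) := by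
          gcongr 2
          refine lintegral_mono_ae ?_
          filter_upwards [h2] with y hy
          simp only [ENNReal.mul_rpow_of_nonneg _ _ hP.le]
          rw [lintegral_mul_const _ ((hWy y).pow_const _)]
          gcongr
          rw [eLpNorm_eq_lintegral_rpow_enorm_toReal hp0 hp] at hy
          have := ENNReal.rpow_le_rpow hy hP.le
          rwa [← ENNReal.rpow_mul, one_div_mul_cancel hP.ne', ENNReal.rpow_one] at this
      _ = _ := by
          rw [lintegral_const_mul _ (hV.pow_const _), ← mul_assoc,
            ENNReal.mul_rpow_of_nonneg _ _ (by positivity),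
            ENNReal.mul_rpow_of_nonneg _ _ (by positivity), ← ENNReal.rpow_mul, ← ENNReal.rpow_mul,
            mul_one_div_cancel hP.ne', ENNReal.rpow_one, ENNReal.rpow_one]

/-- For `t = ⊤` the exponent is `0` and both powers are the constant `1`; this lets the Schur test
treat the endpoint exponents like the others. -/
theorem eLpNorm_rpow_inv_toReal_le {Z : Type*} [MeasurableSpace Z] {ρ : Measure Z} {t : ℝ≥0∞}
    (ht : t ≠ 0) {g : Z → ℝ≥0∞} {A : ℝ≥0∞} (hg : ∫⁻ z, g z ∂ρ ≤ A) :
    eLpNorm (fun z => g z ^ (t⁻¹).toReal) t ρ ≤ A ^ (t⁻¹).toReal := by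
  rcases eq_or_ne t ⊤ with rfl | ht'
  · simp only [ENNReal.inv_top, ENNReal.toReal_zero, ENNReal.rpow_zero, eLpNorm_exponent_top,
      eLpNormEssSup]
    exact essSup_le_of_ae_le _ (by filter_upwards with z; simp)
  · rw [eLpNorm_eq_lintegral_rpow_enorm_toReal ht ht']
    have hT : 0 < t.toReal := ENNReal.toReal_pos ht ht'
    simp only [enorm_eq_self, ← ENNReal.rpow_mul, ENNReal.toReal_inv,
      inv_mul_cancel₀ hT.ne', ENNReal.rpow_one, one_div]
    gcongr

/-- **Schur test**. -/
theorem eLpNorm_lintegral_mul_le_of_schur {X Y : Type*} [MeasurableSpace X] [MeasurableSpace Y]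
    {μ : Measure X} {ν : Measure Y} [SFinite μ] [SFinite ν] {p q : ℝ≥0∞}
    (hpq : p⁻¹ + q⁻¹ = 1) {k : X → Y → ℝ≥0∞} (hk : Measurable (Function.uncurry k))
    {A : ℝ≥0∞} (h1 : ∀ᵐ x ∂μ, ∫⁻ y, k x y ∂ν ≤ A) (h2 : ∀ᵐ y ∂ν, ∫⁻ x, k x y ∂μ ≤ A)
    {V : Y → ℝ≥0∞} (hV : Measurable V) :
    eLpNorm (fun x => ∫⁻ y, k x y * V y ∂ν) p μ
      ≤ A ^ (q⁻¹).toReal * A ^ (p⁻¹).toReal * eLpNorm V p ν := by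
  have hp0 : p ≠ 0 := by rintro rfl; simp at hpq
  have hq0 : q ≠ 0 := by rintro rfl; simp at hpq
  have hsum : (q⁻¹).toReal + (p⁻¹).toReal = 1 := by
    rw [← ENNReal.toReal_add (by simpa) (by simpa), add_comm, hpq, ENNReal.toReal_one]
  -- The kernel is factored as k = k^{1/q} k^{1/p}.
  have h := eLpNorm_lintegral_mul_le (μ := μ) (ν := ν) hpq
    (b := fun x y => k x y ^ (q⁻¹).toReal) (W := fun x y => k x y ^ (p⁻¹).toReal)
    (C₁ := A ^ (q⁻¹).toReal) (C₂ := A ^ (p⁻¹).toReal)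
    (fun x => (hk.comp measurable_prodMk_left).pow_const _) (hk.pow_const _)
    (by filter_upwards [h1] with x hx using eLpNorm_rpow_inv_toReal_le hq0 hx)
    (by filter_upwards [h2] with y hy using eLpNorm_rpow_inv_toReal_le hp0 hy) hV
  refine le_trans (le_of_eq ?_) h
  congr! 4 with x y
  rw [← ENNReal.rpow_add_of_nonneg _ _ ENNReal.toReal_nonneg ENNReal.toReal_nonneg, hsum,
    ENNReal.rpow_one]

/-- An upper bound on `u` makes `u` at most C² times each of 1/u and u. The minimum of these is at
most `1`, so the exponent may be lowered to `ε`. -/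
theorem rpow_le_mul_min_rpow {C u ε s : ℝ} (hC : 1 ≤ C) (hu : 0 < u) (huC : u ≤ C)
    (hε : 0 < ε) (hεs : ε ≤ s) : u ^ s ≤ C ^ (2 * s) * min u⁻¹ u ^ ε := by
  have h1 : u ≤ C ^ 2 * min u⁻¹ u := by
    rw [mul_min_of_nonneg _ _ (by positivity)]
    refine le_min ?_ ?_
    · rw [← div_eq_mul_inv, le_div_iff₀ hu]
      nlinarith
    · nlinarith [one_le_pow₀ hC (n := 2)]
  have hm : 0 < min u⁻¹ u := lt_min (inv_pos.2 hu) hu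
  have hm1 : min u⁻¹ u ≤ 1 := by
    rcases le_total u 1 with h | h
    · exact (min_le_right _ _).trans h
    · exact (min_le_left _ _).trans (inv_le_one_of_one_le₀ h)
  calc u ^ s ≤ (C ^ 2 * min u⁻¹ u) ^ s := Real.rpow_le_rpow hu.le h1 (by linarith)
    _ = C ^ (2 * s) * min u⁻¹ u ^ s := by
        rw [Real.mul_rpow (by positivity) hm.le, Real.rpow_mul (by positivity), Real.rpow_two]
    _ ≤ _ := by
        gcongr ?_ * ?_
        exact Real.rpow_le_rpow_of_exponent_ge hm hm1 hεs

/-- The comparison of weights behind the splitting of the operator, for `0 < s < r`. -/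
theorem weight_split_of_pos {K κ r δ s : ℝ} (hK : 1 ≤ K) (hκ : κ < r) (hδ : δ ≤ 1)
    (hs : 0 < s) (hsr : s < r) : ∃ C ε : ℝ, 0 < C ∧ 0 < ε ∧ ∀ x y z : ℝ, 1 ≤ x → 1 ≤ y → 1 ≤ z →
      x ≤ K * (z + y) → z ≤ K * (x + y) →
      x ^ s * y ^ (-s) ≤ C * min (y / x) (x / y) ^ ε ∨
      x ^ s * y ^ (-s) ≤ C * min (y / x) (x / y) ^ ε * y ^ (-κ) *
        (z ^ r * y ^ (-(δ * (r - κ)))) := by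
  have hr : 0 < r := hs.trans hsr
  refine ⟨max ((K * (1 + 2 * K)) ^ (2 * s)) ((2 * K) ^ r), min s (r - s), by positivity,
    lt_min hs (by linarith), fun x y z hx hy hz h1 h2 => ?_⟩
  have hx0 : 0 < x := by linarith
  have hy0 : 0 < y := by linarith
  have hz0 : 0 < z := by linarith
  have hm : 0 < min (y / x) (x / y) := lt_min (by positivity) (by positivity)
  have e : x ^ s * y ^ (-s) = (x / y) ^ s := by
    rw [Real.div_rpow hx0.le hy0.le, Real.rpow_neg hy0.le, div_eq_mul_inv]
  -- Here `x`, `y`, `z` stand for ⟨η⟩, ⟨ξ⟩, ⟨η - ξ⟩. If `z` is at most of order `y`, then so is `x`,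
  -- and the positive power of `x / y` gives the decay. Otherwise the second triangle inequality
  -- forces `y ≤ x`, and `x` is at most of order `z`.
  rcases le_or_gt z (2 * K * y) with h | h
  · left
    have hu : x / y ≤ K * (1 + 2 * K) := by
      rw [div_le_iff₀ hy0]
      nlinarith
    have := rpow_le_mul_min_rpow (by nlinarith) (div_pos hx0 hy0) hu
      (lt_min hs (by linarith) : 0 < min s (r - s)) (min_le_left _ _)
    rw [inv_div] at this
    rw [e]
    refine this.trans ?_
    gcongr
    exact le_max_left _ _
  · right
    have hyx : y ≤ x := by nlinarith
    have hxz : x ≤ 2 * K * z := by nlinarith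
    have hmin : min (y / x) (x / y) = y / x := by
      refine min_eq_left ?_
      rw [div_le_div_iff₀ hx0 hy0]
      nlinarith
    have hle1 : y / x ≤ 1 := by rw [div_le_one hx0]; exact hyx
    rw [hmin]
    have a1 : (y / x) ^ (r - s) ≤ (y / x) ^ min s (r - s) :=
      Real.rpow_le_rpow_of_exponent_ge (by positivity) hle1 (min_le_right _ _)
    have a2 : x ^ r ≤ (2 * K) ^ r * z ^ r := by
      rw [← Real.mul_rpow (by positivity) hz0.le]
      exact Real.rpow_le_rpow hx0.le hxz hr.le
    have a3 : y ^ (-(r - κ)) ≤ y ^ (-(δ * (r - κ))) :=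
      Real.rpow_le_rpow_of_exponent_le hy (by nlinarith)
    -- The decay comes from `s < r`. The power `x ^ r` is passed to `z ^ r`, and `δ ≤ 1` permits the
    -- weaker power of `y`.
    calc x ^ s * y ^ (-s) = (y / x) ^ (r - s) * y ^ (-κ) * (x ^ r * y ^ (-(r - κ))) := by
          rw [Real.div_rpow hy0.le hx0.le, div_eq_mul_inv, ← Real.rpow_neg hx0.le]
          have ex : x ^ s = x ^ (-(r - s)) * x ^ r := by
            rw [← Real.rpow_add hx0]; congr 1; ring
          have ey : y ^ (-s) = y ^ (r - s) * y ^ (-κ) * y ^ (-(r - κ)) := by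
            rw [← Real.rpow_add hy0, ← Real.rpow_add hy0]; congr 1; ring
          rw [ex, ey]; ring
      _ ≤ (y / x) ^ min s (r - s) * y ^ (-κ) *
          (((2 * K) ^ r * z ^ r) * y ^ (-(δ * (r - κ)))) := by gcongr
      _ = (2 * K) ^ r * (y / x) ^ min s (r - s) * y ^ (-κ) *
          (z ^ r * y ^ (-(δ * (r - κ)))) := by ring
      _ ≤ _ := by
          gcongr
          exact le_max_right _ _

/-- The comparison of weights behind the splitting of the operator, for `δ < 1`. -/
theorem weight_split_of_lt_one {K κ r δ s : ℝ} (hK : 1 ≤ K) (hκ0 : 0 ≤ κ) (hκ : κ < r)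
    (hδ : δ < 1) (hs : (δ - 1) * (r - κ) < s) (hsr : s ≤ r) :
    ∃ C ε : ℝ, 0 < C ∧ 0 < ε ∧ ∀ x y z : ℝ, 1 ≤ x → 1 ≤ y → 1 ≤ z →
      x ≤ K * (z + y) → y ≤ K * (x + z) →
      x ^ s * y ^ (-s) ≤ C * min (y / x) (x / y) ^ ε ∨
      x ^ s * y ^ (-s) ≤ C * min (y / 1) (1 / y) ^ ε * y ^ (-κ) *
        (z ^ r * y ^ (-(δ * (r - κ)))) := by
  have hr : 0 < r := by linarith
  have hδκ : 0 < (1 - δ) * (r - κ) := mul_pos (by linarith) (by linarith)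
  -- For `s ≤ 0` this is the distance of `s` from the lower end of the interval; for `s ≥ 0` it is
  -- the full gap left by `δ < 1`.
  set ε := (1 - δ) * (r - κ) + min s 0 with hεdef
  have hε : 0 < ε := by
    rcases min_choice s 0 with h | h <;> rw [hεdef, h] <;> linarith
  have h2K : 1 ≤ 2 * K := by linarith
  refine ⟨(2 * K) ^ (|s| + ε) + (3 * K ^ 2) ^ |s| * (2 * K) ^ r + (2 * K) ^ r, ε, by positivity, hε,
    fun x y z hx hy hz h1 h2 => ?_⟩
  have hx0 : 0 < x := by linarith
  have hy0 : 0 < y := by linarith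
  have hz0 : 0 < z := by linarith
  -- If `z` is small against `y`, then `x` and `y` are comparable and the minimum is bounded below.
  -- Otherwise `x` and `y` are both at most of order `z`, and a surplus `y ^ (-ε)` remains: the
  -- decay is measured from the fixed scale `1` instead of `x`, which is why `s = r` is allowed.
  rcases le_or_gt (2 * K * z) y with h | h
  · left
    have hyx : y ≤ 2 * K * x := by nlinarith
    have hxy : x ≤ 2 * K * y := by nlinarith
    have hm : (2 * K)⁻¹ ≤ min (y / x) (x / y) := by
      refine le_min ?_ ?_
      · rw [le_div_iff₀ hx0, inv_mul_le_iff₀ (by positivity)]; exact hxy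
      · rw [le_div_iff₀ hy0, inv_mul_le_iff₀ (by positivity)]; exact hyx
    have e : x ^ s * y ^ (-s) = (x / y) ^ s := by
      rw [Real.div_rpow hx0.le hy0.le, Real.rpow_neg hy0.le, div_eq_mul_inv]
    have a1 : (x / y) ^ s ≤ (2 * K) ^ |s| := by
      rcases le_total 0 s with hs0 | hs0
      · rw [abs_of_nonneg hs0]
        exact Real.rpow_le_rpow (by positivity) ((div_le_iff₀ hy0).2 hxy) hs0
      · rw [abs_of_nonpos hs0, ← inv_div, Real.inv_rpow (by positivity), ← Real.rpow_neg (by positivity)]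
        exact Real.rpow_le_rpow (by positivity) ((div_le_iff₀ hx0).2 hyx) (by linarith)
    have a2 : (2 * K)⁻¹ ^ ε ≤ min (y / x) (x / y) ^ ε :=
      Real.rpow_le_rpow (by positivity) hm hε.le
    rw [e]
    calc (x / y) ^ s ≤ (2 * K) ^ |s| := a1
      _ = (2 * K) ^ (|s| + ε) * (2 * K)⁻¹ ^ ε := by
          rw [Real.inv_rpow (by positivity), Real.rpow_add (by positivity)]
          field_simp
      _ ≤ (2 * K) ^ (|s| + ε) * min (y / x) (x / y) ^ ε := by gcongr
      _ ≤ _ := by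
          gcongr
          have : 0 ≤ (3 * K ^ 2) ^ |s| * (2 * K) ^ r := by positivity
          have : 0 ≤ (2 * K) ^ r := by positivity
          linarith
  · right
    have hxz : x ≤ 3 * K ^ 2 * z := by nlinarith
    have hmin : min (y / 1) (1 / y) = y⁻¹ := by
      rw [div_one, one_div]
      exact min_eq_right ((inv_le_one_of_one_le₀ hy).trans hy)
    rw [hmin, Real.inv_rpow hy0.le, ← Real.rpow_neg hy0.le]
    have hyz : y / z ≤ 2 * K := (div_le_iff₀ hz0).2 h.le
    rcases le_total 0 s with hs0 | hs0
    · have hε' : ε = (1 - δ) * (r - κ) := by rw [hεdef, min_eq_right hs0, add_zero]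
      calc x ^ s * y ^ (-s) ≤ ((3 * K ^ 2) ^ s * z ^ s) * y ^ (-s) := by
            gcongr
            rw [← Real.mul_rpow (by positivity) hz0.le]
            exact Real.rpow_le_rpow hx0.le hxz hs0
        _ = (3 * K ^ 2) ^ s * (y / z) ^ (r - s) * y ^ (-ε) * y ^ (-κ) *
            (z ^ r * y ^ (-(δ * (r - κ)))) := by
            rw [Real.div_rpow hy0.le hz0.le, div_eq_mul_inv, ← Real.rpow_neg hz0.le]
            have ez : z ^ s = z ^ (-(r - s)) * z ^ r := by
              rw [← Real.rpow_add hz0]; congr 1; ring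
            have ey : y ^ (-s) = y ^ (r - s) * y ^ (-ε) * y ^ (-κ) * y ^ (-(δ * (r - κ))) := by
              rw [← Real.rpow_add hy0, ← Real.rpow_add hy0, ← Real.rpow_add hy0]; congr 1
              rw [hε']; ring
            rw [ez, ey]; ring
        _ ≤ (3 * K ^ 2) ^ |s| * (2 * K) ^ r * y ^ (-ε) * y ^ (-κ) *
            (z ^ r * y ^ (-(δ * (r - κ)))) := by
            gcongr ?_ * ?_ * _ * _ * _
            · rw [abs_of_nonneg hs0]
            · calc (y / z) ^ (r - s) ≤ (2 * K) ^ (r - s) :=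
                    Real.rpow_le_rpow (by positivity) hyz (by linarith)
                _ ≤ _ := Real.rpow_le_rpow_of_exponent_le h2K (by linarith)
        _ ≤ _ := by
            gcongr
            have : 0 ≤ (2 * K) ^ (|s| + ε) := by positivity
            have : 0 ≤ (2 * K) ^ r := by positivity
            linarith
    · have hε' : ε = (1 - δ) * (r - κ) + s := by rw [hεdef, min_eq_left hs0]
      calc x ^ s * y ^ (-s) ≤ 1 * y ^ (-s) := by
            gcongr
            exact Real.rpow_le_one_of_one_le_of_nonpos hx hs0
        _ = (y / z) ^ r * y ^ (-ε) * y ^ (-κ) * (z ^ r * y ^ (-(δ * (r - κ)))) := by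
            rw [Real.div_rpow hy0.le hz0.le]
            have ey : y ^ (-s) = y ^ r * y ^ (-ε) * y ^ (-κ) * y ^ (-(δ * (r - κ))) := by
              rw [← Real.rpow_add hy0, ← Real.rpow_add hy0, ← Real.rpow_add hy0]; congr 1
              rw [hε']; ring
            rw [ey]; field_simp
        _ ≤ (2 * K) ^ r * y ^ (-ε) * y ^ (-κ) * (z ^ r * y ^ (-(δ * (r - κ)))) := by
            gcongr
        _ ≤ _ := by
            gcongr
            have : 0 ≤ (2 * K) ^ (|s| + ε) := by positivity
            have : 0 ≤ (3 * K ^ 2) ^ |s| * (2 * K) ^ r := by positivity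
            linarith

end

/-! ### Separation of functions on the product space by products of test functions. -/

section

variable {n : ℕ}

/-- Measurable functions of `(ζ, ξ)` that are integrable in `ζ`, locally boundedly in `ξ`. -/
structure SliceIntegrable (f : Rn n × Rn n → ℂ) : Prop where
  measurable : Measurable f
  bound : ∀ R : ℝ, ∃ C : ℝ≥0∞, C ≠ ⊤ ∧ ∀ ξ : Rn n, ‖ξ‖ ≤ R → ∫⁻ ζ, ‖f (ζ, ξ)‖ₑ ≤ C

theorem SliceIntegrable.integrableOn {f : Rn n × Rn n → ℂ} (hf : SliceIntegrable f) (R : ℝ) :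
    Integrable f (volume.prod (volume.restrict (Metric.closedBall 0 R))) := by
  refine ⟨hf.measurable.aestronglyMeasurable, ?_⟩
  obtain ⟨C, hC, h⟩ := hf.bound R
  rw [HasFiniteIntegral, lintegral_prod_symm _ hf.measurable.enorm.aemeasurable]
  calc _ ≤ ∫⁻ ξ in Metric.closedBall (0 : Rn n) R, C :=
        setLIntegral_mono' Metric.isClosed_closedBall.measurableSet
          fun ξ hξ => h ξ (by simpa using hξ)
    _ = C * volume (Metric.closedBall (0 : Rn n) R) := setLIntegral_const _ _
    _ < ⊤ := ENNReal.mul_lt_top hC.lt_top measure_closedBall_lt_top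

theorem SliceIntegrable.integrable_slice {f : Rn n × Rn n → ℂ} (hf : SliceIntegrable f) (ξ : Rn n) :
    Integrable fun ζ => f (ζ, ξ) := by
  obtain ⟨C, hC, h⟩ := hf.bound ‖ξ‖
  exact ⟨(hf.measurable.comp measurable_prodMk_right).aestronglyMeasurable,
    (h ξ le_rfl).trans_lt hC.lt_top⟩

theorem exists_support_closedBall {w : Rn n → ℝ} (hw : HasCompactSupport w) :
    ∃ R : ℝ, 0 ≤ R ∧ ∀ ξ, ξ ∉ Metric.closedBall (0 : Rn n) R → w ξ = 0 := by
  obtain ⟨R, hR⟩ := hw.isCompact.isBounded.subset_closedBall (0 : Rn n)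
  refine ⟨max R 0, le_max_right _ _, fun ξ hξ => ?_⟩
  by_contra hne
  exact hξ (Metric.closedBall_subset_closedBall (le_max_left _ _)
    (hR (subset_tsupport _ (Function.mem_support.2 hne))))

/-- Products of test functions separate functions on the product space. -/
theorem ae_eq_zero_of_forall_tensor {H : Rn n × Rn n → ℂ}
    (hH : ∀ R : ℝ, Integrable H (volume.prod (volume.restrict (Metric.closedBall 0 R))))
    (h : ∀ ψ w : Rn n → ℝ, ContDiff ℝ ∞ ψ → HasCompactSupport ψ → ContDiff ℝ ∞ w →
      HasCompactSupport w → ∫ ξ, w ξ • ∫ ζ, ψ ζ • H (ζ, ξ) = 0) : H =ᵐ[volume] 0 := by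
  -- the product with a test function of `ξ` is integrable
  have hwH : ∀ w : Rn n → ℝ, ContDiff ℝ ∞ w → HasCompactSupport w →
      Integrable fun z : Rn n × Rn n => w z.2 • H z := by
    intro w hw hwc
    obtain ⟨R, hR0, hR⟩ := exists_support_closedBall hwc
    obtain ⟨B, hB⟩ := hwc.exists_bound_of_continuous hw.continuous
    have h1 : Integrable (fun z : Rn n × Rn n => w z.2 • H z)
        (volume.prod (volume.restrict (Metric.closedBall 0 R))) :=
      (hH R).bdd_smul B ((hw.continuous.comp continuous_snd).aestronglyMeasurable)
        (Filter.Eventually.of_forall fun z => hB z.2)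
    have h2 : (volume : Measure (Rn n)).prod (volume.restrict (Metric.closedBall (0 : Rn n) R))
        = (volume : Measure (Rn n × Rn n)).restrict (Set.univ ×ˢ Metric.closedBall 0 R) := by
      rw [Measure.volume_eq_prod, ← Measure.prod_restrict, Measure.restrict_univ]
    rw [h2] at h1
    refine (integrableOn_iff_integrable_of_support_subset fun z hz => ?_).1 h1
    refine ⟨trivial, ?_⟩
    by_contra hne
    exact hz (by simp [hR _ hne])
  -- The two test functions are freed one at a time: with `w` fixed, varying `ψ` kills the partial
  -- integral for almost every `ζ`.
  have step1 : ∀ w : Rn n → ℝ, ContDiff ℝ ∞ w → HasCompactSupport w →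
      (fun ζ => ∫ ξ, w ξ • H (ζ, ξ)) =ᵐ[volume] 0 := by
    intro w hw hwc
    have hi := hwH w hw hwc
    refine ae_eq_zero_of_integral_contDiff_smul_eq_zero (hi.integral_prod_left).locallyIntegrable ?_
    intro ψ hψ hψc
    rw [← h ψ w hψ hψc hw hwc]
    obtain ⟨B, hB⟩ := hψc.exists_bound_of_continuous hψ.continuous
    have hi2 : Integrable fun z : Rn n × Rn n => ψ z.1 • w z.2 • H z :=
      hi.bdd_smul B (hψ.continuous.comp continuous_fst).aestronglyMeasurable
        (Filter.Eventually.of_forall fun z => hB z.1)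
    simp_rw [← integral_smul]
    rw [integral_integral_swap hi2]
    congr! 4
    rw [smul_comm]
  -- That vanishing may now be integrated over any measurable `A`, and varying `w` gives vanishing
  -- for almost every `ξ`. Integrals over rectangles are then zero, and rectangles form a generating
  -- π-system.
  have step2 : ∀ A : Set (Rn n), MeasurableSet A →
      (fun ξ => ∫ ζ in A, H (ζ, ξ)) =ᵐ[volume] 0 := by
    intro A hA
    refine ae_eq_zero_of_integral_contDiff_smul_eq_zero ?_ ?_
    · intro ξ₀
      refine ⟨Metric.closedBall 0 (‖ξ₀‖ + 1),
        Metric.closedBall_mem_nhds_of_mem (by simp [Metric.mem_ball]), ?_⟩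
      have := (hH (‖ξ₀‖ + 1)).integrableOn (s := A ×ˢ Set.univ)
      rw [IntegrableOn, ← Measure.prod_restrict, Measure.restrict_univ] at this
      exact this.integral_prod_right
    · intro w hw hwc
      have hi := (hwH w hw hwc).integrableOn (s := A ×ˢ Set.univ)
      rw [IntegrableOn, Measure.volume_eq_prod, ← Measure.prod_restrict, Measure.restrict_univ] at hi
      simp_rw [← integral_smul]
      rw [← integral_integral_swap hi]
      have := ae_restrict_of_ae (s := A) (step1 w hw hwc)
      rw [integral_congr_ae this]
      simp
  have step3 : ∀ R : ℝ, ∀ S : Set (Rn n × Rn n), MeasurableSet S →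
      ∫ z in S, H z ∂(volume.prod (volume.restrict (Metric.closedBall 0 R))) = 0 := by
    intro R
    have hrect : ∀ A B : Set (Rn n), MeasurableSet A → MeasurableSet B →
        ∫ z in A ×ˢ B, H z ∂(volume.prod (volume.restrict (Metric.closedBall 0 R))) = 0 := by
      intro A B hA hB
      have hi := (hH R).integrableOn (s := A ×ˢ B)
      rw [IntegrableOn, ← Measure.prod_restrict] at hi
      rw [← Measure.prod_restrict, integral_prod_symm _ hi]
      have := ae_restrict_of_ae (s := B) (ae_restrict_of_ae (s := Metric.closedBall 0 R) (step2 A hA))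
      rw [integral_congr_ae this]
      simp
    intro S hS
    induction S, hS using MeasurableSpace.induction_on_inter generateFrom_prod.symm isPiSystem_prod with
    | empty => simp
    | basic t ht =>
      obtain ⟨A, hA, B, hB, rfl⟩ := ht
      exact hrect A B hA hB
    | compl t ht ih =>
      have h1 := integral_add_compl ht (hH R)
      have h2 := hrect Set.univ Set.univ MeasurableSet.univ MeasurableSet.univ
      rw [Set.univ_prod_univ, setIntegral_univ] at h2
      rw [ih, h2, zero_add] at h1
      exact h1
    | iUnion f hd hm ih =>
      rw [integral_iUnion hm hd (hH R).integrableOn]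
      simp [ih]
  have step4 : ∀ R : ℕ, ∀ᵐ z ∂((volume : Measure (Rn n)).prod
      ((volume : Measure (Rn n)).restrict (Metric.closedBall 0 R))), H z = 0 := fun R =>
    Integrable.ae_eq_zero_of_forall_setIntegral_eq_zero (hH R) fun S hS _ => step3 R S hS
  have e : ∀ R : ℕ, (volume : Measure (Rn n)).prod (volume.restrict (Metric.closedBall (0 : Rn n) R))
      = (volume : Measure (Rn n × Rn n)).restrict (Set.univ ×ˢ Metric.closedBall 0 (R : ℝ)) := by
    intro R
    rw [Measure.volume_eq_prod, ← Measure.prod_restrict, Measure.restrict_univ]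
  simp_rw [e] at step4
  have := (ae_restrict_iUnion_iff (fun R : ℕ => Set.univ ×ˢ Metric.closedBall (0 : Rn n) (R : ℝ))
    (fun z : Rn n × Rn n => H z = 0)).2 step4
  have hU : (⋃ R : ℕ, (Set.univ : Set (Rn n)) ×ˢ Metric.closedBall (0 : Rn n) (R : ℝ)) = Set.univ := by
    rw [Set.eq_univ_iff_forall]
    intro z
    obtain ⟨R, hR⟩ := exists_nat_ge ‖z.2‖
    exact Set.mem_iUnion.2 ⟨R, trivial, by simpa using hR⟩
  rwa [hU, Measure.restrict_univ] at this

end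

/-! ### Weak directional derivatives and the averaged fundamental theorem of calculus. -/

section

variable {n : ℕ}

/-- The integrand is the derivative in τ of -(1 - τ) w(ξ - τv), which vanishes at τ = 1. This is the
dual form of F(ξ) = ∫₀¹ (F - (1 - τ) ∂_v F)(ξ + τv) dτ, with shift and derivative moved onto the
test function. -/
theorem integral_sub_smul_add_fderiv {w : Rn n → ℝ} (hw : ContDiff ℝ ∞ w) (v ξ : Rn n) :
    ∫ τ in (0 : ℝ)..1, (w (ξ - τ • v) + (1 - τ) * fderiv ℝ w (ξ - τ • v) v) = w ξ := by
  have hd : ∀ τ : ℝ, HasDerivAt (fun τ : ℝ => -((1 - τ) * w (ξ - τ • v)))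
      (w (ξ - τ • v) + (1 - τ) * fderiv ℝ w (ξ - τ • v) v) τ := by
    intro τ
    have h1 : HasDerivAt (fun τ : ℝ => ξ - τ • v) (-v) τ := by
      simpa using ((hasDerivAt_id τ).smul_const v).const_sub ξ
    have h2 := (hw.differentiable (by simp)).differentiableAt (x := ξ - τ • v)
      |>.hasFDerivAt.comp_hasDerivAt τ h1
    have h3 : HasDerivAt (fun τ : ℝ => 1 - τ) (-1) τ := by
      simpa using (hasDerivAt_id τ).const_sub 1
    refine (h3.mul h2).neg.congr_deriv ?_
    simp only [map_neg, Function.comp_apply]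
    ring
  have hc : Continuous fun τ : ℝ => w (ξ - τ • v) + (1 - τ) * fderiv ℝ w (ξ - τ • v) v := by
    have h1 : Continuous fun τ : ℝ => ξ - τ • v := by fun_prop
    have h2 := (hw.continuous_fderiv (by simp)).comp h1
    exact (hw.continuous.comp h1).add ((continuous_const.sub continuous_id).mul
      (h2.clm_apply continuous_const))
  rw [intervalIntegral.integral_eq_sub_of_hasDerivAt (fun τ _ => hd τ) (hc.intervalIntegrable _ _)]
  simp

/-- A locally bounded measurable function on `ℝⁿ` with values in `ℂ`. -/
structure LocBounded (F : Rn n → ℂ) : Prop where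
  measurable : Measurable F
  bound : ∀ R : ℝ, ∃ C : ℝ, 0 ≤ C ∧ ∀ ξ, ‖ξ‖ ≤ R → ‖F ξ‖ ≤ C

theorem LocBounded.integrable_smul {Φ : Rn n → ℂ} (hΦ : LocBounded Φ) {φ : Rn n → ℝ}
    (hφ : Continuous φ) (hφc : HasCompactSupport φ) : Integrable fun ξ => φ ξ • Φ ξ := by
  obtain ⟨S, hS0, hS⟩ := exists_support_closedBall hφc
  obtain ⟨D, hD⟩ := hφc.exists_bound_of_continuous hφ
  obtain ⟨E, hE0, hE⟩ := hΦ.bound S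
  refine (integrableOn_iff_integrable_of_support_subset (s := Metric.closedBall 0 S)
    fun ξ hξ => ?_).1 (Measure.integrableOn_of_bounded (M := D * E)
      measure_closedBall_lt_top.ne
      (hφ.measurable.smul hΦ.measurable).aestronglyMeasurable
      ((ae_restrict_iff' Metric.isClosed_closedBall.measurableSet).2
        (Filter.Eventually.of_forall fun ξ hξ => ?_)))
  · by_contra hne
    exact hξ (by simp [hS _ hne])
  · rw [norm_smul]
    exact mul_le_mul (hD _) (hE _ (by simpa using hξ)) (norm_nonneg _)
      ((norm_nonneg _).trans (hD 0))

/-- Averaged fundamental theorem of calculus for a weak directional derivative, tested. -/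
theorem integral_smul_average_of_weakDeriv {F G : Rn n → ℂ} (hF : LocBounded F)
    (hG : LocBounded G) {v : Rn n}
    (h : ∀ w : Rn n → ℝ, ContDiff ℝ ∞ w → HasCompactSupport w →
      ∫ ξ, w ξ • G ξ = -∫ ξ, fderiv ℝ w ξ v • F ξ)
    {w : Rn n → ℝ} (hw : ContDiff ℝ ∞ w) (hwc : HasCompactSupport w) :
    ∫ ξ, w ξ • ∫ τ in Set.Icc (0 : ℝ) 1, (F (ξ + τ • v) - (1 - τ) • G (ξ + τ • v))
      = ∫ ξ, w ξ • F ξ := by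
  obtain ⟨R, hR0, hR⟩ := exists_support_closedBall hwc
  have hwc' : HasCompactSupport fun ξ => fderiv ℝ w ξ v :=
    (hwc.fderiv (𝕜 := ℝ)).comp_left (g := fun L : Rn n →L[ℝ] ℝ => L v) (by simp)
  have hwd : Continuous fun ξ => fderiv ℝ w ξ v :=
    (hw.continuous_fderiv (by simp)).clm_apply continuous_const
  -- a locally bounded function times a function supported in a ball is integrable on a strip
  have hint : ∀ (φ : Rn n × ℝ → ℂ) (R C : ℝ), Measurable φ → (∀ z, z.1 ∉ Metric.closedBall 0 R → φ z = 0) →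
      (∀ z, z.1 ∈ Metric.closedBall 0 R → z.2 ∈ Set.Icc (0 : ℝ) 1 → ‖φ z‖ ≤ C) →
      Integrable φ (volume.prod (volume.restrict (Set.Icc (0 : ℝ) 1))) := by
    intro φ R C hm h0 hb
    have h1 : IntegrableOn φ (Metric.closedBall (0 : Rn n) R ×ˢ Set.Icc (0 : ℝ) 1)
        (volume.prod volume) := by
      refine Measure.integrableOn_of_bounded (M := C) ?_ hm.aestronglyMeasurable ?_
      · rw [Measure.prod_prod]
        exact (ENNReal.mul_lt_top measure_closedBall_lt_top (by simp)).ne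
      · refine (ae_restrict_iff' (Metric.isClosed_closedBall.measurableSet.prod
          measurableSet_Icc)).2 (Filter.Eventually.of_forall fun z hz => hb z hz.1 hz.2)
    have h2 : IntegrableOn φ (Set.univ ×ˢ Set.Icc (0 : ℝ) 1) (volume.prod volume) := by
      refine h1.of_forall_sdiff_eq_zero (MeasurableSet.univ.prod measurableSet_Icc) ?_
      rintro z ⟨⟨-, hz2⟩, hz3⟩
      exact h0 z fun hz1 => hz3 ⟨hz1, hz2⟩
    rwa [IntegrableOn, ← Measure.prod_restrict, Measure.restrict_univ] at h2
  obtain ⟨CF, hCF0, hCF⟩ := hF.bound (R + ‖v‖)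
  obtain ⟨CG, hCG0, hCG⟩ := hG.bound (R + ‖v‖)
  obtain ⟨B, hB⟩ := hwc.exists_bound_of_continuous hw.continuous
  obtain ⟨B', hB'⟩ := hwc'.exists_bound_of_continuous hwd
  have hB0 : 0 ≤ B := (norm_nonneg _).trans (hB 0)
  have hB0' : 0 ≤ B' := (norm_nonneg _).trans (hB' 0)
  have hτv : ∀ τ ∈ Set.Icc (0 : ℝ) 1, ‖τ • v‖ ≤ ‖v‖ := fun τ hτ => by
    rw [norm_smul, Real.norm_of_nonneg hτ.1]
    exact mul_le_of_le_one_left (norm_nonneg _) hτ.2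
  have hI1 : Integrable (fun z : Rn n × ℝ =>
      w z.1 • (F (z.1 + z.2 • v) - (1 - z.2) • G (z.1 + z.2 • v)))
      (volume.prod (volume.restrict (Set.Icc (0 : ℝ) 1))) := by
    refine hint _ R (B * (CF + CG)) ?_ (fun z hz => by simp [hR _ hz]) fun z hz1 hz2 => ?_
    · have : Measurable fun z : Rn n × ℝ => z.1 + z.2 • v := by fun_prop
      exact (hw.continuous.measurable.comp measurable_fst).smul ((hF.measurable.comp this).sub
        ((measurable_const.sub measurable_snd).smul (hG.measurable.comp this)))
    · have hz : ‖z.1 + z.2 • v‖ ≤ R + ‖v‖ :=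
        (norm_add_le _ _).trans (add_le_add (by simpa using hz1) (hτv _ hz2))
      rw [norm_smul]
      refine mul_le_mul (hB _) ?_ (norm_nonneg _) hB0
      refine (norm_sub_le _ _).trans (add_le_add (hCF _ hz) ?_)
      rw [norm_smul, Real.norm_of_nonneg (by linarith [hz2.2])]
      exact (mul_le_of_le_one_left (norm_nonneg _) (by linarith [hz2.1])).trans (hCG _ hz)
  have hI2 : Integrable (fun z : Rn n × ℝ =>
      (w (z.1 - z.2 • v) + (1 - z.2) * fderiv ℝ w (z.1 - z.2 • v) v) • F z.1)
      (volume.prod (volume.restrict (Set.Icc (0 : ℝ) 1))) := by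
    have hm1 : Measurable fun z : Rn n × ℝ => z.1 - z.2 • v := by fun_prop
    have hm : Measurable fun z : Rn n × ℝ =>
        (w (z.1 - z.2 • v) + (1 - z.2) * fderiv ℝ w (z.1 - z.2 • v) v) • F z.1 :=
      ((hw.continuous.measurable.comp hm1).add ((measurable_const.sub measurable_snd).mul
        (hwd.measurable.comp hm1))).smul (hF.measurable.comp measurable_fst)
    have hsupp : ∀ z : Rn n × ℝ, z.2 ∈ Set.Icc (0 : ℝ) 1 → z.1 ∉ Metric.closedBall 0 (R + ‖v‖) →
        w (z.1 - z.2 • v) = 0 ∧ fderiv ℝ w (z.1 - z.2 • v) v = 0 := by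
      intro z hz2 hz1
      have hout : z.1 - z.2 • v ∉ Metric.closedBall (0 : Rn n) R := by
        intro hmem
        apply hz1
        have h1 : ‖z.1‖ ≤ ‖z.1 - z.2 • v‖ + ‖z.2 • v‖ := by
          simpa using norm_add_le (z.1 - z.2 • v) (z.2 • v)
        have h2 := hτv _ hz2
        have h3 : ‖z.1 - z.2 • v‖ ≤ R := by simpa using hmem
        simp only [Metric.mem_closedBall, dist_zero_right]
        linarith
      refine ⟨hR _ hout, ?_⟩
      have hev : w =ᶠ[nhds (z.1 - z.2 • v)] fun _ => 0 := by
        filter_upwards [Metric.isClosed_closedBall.isOpen_compl.mem_nhds hout] with y hy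
        exact hR y hy
      rw [hev.fderiv_eq]
      simp
    -- The support is controlled only for τ in [0, 1]. The indicator makes the function vanish
    -- outside a ball for every τ and is invisible to the restricted measure.
    have h3 := hint (fun z => Set.indicator (Set.univ ×ˢ Set.Icc (0 : ℝ) 1) (fun z : Rn n × ℝ =>
        (w (z.1 - z.2 • v) + (1 - z.2) * fderiv ℝ w (z.1 - z.2 • v) v) • F z.1) z)
      (R + ‖v‖) ((B + B') * CF) (hm.indicator (MeasurableSet.univ.prod measurableSet_Icc)) ?_ ?_
    · refine h3.congr ?_
      have hae : ∀ᵐ z ∂((volume : Measure (Rn n)).prod (volume.restrict (Set.Icc (0 : ℝ) 1))),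
          z ∈ (Set.univ : Set (Rn n)) ×ˢ Set.Icc (0 : ℝ) 1 := by
        rw [← Measure.restrict_univ (μ := (volume : Measure (Rn n))), Measure.prod_restrict]
        exact ae_restrict_mem (MeasurableSet.univ.prod measurableSet_Icc)
      filter_upwards [hae] with z hz
      rw [Set.indicator_of_mem hz]
    · intro z hz
      by_cases hz2 : z.2 ∈ Set.Icc (0 : ℝ) 1
      · rw [Set.indicator_of_mem (show z ∈ Set.univ ×ˢ Set.Icc (0 : ℝ) 1 from ⟨trivial, hz2⟩)]
        obtain ⟨e1, e2⟩ := hsupp z hz2 hz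
        simp [e1, e2]
      · exact Set.indicator_of_notMem (fun hh => hz2 hh.2) _
    · intro z hz1 hz2
      rw [Set.indicator_of_mem (show z ∈ Set.univ ×ˢ Set.Icc (0 : ℝ) 1 from ⟨trivial, hz2⟩),
        norm_smul]
      refine mul_le_mul ?_ (hCF _ (by simpa using hz1)) (norm_nonneg _) (by positivity)
      refine (norm_add_le _ _).trans (add_le_add (hB _) ?_)
      rw [norm_mul, Real.norm_of_nonneg (by linarith [hz2.2])]
      exact (mul_le_of_le_one_left (norm_nonneg _) (by linarith [hz2.1])).trans (hB' _)
  simp_rw [← integral_smul]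
  rw [integral_integral_swap hI1]
  -- A translation moves the shift onto `w`; the weak derivative identity is then applied to the
  -- translated test function.
  have inner : ∀ τ : ℝ, ∫ ξ, w ξ • (F (ξ + τ • v) - (1 - τ) • G (ξ + τ • v))
      = ∫ ξ, (w (ξ - τ • v) + (1 - τ) * fderiv ℝ w (ξ - τ • v) v) • F ξ := by
    intro τ
    have hsub : ContDiff ℝ ∞ fun ξ => w (ξ - τ • v) := hw.comp (contDiff_id.sub contDiff_const)
    have hsubc : HasCompactSupport fun ξ => w (ξ - τ • v) :=
      hwc.comp_homeomorph (Homeomorph.subRight (τ • v))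
    have hfd : ∀ ξ, fderiv ℝ (fun ξ => w (ξ - τ • v)) ξ v = fderiv ℝ w (ξ - τ • v) v := by
      intro ξ
      simp only [sub_eq_add_neg]
      rw [fderiv_comp_add_right]
    have hsubd : Continuous fun ξ => fderiv ℝ w (ξ - τ • v) v := hwd.comp (by fun_prop)
    have hsubdc : HasCompactSupport fun ξ => fderiv ℝ w (ξ - τ • v) v :=
      hwc'.comp_homeomorph (Homeomorph.subRight (τ • v))
    have e1 : ∫ ξ, w ξ • (F (ξ + τ • v) - (1 - τ) • G (ξ + τ • v))
        = ∫ ξ, w (ξ - τ • v) • (F ξ - (1 - τ) • G ξ) := by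
      rw [← integral_sub_right_eq_self _ (τ • v)]
      simp
    have h1 := hF.integrable_smul hsub.continuous hsubc
    have h2 := hG.integrable_smul hsub.continuous hsubc
    have h3 := hF.integrable_smul hsubd hsubdc
    rw [e1]
    calc _ = ∫ ξ, (w (ξ - τ • v) • F ξ - (1 - τ) • (w (ξ - τ • v) • G ξ)) := by
          congr! 2 with ξ
          rw [smul_sub, smul_comm]
      _ = (∫ ξ, w (ξ - τ • v) • F ξ) + (1 - τ) • ∫ ξ, fderiv ℝ w (ξ - τ • v) v • F ξ := by
          have h2' : Integrable fun ξ => (1 - τ) • (w (ξ - τ • v) • G ξ) := h2.smul (1 - τ)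
          rw [integral_sub h1 h2', integral_smul, h _ hsub hsubc]
          simp only [hfd]
          rw [smul_neg, sub_neg_eq_add]
      _ = _ := by
          have h3' : Integrable fun ξ => (1 - τ) • (fderiv ℝ w (ξ - τ • v) v • F ξ) := h3.smul (1 - τ)
          rw [← integral_smul, ← integral_add h1 h3']
          congr! 2 with ξ
          rw [add_smul, mul_smul]
  simp_rw [inner]
  rw [← integral_integral_swap hI2]
  congr! 2 with ξ
  rw [integral_smul_const, ← integral_sub_smul_add_fderiv hw v ξ,
    intervalIntegral.integral_of_le zero_le_one, integral_Icc_eq_integral_Ioc]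

/-- `g` is the derivative of `f` in the direction `v` of the second variable, tested on products. -/
def HasWeakDeriv (f g : Rn n × Rn n → ℂ) (v : Rn n) : Prop :=
  ∀ ψ w : Rn n → ℝ, ContDiff ℝ ∞ ψ → HasCompactSupport ψ → ContDiff ℝ ∞ w → HasCompactSupport w →
    ∫ ξ, w ξ • ∫ ζ, ψ ζ • g (ζ, ξ) = -∫ ξ, fderiv ℝ w ξ v • ∫ ζ, ψ ζ • f (ζ, ξ)

theorem SliceIntegrable.locBounded {f : Rn n × Rn n → ℂ} (hf : SliceIntegrable f) {ψ : Rn n → ℝ}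
    (hψ : Continuous ψ) (hψc : HasCompactSupport ψ) : LocBounded fun ξ => ∫ ζ, ψ ζ • f (ζ, ξ) := by
  obtain ⟨B, hB⟩ := hψc.exists_bound_of_continuous hψ
  have hB0 : 0 ≤ B := (norm_nonneg _).trans (hB 0)
  refine ⟨?_, fun R => ?_⟩
  · have : Measurable fun z : Rn n × Rn n => ψ z.1 • f z :=
      (hψ.measurable.comp measurable_fst).smul hf.measurable
    exact (this.stronglyMeasurable.integral_prod_left').measurable
  · obtain ⟨C, hC, h⟩ := hf.bound R
    refine ⟨B * C.toReal, by positivity, fun ξ hξ => ?_⟩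
    have hi := hf.integrable_slice ξ
    calc ‖∫ ζ, ψ ζ • f (ζ, ξ)‖ ≤ ∫ ζ, ‖ψ ζ • f (ζ, ξ)‖ := norm_integral_le_integral_norm _
      _ ≤ ∫ ζ, B * ‖f (ζ, ξ)‖ := by
          refine integral_mono_of_nonneg (Filter.Eventually.of_forall fun _ => norm_nonneg _)
            (hi.norm.const_mul B) (Filter.Eventually.of_forall fun ζ => ?_)
          simp only [norm_smul]
          gcongr
          exact hB ζ
      _ = B * (∫⁻ ζ, ‖f (ζ, ξ)‖ₑ).toReal := by
          rw [integral_const_mul, integral_norm_eq_lintegral_enorm hi.aestronglyMeasurable]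
      _ ≤ B * C.toReal := by
          gcongr
          exact h ξ hξ

/-- Almost everywhere `f` equals the average of f - (1 - τ) g along the segment in direction `v`.
Pairing with a test function in the first variable reduces this to the scalar statement
`integral_smul_average_of_weakDeriv`, and `ae_eq_zero_of_forall_tensor` removes the pairing. The
inequality follows from 0 ≤ 1 - τ ≤ 1. -/
theorem HasWeakDeriv.enorm_le_lintegral {f g : Rn n × Rn n → ℂ} {v : Rn n}
    (hf : SliceIntegrable f) (hg : SliceIntegrable g) (h : HasWeakDeriv f g v) :
    ∀ᵐ z : Rn n × Rn n, ‖f z‖ₑ ≤ ∫⁻ τ in Set.Icc (0 : ℝ) 1,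
      (‖f (z.1, z.2 + τ • v)‖ₑ + ‖g (z.1, z.2 + τ • v)‖ₑ) := by
  let J : Rn n × Rn n → ℝ → ℂ := fun z τ => f (z.1, z.2 + τ • v) - (1 - τ) • g (z.1, z.2 + τ • v)
  have hJm : Measurable (Function.uncurry J) := by
    have : Measurable fun p : (Rn n × Rn n) × ℝ => (p.1.1, p.1.2 + p.2 • v) := by fun_prop
    exact (hf.measurable.comp this).sub
      ((measurable_const.sub measurable_snd).smul (hg.measurable.comp this))
  have hJle : ∀ z, ∀ τ ∈ Set.Icc (0 : ℝ) 1,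
      ‖J z τ‖ₑ ≤ ‖f (z.1, z.2 + τ • v)‖ₑ + ‖g (z.1, z.2 + τ • v)‖ₑ := by
    intro z τ hτ
    refine (enorm_sub_le).trans ?_
    gcongr
    rw [enorm_smul]
    refine mul_le_of_le_one_left zero_le ?_
    rw [Real.enorm_eq_ofReal (by linarith [hτ.2])]
    exact ENNReal.ofReal_le_one.2 (by linarith [hτ.1])
  have hbd : ∀ R : ℝ, ∃ C : ℝ≥0∞, C ≠ ⊤ ∧ ∀ ξ : Rn n, ‖ξ‖ ≤ R →
      ∫⁻ ζ, ∫⁻ τ in Set.Icc (0 : ℝ) 1, ‖J (ζ, ξ) τ‖ₑ ≤ C := by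
    intro R
    obtain ⟨C, hC, hfC⟩ := hf.bound (R + ‖v‖)
    obtain ⟨D, hD, hgD⟩ := hg.bound (R + ‖v‖)
    refine ⟨C + D, ENNReal.add_ne_top.2 ⟨hC, hD⟩, fun ξ hξ => ?_⟩
    have hm : Measurable fun p : Rn n × ℝ => ‖J (p.1, ξ) p.2‖ₑ :=
      hJm.enorm.comp (by fun_prop : Measurable fun p : Rn n × ℝ => ((p.1, ξ), p.2))
    rw [lintegral_lintegral_swap hm.aemeasurable]
    calc _ ≤ ∫⁻ τ in Set.Icc (0 : ℝ) 1, (C + D) := by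
          refine setLIntegral_mono' measurableSet_Icc fun τ hτ => ?_
          have hn : ‖ξ + τ • v‖ ≤ R + ‖v‖ := by
            refine (norm_add_le _ _).trans (add_le_add hξ ?_)
            rw [norm_smul, Real.norm_of_nonneg hτ.1]
            exact mul_le_of_le_one_left (norm_nonneg _) hτ.2
          refine (lintegral_mono fun ζ => hJle (ζ, ξ) τ hτ).trans ?_
          rw [lintegral_add_left]
          · exact add_le_add (hfC _ hn) (hgD _ hn)
          · exact (hf.measurable.comp (measurable_prodMk_right (y := ξ + τ • v))).enorm
      _ = C + D := by simp
  let J' : Rn n × Rn n → ℂ := fun z => ∫ τ in Set.Icc (0 : ℝ) 1, J z τ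
  have hJ' : SliceIntegrable J' := by
    refine ⟨(hJm.stronglyMeasurable.integral_prod_right).measurable, fun R => ?_⟩
    obtain ⟨C, hC, hb⟩ := hbd R
    exact ⟨C, hC, fun ξ hξ => (lintegral_mono fun ζ => enorm_integral_le_lintegral_enorm _).trans
      (hb ξ hξ)⟩
  have hzero : (fun z => f z - J' z) =ᵐ[volume] 0 := by
    refine ae_eq_zero_of_forall_tensor (fun R => (hf.integrableOn R).sub (hJ'.integrableOn R)) ?_
    intro ψ w hψ hψc hw hwc
    obtain ⟨B, hB⟩ := hψc.exists_bound_of_continuous hψ.continuous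
    have hFl := hf.locBounded hψ.continuous hψc
    have hGl := hg.locBounded hψ.continuous hψc
    have key := integral_smul_average_of_weakDeriv hFl hGl (h ψ · hψ hψc · ·) hw hwc
    have hψi : ∀ φ : Rn n → ℂ, Integrable φ → Integrable fun ζ => ψ ζ • φ ζ := fun φ hφ =>
      hφ.bdd_smul B hψ.continuous.aestronglyMeasurable (Filter.Eventually.of_forall hB)
    have hswap : ∀ ξ, ∫ ζ, ψ ζ • J' (ζ, ξ) = ∫ τ in Set.Icc (0 : ℝ) 1,
        ((∫ ζ, ψ ζ • f (ζ, ξ + τ • v)) - (1 - τ) • ∫ ζ, ψ ζ • g (ζ, ξ + τ • v)) := by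
      intro ξ
      have hm : Measurable fun p : Rn n × ℝ => J (p.1, ξ) p.2 :=
        hJm.comp (by fun_prop : Measurable fun p : Rn n × ℝ => ((p.1, ξ), p.2))
      have hi : Integrable (fun p : Rn n × ℝ => J (p.1, ξ) p.2)
          (volume.prod (volume.restrict (Set.Icc (0 : ℝ) 1))) := by
        refine ⟨hm.aestronglyMeasurable, ?_⟩
        obtain ⟨C, hC, hb⟩ := hbd ‖ξ‖
        rw [HasFiniteIntegral, lintegral_prod _ hm.enorm.aemeasurable]
        exact (hb ξ le_rfl).trans_lt hC.lt_top
      have hi2 : Integrable (fun p : Rn n × ℝ => ψ p.1 • J (p.1, ξ) p.2)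
          (volume.prod (volume.restrict (Set.Icc (0 : ℝ) 1))) :=
        hi.bdd_smul B (hψ.continuous.comp continuous_fst).aestronglyMeasurable
          (Filter.Eventually.of_forall fun z => hB z.1)
      simp only [J', ← integral_smul]
      rw [integral_integral_swap hi2]
      congr! 2 with τ
      simp only [J, smul_sub]
      rw [integral_sub (hψi _ (hf.integrable_slice _))]
      · congr! 3 with ζ
        rw [smul_comm]
      · exact hψi _ ((hg.integrable_slice (ξ + τ • v)).smul (1 - τ))
    have hJl := hJ'.locBounded hψ.continuous hψc
    have hwl : ∀ Φ : Rn n → ℂ, LocBounded Φ → Integrable fun ξ => w ξ • Φ ξ :=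
      fun Φ hΦ => hΦ.integrable_smul hw.continuous hwc
    calc ∫ ξ, w ξ • ∫ ζ, ψ ζ • (f (ζ, ξ) - J' (ζ, ξ))
        = ∫ ξ, (w ξ • (∫ ζ, ψ ζ • f (ζ, ξ)) - w ξ • ∫ ζ, ψ ζ • J' (ζ, ξ)) := by
          congr! 2 with ξ
          simp only [smul_sub]
          rw [integral_sub (hψi _ (hf.integrable_slice _)) (hψi _ (hJ'.integrable_slice _)),
            smul_sub]
      _ = 0 := by
          rw [integral_sub (hwl _ hFl) (hwl _ hJl), ← key]
          simp_rw [hswap]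
          exact sub_self _
  filter_upwards [hzero] with z hz
  have : f z = J' z := sub_eq_zero.1 hz
  rw [this]
  refine (enorm_integral_le_lintegral_enorm _).trans ?_
  exact setLIntegral_mono' measurableSet_Icc fun τ hτ => hJle z τ hτ

end

/-! ### The averaged Sobolev inequality over boxes. -/

section

variable {n : ℕ}

/-- The uniform probability measure on the unit cube. -/
def cubeMeasure (n : ℕ) : Measure (Fin n → ℝ) :=
  Measure.pi fun _ => volume.restrict (Set.Icc (0 : ℝ) 1)

instance : IsProbabilityMeasure (volume.restrict (Set.Icc (0 : ℝ) 1)) := ⟨by simp⟩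

instance : IsProbabilityMeasure (cubeMeasure n) := by
  unfold cubeMeasure; infer_instance

/-- Resampling one coordinate of a uniform point does not change its law. The partial average `F` no
longer depends on coordinate `j`, so averaging it there once more returns `F`, and the integrals of
`K` and `F` reduce to the same marginal. -/
theorem lintegral_cubeMeasure_update {K : (Fin n → ℝ) → ℝ≥0∞} (hK : Measurable K) (j : Fin n) :
    ∫⁻ t, (∫⁻ τ in Set.Icc (0 : ℝ) 1, K (Function.update t j τ)) ∂(cubeMeasure n)
      = ∫⁻ t, K t ∂(cubeMeasure n) := by
  let μ : Fin n → Measure ℝ := fun _ => volume.restrict (Set.Icc (0 : ℝ) 1)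
  let F : (Fin n → ℝ) → ℝ≥0∞ := fun t => ∫⁻ τ, K (Function.update t j τ) ∂(μ j)
  have hF : Measurable F := by
    have : Measurable fun p : (Fin n → ℝ) × ℝ => K (Function.update p.1 j p.2) :=
      hK.comp measurable_update'
    exact this.lintegral_prod_right'
  have e1 := lmarginal_erase' (μ := μ) K hK (Finset.mem_univ j)
  have e2 := lmarginal_erase' (μ := μ) F hF (Finset.mem_univ j)
  have e3 : (fun x : Fin n → ℝ => ∫⁻ τ, F (Function.update x j τ) ∂(μ j)) = F := by
    ext x
    simp [F, μ]
  rw [e3] at e2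
  have := e2.trans e1.symm
  simp only [lmarginal_univ] at this
  exact congrFun this 0

/-- The vector with coordinates `tⱼ ℓⱼ` for `j ∈ J`, and `0` elsewhere. -/
def cubeShift (ℓ : Fin n → ℝ) (J : Finset (Fin n)) (t : Fin n → ℝ) : Rn n :=
  ∑ j ∈ J, (t j * ℓ j) • EuclideanSpace.single j (1 : ℝ)

theorem continuous_cubeShift (ℓ : Fin n → ℝ) (J : Finset (Fin n)) : Continuous (cubeShift ℓ J) := by
  unfold cubeShift; fun_prop

theorem cubeShift_insert_update (ℓ : Fin n → ℝ) {J : Finset (Fin n)} {j : Fin n} (hj : j ∉ J)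
    (t : Fin n → ℝ) (τ : ℝ) :
    cubeShift ℓ (insert j J) (Function.update t j τ)
      = τ • (ℓ j • EuclideanSpace.single j (1 : ℝ)) + cubeShift ℓ J t := by
  unfold cubeShift
  rw [Finset.sum_insert hj, Function.update_self, mul_smul]
  congr 1
  refine Finset.sum_congr rfl fun i hi => ?_
  rw [Function.update_of_ne]
  rintro rfl
  exact hj hi

theorem HasWeakDeriv.smul {f g : Rn n × Rn n → ℂ} {v : Rn n} (h : HasWeakDeriv f g v) (c : ℝ) :
    HasWeakDeriv f (fun z => c • g z) (c • v) := by
  intro ψ w hψ hψc hw hwc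
  have := h ψ w hψ hψc hw hwc
  have e1 : ∀ ξ, w ξ • ∫ ζ, ψ ζ • c • g (ζ, ξ) = c • (w ξ • ∫ ζ, ψ ζ • g (ζ, ξ)) := by
    intro ξ
    simp_rw [smul_comm _ c]
    rw [integral_smul, smul_comm]
  simp_rw [e1, map_smul, smul_assoc]
  rw [integral_smul, integral_smul, this, smul_neg]

theorem SliceIntegrable.smul {f : Rn n × Rn n → ℂ} (hf : SliceIntegrable f) (c : ℝ) :
    SliceIntegrable fun z => c • f z := by
  refine ⟨hf.measurable.const_smul c, fun R => ?_⟩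
  obtain ⟨C, hC, h⟩ := hf.bound R
  refine ⟨‖c‖ₑ * C, ENNReal.mul_ne_top enorm_ne_top hC, fun ξ hξ => ?_⟩
  simp_rw [enorm_smul]
  rw [lintegral_const_mul' _ _ enorm_ne_top]
  gcongr
  exact h ξ hξ

/-- The integrand of the averaged Sobolev inequality over a box. -/
def cubeIntegrand (f : Finset (Fin n) → Rn n × Rn n → ℂ) (ℓ : Fin n → ℝ) (S J : Finset (Fin n))
    (p : (Rn n × Rn n) × (Fin n → ℝ)) : ℝ≥0∞ :=
  ∑ T ∈ J.powerset, ENNReal.ofReal (∏ j ∈ T, ℓ j) *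
    ‖f (S ∪ T) (p.1.1, p.1.2 + cubeShift ℓ J p.2)‖ₑ

theorem measurable_cubeIntegrand {f : Finset (Fin n) → Rn n × Rn n → ℂ}
    (hf : ∀ S, Measurable (f S)) (ℓ : Fin n → ℝ) (S J : Finset (Fin n)) :
    Measurable (cubeIntegrand f ℓ S J) := by
  have hc := (continuous_cubeShift ℓ J).measurable
  refine Finset.measurable_sum _ fun T _ => measurable_const.mul ((hf _).comp ?_).enorm
  fun_prop

/-- The right side of the averaged Sobolev inequality over a box. -/
def cubeAverage (f : Finset (Fin n) → Rn n × Rn n → ℂ) (ℓ : Fin n → ℝ) (S J : Finset (Fin n))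
    (z : Rn n × Rn n) : ℝ≥0∞ :=
  ∫⁻ t, cubeIntegrand f ℓ S J (z, t) ∂(cubeMeasure n)

theorem measurable_cubeAverage {f : Finset (Fin n) → Rn n × Rn n → ℂ}
    (hf : ∀ S, Measurable (f S)) (ℓ : Fin n → ℝ) (S J : Finset (Fin n)) :
    Measurable (cubeAverage f ℓ S J) :=
  (measurable_cubeIntegrand hf ℓ S J).lintegral_prod_right'

/-- Averaged Sobolev inequality over a box, for a family of iterated weak derivatives. -/
theorem enorm_le_cubeAverage {f : Finset (Fin n) → Rn n × Rn n → ℂ}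
    (hf : ∀ S, SliceIntegrable (f S))
    (hd : ∀ S j, j ∉ S → HasWeakDeriv (f S) (f (insert j S)) (EuclideanSpace.single j 1))
    {ℓ : Fin n → ℝ} (hℓ : ∀ j, 0 ≤ ℓ j) (J : Finset (Fin n)) :
    ∀ S, Disjoint S J → ∀ᵐ z : Rn n × Rn n, ‖f S z‖ₑ ≤ cubeAverage f ℓ S J z := by
  classical
  have hfm : ∀ S, Measurable (f S) := fun S => (hf S).measurable
  -- Adding a direction `j` applies the one-dimensional inequality with step `ℓ j`, producing a term
  -- for `S` and one for `insert j S`. The induction hypothesis for these two gives the subsets of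
  -- `insert j J` without and with `j`.
  induction J using Finset.induction_on with
  | empty =>
    intro S _
    refine Filter.Eventually.of_forall fun z => ?_
    simp [cubeAverage, cubeIntegrand, cubeShift]
  | insert j J hj ih =>
    intro S hS
    rw [Finset.disjoint_insert_right] at hS
    obtain ⟨hjS, hSJ⟩ := hS
    set v : Rn n := ℓ j • EuclideanSpace.single j (1 : ℝ) with hv
    have h1 := ((hd S j hjS).smul (ℓ j)).enorm_le_lintegral (hf S) ((hf _).smul (ℓ j))
    -- The induction hypothesis is needed at points shifted by τ; for each τ the shift preserves
    -- null sets, and the two quantifiers are exchanged.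
    have hshift : ∀ S', Disjoint S' J → ∀ᵐ z : Rn n × Rn n,
        ∀ᵐ τ ∂(volume.restrict (Set.Icc (0 : ℝ) 1)),
        ‖f S' (z.1, z.2 + τ • v)‖ₑ ≤ cubeAverage f ℓ S' J (z.1, z.2 + τ • v) := by
      intro S' hS'
      have hadd : Measurable fun p : (Rn n × Rn n) × ℝ => (p.1.1, p.1.2 + p.2 • v) := by fun_prop
      have hms : MeasurableSet {p : (Rn n × Rn n) × ℝ | ‖f S' (p.1.1, p.1.2 + p.2 • v)‖ₑ
          ≤ cubeAverage f ℓ S' J (p.1.1, p.1.2 + p.2 • v)} :=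
        measurableSet_le ((hfm S').comp hadd).enorm
          ((measurable_cubeAverage hfm ℓ S' J).comp hadd)
      rw [Measure.ae_ae_comm hms]
      refine Filter.Eventually.of_forall fun τ => ?_
      have hmp : MeasurePreserving (fun z : Rn n × Rn n => (z.1, z.2 + τ • v)) volume volume :=
        (MeasurePreserving.id volume).prod (measurePreserving_add_right volume (τ • v))
      exact hmp.quasiMeasurePreserving.ae (ih S' hS')
    have hS2 : Disjoint (insert j S) J := Finset.disjoint_insert_left.2 ⟨hj, hSJ⟩
    filter_upwards [h1, hshift S hSJ, hshift (insert j S) hS2] with z hz1 hz2 hz3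
    have hm3 : Measurable fun t : Fin n → ℝ => cubeIntegrand f ℓ S (insert j J) (z, t) :=
      (measurable_cubeIntegrand hfm ℓ S (insert j J)).comp measurable_prodMk_left
    have hm2 : Measurable fun p : (Fin n → ℝ) × ℝ =>
        cubeIntegrand f ℓ S (insert j J) (z, Function.update p.1 j p.2) :=
      hm3.comp measurable_update'
    unfold cubeAverage
    -- The shift over `J` does not read coordinate `j` of `t`, so that coordinate can be resampled
    -- as the variable τ of the one-dimensional inequality.
    rw [← lintegral_cubeMeasure_update hm3 j]
    refine le_of_le_of_eq ?_ (lintegral_lintegral_swap hm2.aemeasurable).symm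
    refine hz1.trans (lintegral_mono_ae ?_)
    filter_upwards [hz2, hz3] with τ e2 e3
    have hsm : ‖ℓ j • f (insert j S) (z.1, z.2 + τ • v)‖ₑ
        = ENNReal.ofReal (ℓ j) * ‖f (insert j S) (z.1, z.2 + τ • v)‖ₑ := by
      rw [enorm_smul, Real.enorm_eq_ofReal (hℓ j)]
    rw [hsm]
    refine (add_le_add e2 (mul_le_mul_right e3 _)).trans (le_of_eq ?_)
    have hmS : ∀ S', Measurable fun t : Fin n → ℝ =>
        cubeIntegrand f ℓ S' J ((z.1, z.2 + τ • v), t) := fun S' =>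
      (measurable_cubeIntegrand hfm ℓ S' J).comp measurable_prodMk_left
    unfold cubeAverage
    rw [← lintegral_const_mul _ (hmS _), ← lintegral_add_left (hmS _)]
    refine lintegral_congr fun t => ?_
    unfold cubeIntegrand
    rw [Finset.sum_powerset_insert hj, cubeShift_insert_update ℓ hj, ← hv, ← add_assoc,
      Finset.mul_sum]
    congr 1
    refine Finset.sum_congr rfl fun T hT => ?_
    have hjT : j ∉ T := fun h => hj (Finset.mem_powerset.1 hT h)
    rw [Finset.prod_insert hjT, ENNReal.ofReal_mul (hℓ j), mul_assoc, Finset.insert_union,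
      Finset.union_insert]

end

/-! ### Integrals along the antidiagonal over one shell. -/

section

variable {n : ℕ} {M : Fin n → ℝ}

theorem cubeShift_univ_apply (ℓ t : Fin n → ℝ) (j : Fin n) :
    cubeShift ℓ Finset.univ t j = t j * ℓ j := by
  unfold cubeShift
  simp [Finset.sum_apply, Pi.single_apply]

/-- The diagonal map with entries `ℓ j` carries the unit cube into the box, with Jacobian the
product of the sides. -/
theorem lintegral_cubeMeasure_comp_cubeShift_le {ℓ : Fin n → ℝ} (hℓ : ∀ j, 0 < ℓ j)
    {g : Rn n → ℝ≥0∞} (hg : Measurable g) :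
    ∫⁻ t, g (cubeShift ℓ Finset.univ t) ∂(cubeMeasure n)
      ≤ ENNReal.ofReal (∏ j, ℓ j)⁻¹ * ∫⁻ y in {y : Rn n | ∀ j, y j ∈ Set.Icc 0 (ℓ j)}, g y := by
  classical
  have hprod : 0 < ∏ j, ℓ j := Finset.prod_pos fun j _ => hℓ j
  have hdet : (Matrix.diagonal ℓ).det ≠ 0 := by
    rw [Matrix.det_diagonal]; exact hprod.ne'
  have hQ : MeasurableSet {y : Rn n | ∀ j, y j ∈ Set.Icc 0 (ℓ j)} := by
    have : {y : Rn n | ∀ j, y j ∈ Set.Icc 0 (ℓ j)} = ⋂ j, {y : Rn n | y j ∈ Set.Icc 0 (ℓ j)} := by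
      ext; simp
    rw [this]
    exact MeasurableSet.iInter fun j => (by fun_prop : Measurable fun y : Rn n => y j) measurableSet_Icc
  set gQ := Set.indicator {y : Rn n | ∀ j, y j ∈ Set.Icc 0 (ℓ j)} g with hgQ
  have hgQm : Measurable gQ := hg.indicator hQ
  have hL : Measurable fun x : Fin n → ℝ => gQ (WithLp.toLp 2 x) :=
    hgQm.comp (WithLp.measurable_toLp 2 _)
  have hlin : Measurable (Matrix.toLin' (Matrix.diagonal ℓ)) :=
    (LinearMap.continuous_on_pi _).measurable
  have e1 : ∫⁻ y in {y : Rn n | ∀ j, y j ∈ Set.Icc 0 (ℓ j)}, g y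
      = ENNReal.ofReal (∏ j, ℓ j) * ∫⁻ t, gQ (cubeShift ℓ Finset.univ t) := by
    rw [← lintegral_indicator hQ, ← hgQ, ← (PiLp.volume_preserving_toLp (Fin n)).lintegral_comp hgQm]
    conv_lhs => rw [← Real.smul_map_diagonal_volume_pi hdet]
    rw [lintegral_smul_measure, lintegral_map hL hlin, Matrix.det_diagonal,
      abs_of_pos hprod, smul_eq_mul]
    congr! 3 with t
    congr 1
    ext j
    rw [cubeShift_univ_apply]
    simp [Matrix.toLin'_apply, Matrix.mulVec_diagonal, mul_comm]
  rw [e1, ← mul_assoc, ← ENNReal.ofReal_mul (by positivity), inv_mul_cancel₀ hprod.ne',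
    ENNReal.ofReal_one, one_mul]
  unfold cubeMeasure
  rw [← Measure.restrict_pi_pi, ← volume_pi]
  refine (setLIntegral_mono' (MeasurableSet.univ_pi fun _ => measurableSet_Icc)
    fun t ht => ?_).trans (setLIntegral_le_lintegral _ _)
  rw [hgQ, Set.indicator_of_mem]
  intro j
  have := ht j trivial
  rw [cubeShift_univ_apply]
  exact ⟨mul_nonneg this.1 (hℓ j).le, mul_le_of_le_one_left (hℓ j).le this.2⟩

/-- Points of a shell of radius `R` move to comparable points under translations of size at most
`(c R)^{1/μⱼ}` in the coordinates. -/
theorem exists_mWeight_add_mem_Icc (hM : ∀ j, 0 < M j) : ∃ c L : ℝ, 0 < c ∧ 1 ≤ L ∧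
    ∀ (R : ℝ) (ξ y : Rn n), 0 < R → mWeight M ξ ∈ Set.Ico R (2 * R) →
      (∀ j, |y j| ≤ (c * R) ^ (1 / M j)) → mWeight M (ξ + y) ∈ Set.Icc (R / L) (L * R) := by
  obtain ⟨K, hK, h⟩ := exists_mWeight_add_sq_le hM
  -- Chosen so that K n (cR)² ≤ R²/4: the displacement is absorbed by ⟨ξ⟩² ≥ R².
  set c : ℝ := 1 / (2 * K * (n + 1)) with hc
  have hc0 : 0 < c := by positivity
  refine ⟨c, 3 * K, hc0, by linarith, fun R ξ y hR hξ hy => ?_⟩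
  have hsum : ∑ j, |y j| ^ (2 * M j) ≤ n * (c * R) ^ 2 := by
    calc ∑ j, |y j| ^ (2 * M j) ≤ ∑ j : Fin n, (c * R) ^ 2 := by
          refine Finset.sum_le_sum fun j _ => ?_
          have hMj := hM j
          calc |y j| ^ (2 * M j) ≤ ((c * R) ^ (1 / M j)) ^ (2 * M j) :=
                Real.rpow_le_rpow (abs_nonneg _) (hy j) (by positivity)
            _ = (c * R) ^ (2 : ℝ) := by
                rw [← Real.rpow_mul (by positivity)]
                congr 1
                field_simp
            _ = _ := Real.rpow_two _
      _ = _ := by simp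
  have hKc : K * (n * (c * R) ^ 2) ≤ R ^ 2 / 4 := by
    have h1 : K * (n * c ^ 2) ≤ 1 / 4 := by
      rw [hc, div_pow, one_pow, mul_one_div, mul_div_assoc', div_le_div_iff₀ (by positivity) (by norm_num)]
      have : (0 : ℝ) ≤ n := Nat.cast_nonneg n
      nlinarith [mul_nonneg this this, mul_nonneg (by linarith : (0:ℝ) ≤ K - 1) this]
    nlinarith [sq_nonneg R]
  have h1 := h ξ y
  -- The lower bound comes from translating back from `ξ + y` to `ξ`.
  have h2 := h (ξ + y) (-y)
  rw [add_neg_cancel_right] at h2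
  simp only [PiLp.neg_apply, abs_neg] at h2
  have hw := mWeight_pos M (ξ + y)
  obtain ⟨hl, hu⟩ := hξ
  have hR2 : R ^ 2 ≤ mWeight M ξ ^ 2 := by gcongr
  have hR3 : mWeight M ξ ^ 2 ≤ (2 * R) ^ 2 := by
    have := mWeight_pos M ξ
    gcongr
  have hKS : K * ∑ j, |y j| ^ (2 * M j) ≤ R ^ 2 / 4 :=
    (mul_le_mul_of_nonneg_left hsum (by linarith)).trans hKc
  rw [mul_add] at h1 h2
  have hR0 := sq_nonneg R
  have hK2 : 0 ≤ (K - 1) * K := mul_nonneg (by linarith) (by linarith)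
  constructor
  · rw [div_le_iff₀ (by positivity)]
    refine abs_le_of_sq_le_sq' ?_ (by positivity) |>.2
    have := mul_nonneg hK2 (sq_nonneg (mWeight M (ξ + y)))
    nlinarith
  · refine abs_le_of_sq_le_sq' ?_ (by positivity) |>.2
    have := mul_nonneg hK2 hR0
    have h3 : K * mWeight M ξ ^ 2 ≤ K * (2 * R) ^ 2 := by gcongr
    nlinarith [mul_nonneg (by linarith : 0 ≤ K - 1) hR0]

theorem rpow_le_rpow_abs_mul {L R x : ℝ} (hL : 1 ≤ L) (hR : 0 < R) (hx : x ∈ Set.Icc (R / L) (L * R))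
    (a : ℝ) : x ^ a ≤ L ^ |a| * R ^ a := by
  have hx0 : 0 < x := lt_of_lt_of_le (by positivity) hx.1
  rw [← div_le_iff₀ (by positivity), ← Real.div_rpow hx0.le hR.le]
  rcases le_total 0 a with ha | ha
  · rw [abs_of_nonneg ha]
    exact Real.rpow_le_rpow (by positivity) ((div_le_iff₀ hR).2 hx.2) ha
  · rw [abs_of_nonpos ha, ← inv_div, Real.inv_rpow (by positivity), ← Real.rpow_neg (by positivity)]
    refine Real.rpow_le_rpow (by positivity) ?_ (by linarith)
    rw [div_le_iff₀ hx0, mul_comm, ← div_le_iff₀ (by linarith)]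
    exact hx.1

/-- Integrals along the antidiagonal over a shell are bounded by the integrals in the first
variable, for a function bounded by box averages. -/
theorem exists_lintegral_shell_le (hM : ∀ j, 0 < M j) {f : Finset (Fin n) → Rn n × Rn n → ℂ}
    (hf : ∀ S, SliceIntegrable (f S))
    (hd : ∀ S j, j ∉ S → HasWeakDeriv (f S) (f (insert j S)) (EuclideanSpace.single j 1))
    {C m : ℝ} (hC : 0 ≤ C) (hb : ∀ S ξ, ∫⁻ ζ, ‖f S (ζ, ξ)‖ₑ
      ≤ ENNReal.ofReal (C * mWeight M ξ ^ (m - ∑ j ∈ S, 1 / M j))) :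
    ∃ A : ℝ, 0 ≤ A ∧ ∀ R : ℝ, 0 < R → ∀ᵐ η : Rn n,
      ∫⁻ ξ in {ξ | mWeight M ξ ∈ Set.Ico R (2 * R)}, ‖f ∅ (η - ξ, ξ)‖ₑ
        ≤ ENNReal.ofReal (A * R ^ m) := by
  obtain ⟨c, L, hc, hL, hcL⟩ := exists_mWeight_add_mem_Icc hM
  have hL0 : 0 < L := by linarith
  let σ : Finset (Fin n) → ℝ := fun T => ∑ j ∈ T, 1 / M j
  refine ⟨∑ T : Finset (Fin n), (c ^ homDim M)⁻¹ *
    (c ^ σ T * (C * L ^ |m - σ T| * (2 ^ n * L ^ homDim M))), by positivity, fun R hR => ?_⟩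
  -- At this scale the product of the sides over `T` compensates the gain `R ^ (-σ T)` of the
  -- derivatives, while the box does not leave the enlarged shell.
  set ℓ : Fin n → ℝ := fun j => (c * R) ^ (1 / M j) with hℓ
  have hℓ0 : ∀ j, 0 < ℓ j := fun j => by positivity
  have hℓT : ∀ T : Finset (Fin n), ∏ j ∈ T, ℓ j = c ^ σ T * R ^ σ T := by
    intro T
    rw [hℓ, ← Real.rpow_sum_of_pos (by positivity), Real.mul_rpow hc.le hR.le]
  have hcube := enorm_le_cubeAverage hf hd (fun j => (hℓ0 j).le) Finset.univ ∅
    (Finset.disjoint_empty_left _)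
  have hfm : ∀ S, Measurable (f S) := fun S => (hf S).measurable
  -- The shear (η, ξ) ↦ (η - ξ, ξ) preserves measure, so the inequality holds at almost every point
  -- of almost every antidiagonal.
  have hcube' : ∀ᵐ η : Rn n, ∀ᵐ ξ : Rn n, ‖f ∅ (η - ξ, ξ)‖ₑ
      ≤ cubeAverage f ℓ ∅ Finset.univ (η - ξ, ξ) :=
    Measure.ae_ae_of_ae_prod
      ((measurePreserving_sub_prod (volume : Measure (Rn n)) (volume : Measure (Rn n))
        ).quasiMeasurePreserving.ae hcube)
  set B : Set (Rn n) := {ξ | mWeight M ξ ∈ Set.Ico R (2 * R)} with hB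
  set B' : Set (Rn n) := {ξ | mWeight M ξ ∈ Set.Icc (R / L) (L * R)} with hB'
  set Q : Set (Rn n) := {y : Rn n | ∀ j, y j ∈ Set.Icc 0 (ℓ j)} with hQ
  have hBm : MeasurableSet B := measurable_mWeight hM measurableSet_Ico
  have hB'm : MeasurableSet B' := measurable_mWeight hM measurableSet_Icc
  have hQm : MeasurableSet Q := by
    have : Q = ⋂ j, {y : Rn n | y j ∈ Set.Icc 0 (ℓ j)} := by
      ext; simp [hQ]
    rw [this]
    exact MeasurableSet.iInter fun j => (by fun_prop : Measurable fun y : Rn n => y j) measurableSet_Icc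
  have hvol : volume B' ≤ ENNReal.ofReal (2 ^ n * (L * R) ^ homDim M) :=
    (measure_mono fun ξ hξ => hξ.2).trans (volume_mWeight_le hM (by positivity))
  -- The decoupling: replacing ξ by ξ - y turns the integrand into f(η - ξ + y, ξ), where `y` enters
  -- only the first variable. Its integral is bounded by the FL^1 norm at ξ, and the remaining
  -- integral costs the volume of the enlarged shell.
  have hT : ∀ (η : Rn n) (T : Finset (Fin n)),
      ∫⁻ ξ in B, ∫⁻ y in Q, ‖f T (η - ξ, ξ + y)‖ₑ
        ≤ ENNReal.ofReal (C * (L ^ |m - σ T| * R ^ (m - σ T)) * (2 ^ n * (L * R) ^ homDim M)) := by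
    intro η T
    have hm1 : Measurable fun p : Rn n × Rn n => ‖f T (η - p.1, p.1 + p.2)‖ₑ :=
      ((hfm T).comp (by fun_prop)).enorm
    have hm2 : Measurable fun p : Rn n × Rn n => ‖f T (η - p.1 + p.2, p.1)‖ₑ :=
      ((hfm T).comp (by fun_prop)).enorm
    rw [lintegral_lintegral_swap hm1.aemeasurable]
    calc ∫⁻ y in Q, ∫⁻ ξ in B, ‖f T (η - ξ, ξ + y)‖ₑ
        ≤ ∫⁻ y in Q, ∫⁻ ξ in B', ‖f T (η - ξ + y, ξ)‖ₑ := by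
          refine setLIntegral_mono' hQm fun y hy => ?_
          rw [← lintegral_indicator hBm, ← lintegral_indicator hB'm,
            ← lintegral_sub_right_eq_self _ y]
          refine lintegral_mono fun ξ => ?_
          by_cases hξ : ξ - y ∈ B
          · have hξ' : ξ ∈ B' := by
              have := hcL R (ξ - y) y hR hξ fun j => by
                rw [abs_of_nonneg (hy j).1]; exact (hy j).2
              rwa [sub_add_cancel] at this
            rw [Set.indicator_of_mem hξ, Set.indicator_of_mem hξ', sub_add_cancel, sub_sub_eq_add_sub,
              sub_add_eq_add_sub]
          · rw [Set.indicator_of_notMem hξ]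
            exact zero_le
      _ = ∫⁻ ξ in B', ∫⁻ y in Q, ‖f T (η - ξ + y, ξ)‖ₑ :=
          (lintegral_lintegral_swap hm2.aemeasurable).symm
      _ ≤ ∫⁻ ξ in B', ENNReal.ofReal (C * (L ^ |m - σ T| * R ^ (m - σ T))) := by
          refine setLIntegral_mono' hB'm fun ξ hξ => ?_
          refine (setLIntegral_le_lintegral _ _).trans ?_
          rw [lintegral_add_left_eq_self (fun ζ => ‖f T (ζ, ξ)‖ₑ) (η - ξ)]
          refine (hb T ξ).trans (ENNReal.ofReal_le_ofReal ?_)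
          gcongr
          exact rpow_le_rpow_abs_mul hL hR hξ _
      _ = ENNReal.ofReal (C * (L ^ |m - σ T| * R ^ (m - σ T))) * volume B' :=
          setLIntegral_const _ _
      _ ≤ _ := by
          rw [ENNReal.ofReal_mul (p := C * (L ^ |m - σ T| * R ^ (m - σ T))) (by positivity)]
          gcongr
  filter_upwards [hcube'] with η hη
  have hgm : ∀ ξ, Measurable fun y : Rn n => ∑ T : Finset (Fin n),
      ENNReal.ofReal (∏ j ∈ T, ℓ j) * ‖f T (η - ξ, ξ + y)‖ₑ := fun ξ =>
    Finset.measurable_sum _ fun T _ => measurable_const.mul ((hfm T).comp (by fun_prop)).enorm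
  have hyT : ∀ (T : Finset (Fin n)) (ξ : Rn n), Measurable fun y => ‖f T (η - ξ, ξ + y)‖ₑ :=
    fun T ξ => ((hfm T).comp (by fun_prop)).enorm
  have hξT : ∀ T : Finset (Fin n), Measurable fun ξ => ∫⁻ y in Q, ‖f T (η - ξ, ξ + y)‖ₑ := by
    intro T
    have : Measurable fun p : Rn n × Rn n => ‖f T (η - p.1, p.1 + p.2)‖ₑ :=
      ((hfm T).comp (by fun_prop)).enorm
    exact this.lintegral_prod_right'
  calc ∫⁻ ξ in B, ‖f ∅ (η - ξ, ξ)‖ₑ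
      ≤ ∫⁻ ξ in B, cubeAverage f ℓ ∅ Finset.univ (η - ξ, ξ) :=
        lintegral_mono_ae (ae_restrict_of_ae hη)
    _ ≤ ∫⁻ ξ in B, ENNReal.ofReal (∏ j, ℓ j)⁻¹ * ∑ T : Finset (Fin n),
          ENNReal.ofReal (∏ j ∈ T, ℓ j) * ∫⁻ y in Q, ‖f T (η - ξ, ξ + y)‖ₑ := by
        refine lintegral_mono fun ξ => ?_
        have := lintegral_cubeMeasure_comp_cubeShift_le hℓ0 (hgm ξ)
        refine (le_of_eq ?_).trans (this.trans (le_of_eq ?_))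
        · simp [cubeAverage, cubeIntegrand]
        · rw [lintegral_finsetSum _ fun T _ => (hyT T ξ).const_mul _]
          congr 1
          exact Finset.sum_congr rfl fun T _ => lintegral_const_mul _ (hyT T ξ)
    _ = ENNReal.ofReal (∏ j, ℓ j)⁻¹ * ∑ T : Finset (Fin n),
          ENNReal.ofReal (∏ j ∈ T, ℓ j) * ∫⁻ ξ in B, ∫⁻ y in Q, ‖f T (η - ξ, ξ + y)‖ₑ := by
        rw [lintegral_const_mul _ (Finset.measurable_sum _ fun T _ => (hξT T).const_mul _),
          lintegral_finsetSum _ fun T _ => (hξT T).const_mul _]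
        congr 1
        exact Finset.sum_congr rfl fun T _ => lintegral_const_mul _ (hξT T)
    _ ≤ ENNReal.ofReal (∏ j, ℓ j)⁻¹ * ∑ T : Finset (Fin n), ENNReal.ofReal (∏ j ∈ T, ℓ j) *
          ENNReal.ofReal (C * (L ^ |m - σ T| * R ^ (m - σ T)) * (2 ^ n * (L * R) ^ homDim M)) := by
        gcongr with T
        exact hT η T
    _ = _ := by
        -- The normalization by the box cancels the shell volume, both of order `R ^ homDim M`, and
        -- `R ^ σ T * R ^ (m - σ T)` leaves `R ^ m`.
        have hprod : ∏ j, ℓ j = c ^ homDim M * R ^ homDim M := hℓT Finset.univ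
        simp_rw [hprod, hℓT]
        have h1 : ∀ T : Finset (Fin n), ENNReal.ofReal (c ^ σ T * R ^ σ T) *
            ENNReal.ofReal (C * (L ^ |m - σ T| * R ^ (m - σ T)) * (2 ^ n * (L * R) ^ homDim M))
            = ENNReal.ofReal ((c ^ σ T * R ^ σ T) *
              (C * (L ^ |m - σ T| * R ^ (m - σ T)) * (2 ^ n * (L * R) ^ homDim M))) := fun T =>
          (ENNReal.ofReal_mul (by positivity)).symm
        simp_rw [h1]
        rw [← ENNReal.ofReal_sum_of_nonneg fun T _ => by positivity,
          ← ENNReal.ofReal_mul (by positivity), Finset.mul_sum, Finset.sum_mul]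
        congr 1
        refine Finset.sum_congr rfl fun T _ => ?_
        have e : R ^ σ T * R ^ (m - σ T) = R ^ m := by
          rw [← Real.rpow_add hR]; congr 1; ring
        have hp : 0 < R ^ homDim M := by positivity
        have hp' : 0 < c ^ homDim M := by positivity
        rw [Real.mul_rpow hL0.le hR.le, ← e]
        field_simp

end

/-! ### Boundedness on L^p of the weighted kernel. -/

section

variable {n : ℕ} {M : Fin n → ℝ}

/-- The scale `ρ x` is where the far factor is concentrated: `x` itself for 0 < s < r, and `1`
otherwise. In the latter cases `δ < 1` holds, either by assumption or because the interval contains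
some `s ≤ 0`. -/
theorem exists_weight_split {K κ r δ s : ℝ} (hK : 1 ≤ K) (hκ0 : 0 ≤ κ) (hκ : κ < r)
    (hδ : δ ≤ 1) (hs : s ∈ Set.Ioo ((δ - 1) * (r - κ)) r ∨ (δ < 1 ∧ s = r)) :
    ∃ (C ε : ℝ) (ρ : ℝ → ℝ), 0 < C ∧ 0 < ε ∧ Measurable ρ ∧
      (∀ x, 1 ≤ x → 0 < ρ x) ∧
      ∀ x y z : ℝ, 1 ≤ x → 1 ≤ y → 1 ≤ z →
      x ≤ K * (z + y) → y ≤ K * (x + z) → z ≤ K * (x + y) →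
      x ^ s * y ^ (-s) ≤ C * min (y / x) (x / y) ^ ε ∨
      x ^ s * y ^ (-s) ≤ C * min (y / ρ x) (ρ x / y) ^ ε * y ^ (-κ) *
        (z ^ r * y ^ (-(δ * (r - κ)))) := by
  rcases lt_or_ge 0 s with h0 | h0
  · by_cases hsr : s < r
    · obtain ⟨C, ε, hC, hε, h⟩ := weight_split_of_pos hK hκ hδ h0 hsr
      exact ⟨C, ε, id, hC, hε, measurable_id, fun x hx => lt_of_lt_of_le one_pos hx,
        fun x y z hx hy hz e1 _ e3 => h x y z hx hy hz e1 e3⟩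
    · obtain ⟨h1, h2⟩ : δ < 1 ∧ s = r := hs.resolve_left fun h => hsr h.2
      obtain ⟨C, ε, hC, hε, h⟩ := weight_split_of_lt_one hK hκ0 hκ h1 (by nlinarith) h2.le
      exact ⟨C, ε, fun _ => 1, hC, hε, measurable_const, fun _ _ => one_pos,
        fun x y z hx hy hz e1 e2 _ => h x y z hx hy hz e1 e2⟩
  · have h1 : s ∈ Set.Ioo ((δ - 1) * (r - κ)) r := hs.resolve_right fun h => by
      linarith [h.2]
    obtain ⟨C, ε, hC, hε, h⟩ := weight_split_of_lt_one hK hκ0 hκ (by nlinarith [h1.1]) h1.1 h1.2.le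
    exact ⟨C, ε, fun _ => 1, hC, hε, measurable_const, fun _ _ => one_pos,
      fun x y z hx hy hz e1 e2 _ => h x y z hx hy hz e1 e2⟩

/-- This explains the exponent n/(μ_* q). For finite `q` its q-th power ⟨ξ⟩^{-n/μ_*} offsets the
volume of each dyadic shell, and the minimum makes the sum over shells converge. For `q = ⊤` the
power disappears and the function is at most `1`. -/
theorem exists_eLpNorm_min_rpow_mul_le (hn : 0 < n) (hM : ∀ j, 0 < M j) {q : ℝ≥0∞} (hq : q ≠ 0)
    {ε : ℝ} (hε : 0 < ε) : ∃ A : ℝ≥0∞, A ≠ ⊤ ∧ ∀ R : ℝ, 0 < R →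
      eLpNorm (fun ξ : Rn n => ENNReal.ofReal (min (mWeight M ξ / R) (R / mWeight M ξ) ^ ε *
        mWeight M ξ ^ (-(n / muMin M * (q⁻¹).toReal)))) q volume ≤ A := by
  rcases eq_or_ne q ⊤ with rfl | hq'
  · refine ⟨1, by simp, fun R hR => ?_⟩
    rw [eLpNorm_exponent_top]
    refine essSup_le_of_ae_le _ (Filter.Eventually.of_forall fun ξ => ?_)
    simp only [ENNReal.inv_top, ENNReal.toReal_zero, mul_zero, neg_zero, Real.rpow_zero, mul_one,
      enorm_eq_self]
    refine ENNReal.ofReal_le_one.2 (Real.rpow_le_one ?_ ?_ hε.le)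
    · have := mWeight_pos M ξ
      positivity
    · have := mWeight_pos M ξ
      rcases le_total (mWeight M ξ) R with h | h
      · exact (min_le_left _ _).trans ((div_le_one hR).2 h)
      · exact (min_le_right _ _).trans ((div_le_one this).2 h)
  · have hQ : 0 < q.toReal := ENNReal.toReal_pos hq hq'
    obtain ⟨C, hC, h⟩ := exists_lintegral_min_rpow_mul_le hM (mul_pos hε hQ)
    refine ⟨(C * ENNReal.ofReal (2 ^ n * 2 ^ homDim M)) ^ (1 / q.toReal),
      ENNReal.rpow_ne_top_of_nonneg (by positivity) (ENNReal.mul_ne_top hC ENNReal.ofReal_ne_top),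
      fun R hR => ?_⟩
    rw [eLpNorm_eq_lintegral_rpow_enorm_toReal hq hq']
    gcongr
    have key := h (fun ξ => ENNReal.ofReal (mWeight M ξ ^ (-(n / muMin M))))
      (ENNReal.ofReal (2 ^ n * 2 ^ homDim M)) ?_ R hR
    · refine le_trans (le_of_eq (lintegral_congr fun ξ => ?_)) key
      have hw := mWeight_pos M ξ
      have hm : 0 ≤ min (mWeight M ξ / R) (R / mWeight M ξ) := by positivity
      rw [enorm_eq_self, ENNReal.ofReal_rpow_of_nonneg (by positivity) hQ.le,
        ← ENNReal.ofReal_mul (by positivity), Real.mul_rpow (by positivity) (by positivity),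
        ← Real.rpow_mul hm, ← Real.rpow_mul hw.le]
      congr 3
      rw [ENNReal.toReal_inv]
      field_simp
    · intro i
      have hm : 0 ≤ (n : ℝ) / muMin M :=
        le_trans (Finset.sum_nonneg fun j _ => by have := hM j; positivity) (homDim_le hn hM)
      calc _ ≤ ∫⁻ ξ in {ξ : Rn n | mWeight M ξ ∈ Set.Ico ((2 : ℝ) ^ i) (2 ^ (i + 1))},
            ENNReal.ofReal (((2 : ℝ) ^ i) ^ (-(n / muMin M))) := by
            refine setLIntegral_mono' (measurable_mWeight hM measurableSet_Ico) fun ξ hξ => ?_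
            refine ENNReal.ofReal_le_ofReal ?_
            exact Real.rpow_le_rpow_of_nonpos (by positivity) hξ.1 (by linarith)
        _ = ENNReal.ofReal (((2 : ℝ) ^ i) ^ (-(n / muMin M))) *
            volume {ξ : Rn n | mWeight M ξ ∈ Set.Ico ((2 : ℝ) ^ i) (2 ^ (i + 1))} :=
            setLIntegral_const _ _
        _ ≤ ENNReal.ofReal (((2 : ℝ) ^ i) ^ (-(n / muMin M))) *
            ENNReal.ofReal (2 ^ n * (2 ^ (i + 1)) ^ homDim M) := by
            gcongr
            exact (measure_mono fun ξ hξ => hξ.2.le).trans (volume_mWeight_le hM (by positivity))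
        _ ≤ _ := by
            rw [← ENNReal.ofReal_mul (by positivity)]
            refine ENNReal.ofReal_le_ofReal ?_
            have e : ((2 : ℝ) ^ (i + 1)) ^ homDim M = 2 ^ homDim M * ((2 : ℝ) ^ i) ^ homDim M := by
              rw [pow_succ, Real.mul_rpow (by positivity) (by norm_num), mul_comm]
            have h1 : ((2 : ℝ) ^ i) ^ (-(n / muMin M)) * ((2 : ℝ) ^ i) ^ homDim M ≤ 1 := by
              rw [← Real.rpow_add (by positivity)]
              exact Real.rpow_le_one_of_one_le_of_nonpos (one_le_pow₀ one_le_two)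
                (by linarith [homDim_le hn hM])
            rw [e]
            calc _ = 2 ^ n * 2 ^ homDim M *
                  (((2 : ℝ) ^ i) ^ (-(n / muMin M)) * ((2 : ℝ) ^ i) ^ homDim M) := by ring
              _ ≤ 2 ^ n * 2 ^ homDim M * 1 := by gcongr
              _ = _ := mul_one _

theorem eLpNorm_le_of_le_mul_add {X : Type*} [MeasurableSpace X] {μ : Measure X} {p c : ℝ≥0∞}
    (hp : 1 ≤ p) (hc : c ≠ ⊤) {F G₁ G₂ : X → ℝ≥0∞} (h₁ : Measurable G₁) (h₂ : Measurable G₂)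
    (h : ∀ x, F x ≤ c * (G₁ x + G₂ x)) :
    eLpNorm F p μ ≤ c * (eLpNorm G₁ p μ + eLpNorm G₂ p μ) := by
  lift c to NNReal using hc
  refine (eLpNorm_le_mul_eLpNorm_of_ae_le_mul' (g := G₁ + G₂)
    (Filter.Eventually.of_forall h) p).trans ?_
  gcongr
  exact eLpNorm_add_le h₁.aestronglyMeasurable h₂.aestronglyMeasurable hp

/-- The kernel of the part of the operator where `⟨η⟩` and `⟨ξ⟩` are compared. -/
def nearKernel (M : Fin n → ℝ) (ε m : ℝ) (F : Rn n × Rn n → ℂ) (η ξ : Rn n) : ℝ≥0∞ :=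
  ENNReal.ofReal (min (mWeight M ξ / mWeight M η) (mWeight M η / mWeight M ξ) ^ ε) *
    (ENNReal.ofReal (mWeight M ξ ^ (-m)) * ‖F (η - ξ, ξ)‖ₑ)

/-- The factor in `L^q` of the kernel of the part of the operator where `⟨η - ξ⟩` dominates. -/
def farFactor (M : Fin n → ℝ) (ρ : ℝ → ℝ) (ε κ : ℝ) (η ξ : Rn n) : ℝ≥0∞ :=
  ENNReal.ofReal (min (mWeight M ξ / ρ (mWeight M η)) (ρ (mWeight M η) / mWeight M ξ) ^ ε *
    mWeight M ξ ^ (-κ))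

/-- The factor in `L^p` of the kernel of the part of the operator where `⟨η - ξ⟩` dominates. -/
def farKernel (M : Fin n → ℝ) (r a : ℝ) (F : Rn n × Rn n → ℂ) (η ξ : Rn n) : ℝ≥0∞ :=
  ENNReal.ofReal (mWeight M (η - ξ) ^ r * mWeight M ξ ^ (-a)) * ‖F (η - ξ, ξ)‖ₑ

theorem measurable_enorm_comp_sub {F : Rn n × Rn n → ℂ} (hF : Measurable F) :
    Measurable fun z : Rn n × Rn n => ‖F (z.1 - z.2, z.2)‖ₑ :=
  (hF.comp (by fun_prop)).enorm

theorem measurable_nearKernel (hM : ∀ j, 0 < M j) {F : Rn n × Rn n → ℂ} (hF : Measurable F)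
    (ε m : ℝ) : Measurable (Function.uncurry (nearKernel M ε m F)) := by
  have hwm := measurable_mWeight hM
  have h1 : Measurable fun z : Rn n × Rn n => mWeight M z.1 := hwm.comp measurable_fst
  have h2 : Measurable fun z : Rn n × Rn n => mWeight M z.2 := hwm.comp measurable_snd
  exact (((h2.div h1).min (h1.div h2)).pow_const _).ennreal_ofReal.mul
    ((h2.pow_const _).ennreal_ofReal.mul (measurable_enorm_comp_sub hF))

theorem measurable_farFactor (hM : ∀ j, 0 < M j) {ρ : ℝ → ℝ} (hρ : Measurable ρ) (ε κ : ℝ) :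
    Measurable (Function.uncurry (farFactor M ρ ε κ)) := by
  have hwm := measurable_mWeight hM
  have h1 : Measurable fun z : Rn n × Rn n => ρ (mWeight M z.1) :=
    hρ.comp (hwm.comp measurable_fst)
  have h2 : Measurable fun z : Rn n × Rn n => mWeight M z.2 := hwm.comp measurable_snd
  exact ((((h2.div h1).min (h1.div h2)).pow_const _).mul (h2.pow_const _)).ennreal_ofReal

theorem measurable_farKernel (hM : ∀ j, 0 < M j) {F : Rn n × Rn n → ℂ} (hF : Measurable F)
    (r a : ℝ) : Measurable (Function.uncurry (farKernel M r a F)) := by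
  have hwm := measurable_mWeight hM
  have h1 : Measurable fun z : Rn n × Rn n => mWeight M (z.1 - z.2) :=
    hwm.comp (measurable_fst.sub measurable_snd)
  have h2 : Measurable fun z : Rn n × Rn n => mWeight M z.2 := hwm.comp measurable_snd
  exact ((h1.pow_const _).mul (h2.pow_const _)).ennreal_ofReal.mul (measurable_enorm_comp_sub hF)

/-- Schur test. Integrating in `η` needs only the FL^1 bound, since the minimum is at most `1`;
integrating in `ξ` needs the shell bound and the decay of the minimum away from ⟨η⟩. -/
theorem exists_eLpNorm_nearKernel_le (hM : ∀ j, 0 < M j) {p q : ℝ≥0∞}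
    (hpq : p⁻¹ + q⁻¹ = 1) {ε m C A₁ : ℝ} (hε : 0 < ε)
    {F : Rn n × Rn n → ℂ} (hF : Measurable F)
    (hb : ∀ ξ, ∫⁻ ζ, ‖F (ζ, ξ)‖ₑ ≤ ENNReal.ofReal (C * mWeight M ξ ^ m))
    (hshell : ∀ R : ℝ, 0 < R → ∀ᵐ η : Rn n,
      ∫⁻ ξ in {ξ | mWeight M ξ ∈ Set.Ico R (2 * R)}, ‖F (η - ξ, ξ)‖ₑ
        ≤ ENNReal.ofReal (A₁ * R ^ m)) :
    ∃ D : ℝ≥0∞, D ≠ ⊤ ∧ ∀ V : Rn n → ℝ≥0∞, Measurable V →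
      eLpNorm (fun η => ∫⁻ ξ, nearKernel M ε m F η ξ * V ξ) p volume
        ≤ D * eLpNorm V p volume := by
  obtain ⟨A₂, hA₂, hmin⟩ := exists_lintegral_min_rpow_mul_le hM hε
  have hwm := measurable_mWeight hM
  set D : ℝ≥0∞ := max (A₂ * ENNReal.ofReal (2 ^ |m| * A₁)) (ENNReal.ofReal C) with hD
  have hDtop : D ≠ ⊤ := by
    rw [hD, ne_eq, max_eq_top, not_or]
    exact ⟨ENNReal.mul_ne_top hA₂ ENNReal.ofReal_ne_top, ENNReal.ofReal_ne_top⟩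
  have schur1 : ∀ᵐ η : Rn n, ∫⁻ ξ, nearKernel M ε m F η ξ ≤ D := by
    have hall : ∀ᵐ η : Rn n, ∀ i : ℕ,
        ∫⁻ ξ in {ξ | mWeight M ξ ∈ Set.Ico ((2 : ℝ) ^ i) (2 * 2 ^ i)}, ‖F (η - ξ, ξ)‖ₑ
          ≤ ENNReal.ofReal (A₁ * ((2 : ℝ) ^ i) ^ m) :=
      ae_all_iff.2 fun i => hshell _ (by positivity)
    filter_upwards [hall] with η hη
    refine (hmin _ (ENNReal.ofReal (2 ^ |m| * A₁)) (fun i => ?_) _ (mWeight_pos M η)).trans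
      (le_max_left _ _)
    rw [pow_succ, mul_comm ((2 : ℝ) ^ i) 2]
    have h2i : (0 : ℝ) < 2 ^ i := by positivity
    calc _ ≤ ∫⁻ ξ in {ξ | mWeight M ξ ∈ Set.Ico ((2 : ℝ) ^ i) (2 * 2 ^ i)},
          ENNReal.ofReal (2 ^ |m| * ((2 : ℝ) ^ i) ^ (-m)) * ‖F (η - ξ, ξ)‖ₑ := by
          refine setLIntegral_mono' (hwm measurableSet_Ico) fun ξ hξ => ?_
          gcongr
          rw [← abs_neg m]
          refine rpow_le_rpow_abs_mul one_le_two h2i ⟨?_, hξ.2.le⟩ _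
          linarith [hξ.1]
      _ = ENNReal.ofReal (2 ^ |m| * ((2 : ℝ) ^ i) ^ (-m)) *
          ∫⁻ ξ in {ξ | mWeight M ξ ∈ Set.Ico ((2 : ℝ) ^ i) (2 * 2 ^ i)}, ‖F (η - ξ, ξ)‖ₑ :=
          lintegral_const_mul' _ _ ENNReal.ofReal_ne_top
      _ ≤ ENNReal.ofReal (2 ^ |m| * ((2 : ℝ) ^ i) ^ (-m)) *
          ENNReal.ofReal (A₁ * ((2 : ℝ) ^ i) ^ m) := by gcongr; exact hη i
      _ = _ := by
          rw [← ENNReal.ofReal_mul (by positivity)]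
          congr 1
          rw [Real.rpow_neg h2i.le]
          have : (0 : ℝ) < ((2 : ℝ) ^ i) ^ m := by positivity
          field_simp
  have schur2 : ∀ᵐ ξ : Rn n, ∫⁻ η, nearKernel M ε m F η ξ ≤ D := by
    refine Filter.Eventually.of_forall fun ξ => le_trans ?_ (le_max_right _ _)
    have hξ := mWeight_pos M ξ
    calc ∫⁻ η, nearKernel M ε m F η ξ
        ≤ ∫⁻ η, ENNReal.ofReal (mWeight M ξ ^ (-m)) * ‖F (η - ξ, ξ)‖ₑ := by
          refine lintegral_mono fun η => mul_le_of_le_one_left zero_le ?_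
          have hη := mWeight_pos M η
          refine ENNReal.ofReal_le_one.2 (Real.rpow_le_one (by positivity) ?_ hε.le)
          rcases le_total (mWeight M ξ) (mWeight M η) with h | h
          · exact (min_le_left _ _).trans ((div_le_one hη).2 h)
          · exact (min_le_right _ _).trans ((div_le_one hξ).2 h)
      _ = ENNReal.ofReal (mWeight M ξ ^ (-m)) * ∫⁻ ζ, ‖F (ζ, ξ)‖ₑ := by
          rw [lintegral_const_mul' _ _ ENNReal.ofReal_ne_top,
            lintegral_sub_right_eq_self (fun ζ => ‖F (ζ, ξ)‖ₑ) ξ]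
      _ ≤ ENNReal.ofReal (mWeight M ξ ^ (-m)) * ENNReal.ofReal (C * mWeight M ξ ^ m) := by
          gcongr
          simpa using hb ξ
      _ = _ := by
          rw [← ENNReal.ofReal_mul (by positivity)]
          congr 1
          rw [Real.rpow_neg hξ.le]
          have : 0 < mWeight M ξ ^ m := by positivity
          field_simp
  exact ⟨D ^ (q⁻¹).toReal * D ^ (p⁻¹).toReal, ENNReal.mul_ne_top
    (ENNReal.rpow_ne_top_of_nonneg ENNReal.toReal_nonneg hDtop)
    (ENNReal.rpow_ne_top_of_nonneg ENNReal.toReal_nonneg hDtop), fun V hV =>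
    eLpNorm_lintegral_mul_le_of_schur hpq (measurable_nearKernel hM hF ε m) schur1 schur2 hV⟩

/-- For fixed `ξ` the kernel is a translate of the weighted transform, and ⟨ξ⟩^{-a} cancels the
growth of its norm. -/
theorem eLpNorm_farKernel_le (hM : ∀ j, 0 < M j) {p : ℝ≥0∞} {r a C : ℝ}
    {F : Rn n × Rn n → ℂ} (hF : Measurable F) (ξ : Rn n)
    (hbp : eLpNorm (fun ζ => ((mWeight M ζ ^ r : ℝ) : ℂ) * F (ζ, ξ)) p volume
      ≤ ENNReal.ofReal (C * mWeight M ξ ^ a)) :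
    eLpNorm (fun η => farKernel M r a F η ξ) p volume ≤ ENNReal.ofReal C := by
  have hwm := measurable_mWeight hM
  have hξ := mWeight_pos M ξ
  let G : Rn n → ℂ := (mWeight M ξ ^ (-a) : ℝ) •
    fun ζ => ((mWeight M ζ ^ r : ℝ) : ℂ) * F (ζ, ξ)
  have hG : Measurable G := by
    have h1 : Measurable fun ζ : Rn n => ((mWeight M ζ ^ r : ℝ) : ℂ) :=
      Complex.measurable_ofReal.comp (hwm.pow_const _)
    exact (h1.mul (hF.comp measurable_prodMk_right)).const_smul _
  have e : (fun η => farKernel M r a F η ξ) = fun η => ‖(G ∘ fun η => η - ξ) η‖ₑ := by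
    ext η
    have hz := mWeight_pos M (η - ξ)
    simp only [G, farKernel, Function.comp, Pi.smul_apply]
    rw [enorm_smul, enorm_mul, ← mul_assoc, Real.enorm_eq_ofReal (by positivity),
      ENNReal.ofReal_mul (by positivity), mul_comm (ENNReal.ofReal (mWeight M (η - ξ) ^ r))]
    congr 2
    rw [← ofReal_norm, Complex.norm_real, Real.norm_of_nonneg (by positivity)]
  rw [e, eLpNorm_enorm, eLpNorm_comp_measurePreserving hG.aestronglyMeasurable
    (measurePreserving_sub_right volume ξ), eLpNorm_const_smul, Real.enorm_eq_ofReal (by positivity)]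
  calc _ ≤ ENNReal.ofReal (mWeight M ξ ^ (-a)) *
        ENNReal.ofReal (C * mWeight M ξ ^ a) := by
        gcongr
    _ = _ := by
        rw [← ENNReal.ofReal_mul (by positivity)]
        congr 1
        rw [Real.rpow_neg hξ.le]
        have : 0 < mWeight M ξ ^ a := by positivity
        field_simp

/-- The main estimate: the integral operator with kernel `⟨η⟩^s ⟨ξ⟩^{-(s+m)} f(η - ξ, ξ)` is
absolutely bounded on `L^p`. -/
theorem exists_eLpNorm_lintegral_kernel_le (hn : 0 < n) (hM : ∀ j, 0 < M j) {p q : ℝ≥0∞}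
    (hpq : p⁻¹ + q⁻¹ = 1) {r δ m s C : ℝ} (hC : 0 ≤ C)
    (hr : n / muMin M * (q⁻¹).toReal < r) (hδ : δ ≤ 1)
    (hs : s ∈ Set.Ioo ((δ - 1) * (r - n / muMin M * (q⁻¹).toReal)) r ∨ (δ < 1 ∧ s = r))
    {f : Finset (Fin n) → Rn n × Rn n → ℂ} (hf : ∀ S, SliceIntegrable (f S))
    (hd : ∀ S j, j ∉ S → HasWeakDeriv (f S) (f (insert j S)) (EuclideanSpace.single j 1))
    (hb : ∀ S ξ, ∫⁻ ζ, ‖f S (ζ, ξ)‖ₑ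
      ≤ ENNReal.ofReal (C * mWeight M ξ ^ (m - ∑ j ∈ S, 1 / M j)))
    (hbp : ∀ ξ, eLpNorm (fun ζ => ((mWeight M ζ ^ r : ℝ) : ℂ) * f ∅ (ζ, ξ)) p volume
      ≤ ENNReal.ofReal (C * mWeight M ξ ^ (m + δ * (r - n / muMin M * (q⁻¹).toReal)))) :
    ∃ A : ℝ≥0∞, A ≠ ⊤ ∧ ∀ V : Rn n → ℝ≥0∞, Measurable V →
      eLpNorm (fun η => ∫⁻ ξ, ENNReal.ofReal (mWeight M η ^ s * mWeight M ξ ^ (-(s + m))) *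
        ‖f ∅ (η - ξ, ξ)‖ₑ * V ξ) p volume ≤ A * eLpNorm V p volume := by
  have hp1 : 1 ≤ p := by
    rw [← ENNReal.inv_le_one, ← hpq]; exact le_self_add
  have hq0 : q ≠ 0 := by rintro rfl; simp at hpq
  set κ : ℝ := n / muMin M * (q⁻¹).toReal with hκ
  have hκ0 : 0 ≤ κ := mul_nonneg
    (le_trans (Finset.sum_nonneg fun j _ => by have := hM j; positivity) (homDim_le hn hM))
    ENNReal.toReal_nonneg
  obtain ⟨K, hK, htri⟩ := exists_mWeight_add_le hM
  obtain ⟨C₀, ε, ρ, hC₀, hε, hρm, hρ, hsplit⟩ := exists_weight_split hK hκ0 hr hδ hs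
  obtain ⟨A₁, hA₁, hshell⟩ := exists_lintegral_shell_le hM hf hd hC hb
  obtain ⟨A₃, hA₃, hbq⟩ := exists_eLpNorm_min_rpow_mul_le hn hM hq0 hε
  simp only [← hκ] at hbq
  clear_value κ
  have hfac : ∀ η : Rn n, eLpNorm (farFactor M ρ ε κ η) q volume ≤ A₃ := fun η =>
    hbq (ρ (mWeight M η)) (hρ _ (one_le_mWeight M η))
  have hfm : Measurable (f ∅) := (hf ∅).measurable
  obtain ⟨D, hD, hnear⟩ := exists_eLpNorm_nearKernel_le hM hpq hε hfm
    (fun ξ => by simpa using hb ∅ ξ) hshell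
  set a := m + δ * (r - κ) with ha
  have hpt : ∀ η ξ : Rn n, ENNReal.ofReal (mWeight M η ^ s * mWeight M ξ ^ (-(s + m))) *
      ‖f ∅ (η - ξ, ξ)‖ₑ ≤ ENNReal.ofReal C₀ * (nearKernel M ε m (f ∅) η ξ +
        farFactor M ρ ε κ η ξ * farKernel M r a (f ∅) η ξ) := by
    intro η ξ
    have hη := mWeight_pos M η
    have hξ := mWeight_pos M ξ
    have hz := mWeight_pos M (η - ξ)
    have hρη := hρ _ (one_le_mWeight M η)
    have t1 : mWeight M η ≤ K * (mWeight M (η - ξ) + mWeight M ξ) := by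
      simpa using htri (η - ξ) ξ
    have t2 : mWeight M ξ ≤ K * (mWeight M η + mWeight M (η - ξ)) := by
      have := htri η (-(η - ξ))
      rwa [mWeight_neg, neg_sub, add_sub_cancel] at this
    have t3 : mWeight M (η - ξ) ≤ K * (mWeight M η + mWeight M ξ) := by
      have := htri η (-ξ)
      rwa [mWeight_neg, ← sub_eq_add_neg] at this
    have em : mWeight M ξ ^ (-(s + m)) = mWeight M ξ ^ (-s) * mWeight M ξ ^ (-m) := by
      rw [← Real.rpow_add hξ]; congr 1; ring
    -- Each alternative bounds the kernel by one of the two summands, and the other is nonnegative;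
    -- hence no regions of integration have to be separated.
    rcases hsplit _ _ _ (one_le_mWeight M η) (one_le_mWeight M ξ) (one_le_mWeight M (η - ξ))
      t1 t2 t3 with h | h
    · refine le_trans ?_ (mul_le_mul_right le_self_add _)
      unfold nearKernel
      rw [← mul_assoc, ← mul_assoc, ← ENNReal.ofReal_mul hC₀.le,
        ← ENNReal.ofReal_mul (by positivity), em, ← mul_assoc]
      gcongr
    · refine le_trans ?_ (mul_le_mul_right le_add_self _)
      unfold farFactor farKernel
      rw [← mul_assoc, ← mul_assoc, ← ENNReal.ofReal_mul hC₀.le,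
        ← ENNReal.ofReal_mul (by positivity), em, ← mul_assoc]
      gcongr ENNReal.ofReal ?_ * _
      refine (mul_le_mul_of_nonneg_right h (by positivity)).trans (le_of_eq ?_)
      have e2 : mWeight M ξ ^ (-a)
          = mWeight M ξ ^ (-(δ * (r - κ))) * mWeight M ξ ^ (-m) := by
        rw [← Real.rpow_add hξ, ha]; congr 1; ring
      rw [e2]
      ring
  have hm1 := measurable_nearKernel hM hfm ε m
  have hm2 := measurable_farFactor hM hρm ε κ
  have hm3 := measurable_farKernel hM hfm r a
  refine ⟨ENNReal.ofReal C₀ * (D + A₃ * ENNReal.ofReal C),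
    ENNReal.mul_ne_top ENNReal.ofReal_ne_top (ENNReal.add_ne_top.2 ⟨hD,
      ENNReal.mul_ne_top hA₃ ENNReal.ofReal_ne_top⟩), fun V hV => ?_⟩
  have hfar : eLpNorm (fun η => ∫⁻ ξ, farFactor M ρ ε κ η ξ * farKernel M r a (f ∅) η ξ * V ξ)
      p volume ≤ A₃ * ENNReal.ofReal C * eLpNorm V p volume := by
    refine eLpNorm_lintegral_mul_le hpq (fun η => hm2.comp measurable_prodMk_left) hm3 ?_ ?_ hV
    · exact Filter.Eventually.of_forall hfac
    · exact Filter.Eventually.of_forall fun ξ => eLpNorm_farKernel_le hM hfm ξ (hbp ξ)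
  have hI₁ : Measurable fun η => ∫⁻ ξ, nearKernel M ε m (f ∅) η ξ * V ξ :=
    (Measurable.mul hm1 (hV.comp measurable_snd)).lintegral_prod_right'
  have hI₂ : Measurable fun η =>
      ∫⁻ ξ, farFactor M ρ ε κ η ξ * farKernel M r a (f ∅) η ξ * V ξ :=
    ((Measurable.mul hm2 hm3).mul (hV.comp measurable_snd)).lintegral_prod_right'
  have hle : ∀ η, ∫⁻ ξ, ENNReal.ofReal (mWeight M η ^ s * mWeight M ξ ^ (-(s + m))) *
      ‖f ∅ (η - ξ, ξ)‖ₑ * V ξ ≤ ENNReal.ofReal C₀ * ((∫⁻ ξ, nearKernel M ε m (f ∅) η ξ * V ξ) +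
        ∫⁻ ξ, farFactor M ρ ε κ η ξ * farKernel M r a (f ∅) η ξ * V ξ) := by
    intro η
    have hmη : Measurable fun ξ => nearKernel M ε m (f ∅) η ξ * V ξ :=
      (hm1.comp measurable_prodMk_left).mul hV
    rw [← lintegral_add_left hmη, ← lintegral_const_mul' _ _ ENNReal.ofReal_ne_top]
    refine lintegral_mono fun ξ => ?_
    rw [← add_mul, ← mul_assoc]
    exact mul_le_mul_left (hpt η ξ) _
  have hfin := eLpNorm_le_of_le_mul_add (μ := volume) hp1 ENNReal.ofReal_ne_top hI₁ hI₂ hle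
  rw [mul_assoc, add_mul]
  exact hfin.trans (mul_le_mul_right (add_le_add (hnear V hV) hfar) _)

end

/-! ### Joint measurability of the partial transforms, and commuting derivatives in ξ. -/

section

variable {n : ℕ} {M : Fin n → ℝ}

/-- A strongly measurable family of elements of `L^1` is given by a jointly measurable function. -/
theorem exists_measurable_uncurry_ae_eq {X Y : Type*} [MeasurableSpace X] [MeasurableSpace Y]
    {μ : Measure X} [IsSeparable μ] {A : Y → Lp ℂ 1 μ} (hA : StronglyMeasurable A) :
    ∃ f : X × Y → ℂ, Measurable f ∧ ∀ y, (fun x => f (x, y)) =ᵐ[μ] A y := by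
  classical
  have : Fact ((1 : ℝ≥0∞) ≠ ⊤) := ⟨by simp⟩
  let d := TopologicalSpace.denseSeq (Lp ℂ 1 μ)
  have hd : ∀ (j : ℕ) (y : Y), ∃ i, dist (d i) (A y) < (1 / 2 : ℝ) ^ j := fun j y => by
    obtain ⟨i, hi⟩ := (TopologicalSpace.denseRange_denseSeq (Lp ℂ 1 μ)).exists_dist_lt (A y)
      (by positivity : (0 : ℝ) < (1 / 2 : ℝ) ^ j)
    exact ⟨i, by rwa [dist_comm]⟩
  -- Choosing the least index makes the selection measurable, and only countably many
  -- representatives occur, so each approximation `g j` is jointly measurable.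
  let i : ℕ → Y → ℕ := fun j y => Nat.find (hd j y)
  have hi : ∀ j, Measurable (i j) := fun j => by
    refine measurable_find (hd j) fun k => ?_
    have : StronglyMeasurable fun y => dist (d k) (A y) := stronglyMeasurable_const.dist hA
    exact this.measurable measurableSet_Iio
  have hispec : ∀ j y, dist (d (i j y)) (A y) < (1 / 2 : ℝ) ^ j := fun j y => Nat.find_spec (hd j y)
  let g : ℕ → X × Y → ℂ := fun j z => d (i j z.2) z.1
  have hg : ∀ j, Measurable (g j) := fun j => by
    have h1 : Measurable fun z : ℕ × X => d z.1 z.2 :=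
      measurable_from_prod_countable_right fun k => (Lp.stronglyMeasurable (d k)).measurable
    exact h1.comp (((hi j).comp measurable_snd).prodMk measurable_fst)
  refine ⟨fun z => Filter.limUnder Filter.atTop fun j => g j z,
    (StronglyMeasurable.limUnder fun j => (hg j).stronglyMeasurable).measurable, fun y => ?_⟩
  have hm : ∀ j, AEMeasurable (fun x => ‖g j (x, y) - A y x‖ₑ) μ := fun j =>
    (((hg j).comp measurable_prodMk_right).sub
      (Lp.stronglyMeasurable (A y)).measurable).enorm.aemeasurable
  -- The L^1 errors 2^{-j} are summable, so for every `y` the approximations converge at almost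
  -- every `x`, without passing to a subsequence.
  have hsum : ∫⁻ x, ∑' j, ‖g j (x, y) - A y x‖ₑ ∂μ ≠ ⊤ := by
    rw [lintegral_tsum hm]
    refine ne_top_of_le_ne_top (b := ∑' j : ℕ, ENNReal.ofReal ((1 / 2 : ℝ) ^ j)) ?_
      (ENNReal.tsum_le_tsum fun j => ?_)
    · rw [← ENNReal.ofReal_tsum_of_nonneg (fun j => by positivity) summable_geometric_two]
      exact ENNReal.ofReal_ne_top
    · have h1 : edist (d (i j y)) (A y) = ∫⁻ x, ‖g j (x, y) - A y x‖ₑ ∂μ := by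
        rw [Lp.edist_def, eLpNorm_one_eq_lintegral_enorm]; rfl
      rw [← h1, edist_dist]
      exact ENNReal.ofReal_le_ofReal (hispec j y).le
  have hfin := ae_lt_top' (AEMeasurable.tsum hm) hsum
  filter_upwards [hfin] with x hx
  have h0 := ENNReal.tendsto_atTop_zero_of_tsum_ne_top hx.ne
  refine Filter.Tendsto.limUnder_eq ?_
  rw [tendsto_iff_edist_tendsto_0]
  simpa [edist_eq_enorm_sub] using h0

/-- The extra factor `D j` commutes past all the others to the front; a list without duplicates
meets `j` at most once. -/
theorem foldr_iterate_update {ι E : Type*} [DecidableEq ι] (D : ι → E → E)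
    (hD : ∀ i j x, D i (D j x) = D j (D i x)) (α : ι → ℕ) (j : ι) (x : E) (l : List ι)
    (hl : l.Nodup) :
    l.foldr (fun i b => (D i)^[Function.update α j (α j + 1) i] b) x
      = if j ∈ l then D j (l.foldr (fun i b => (D i)^[α i] b) x)
        else l.foldr (fun i b => (D i)^[α i] b) x := by
  induction l with
  | nil => simp
  | cons i l ih =>
    rw [List.nodup_cons] at hl
    rw [List.foldr_cons, List.foldr_cons, ih hl.2]
    have hc : ∀ k y, (D i)^[k] (D j y) = D j ((D i)^[k] y) := fun k y =>
      (Function.Commute.iterate_left (f := D i) (g := D j) (fun z => hD i j z) k) y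
    by_cases hij : j = i
    · subst hij
      rw [if_neg hl.1, if_pos (by simp), Function.update_self, Function.iterate_succ_apply']
    · rw [Function.update_of_ne (Ne.symm hij)]
      by_cases hj : j ∈ l
      · rw [if_pos hj, if_pos (by simp [hj]), hc]
      · rw [if_neg hj, if_neg (by simp [hj, hij])]

theorem schwartz_lineDerivOp_comm {E : Type*} [NormedAddCommGroup E] [NormedSpace ℝ E]
    (f : 𝓢(E, ℂ)) (v w : E) : ∂_{v} (∂_{w} f) = ∂_{w} (∂_{v} f) := by
  ext x
  have hd : ∀ v w : E, (∂_{v} (∂_{w} f)) x = fderiv ℝ (fderiv ℝ f) x v w := fun v w => by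
    have h1 : DifferentiableAt ℝ (fderiv ℝ f) x :=
      ((f.smooth 2).fderiv_right (m := 1) (by norm_num)).differentiable (by norm_num) x
    have h2 : (∂_{w} f : 𝓢(E, ℂ)) = (fun y => fderiv ℝ f y w : E → ℂ) := rfl
    rw [SchwartzMap.lineDerivOp_apply_eq_fderiv, h2, fderiv_clm_apply h1 (by fun_prop)]
    simp
  rw [hd, hd]
  exact ((f.smooth 2).contDiffAt.isSymmSndFDerivAt (by simp)) v w

theorem distribution_lineDerivOp_comm (b : 𝓢'(Rn n × Rn n, ℂ)) (v w : Rn n × Rn n) :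
    ∂_{v} (∂_{w} b) = ∂_{w} (∂_{v} b) := by
  ext Φ
  simp only [TemperedDistribution.lineDerivOp_apply_apply]
  rw [lineDerivOp_neg, lineDerivOp_neg, schwartz_lineDerivOp_comm]

/-- The multi-index with entries `1` on `S` and `0` elsewhere. -/
def indicatorIndex (S : Finset (Fin n)) (j : Fin n) : ℕ := if j ∈ S then 1 else 0

theorem indicatorIndex_insert {S : Finset (Fin n)} {j : Fin n} (hj : j ∉ S) :
    indicatorIndex (insert j S) = Function.update (indicatorIndex S) j (indicatorIndex S j + 1) := by
  ext i
  by_cases h : i = j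
  · subst h; simp [indicatorIndex, hj]
  · simp [indicatorIndex, h]

theorem sum_indicatorIndex_le (S : Finset (Fin n)) : ∑ j, indicatorIndex S j ≤ n := by
  simp only [indicatorIndex, Finset.sum_ite_mem, Finset.univ_inter, Finset.sum_const, smul_eq_mul,
    mul_one]
  simpa using Finset.card_le_univ S

theorem mOrder_indicatorIndex (S : Finset (Fin n)) :
    mOrder M (indicatorIndex S) = ∑ j ∈ S, 1 / M j := by
  simp [mOrder, indicatorIndex, ite_div, Finset.sum_ite_mem]

theorem dXi_insert (a : 𝓢'(Rn n × Rn n, ℂ)) {S : Finset (Fin n)} {j : Fin n} (hj : j ∉ S) :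
    dXi (indicatorIndex (insert j S)) a
      = ∂_{((0, EuclideanSpace.single j 1) : Rn n × Rn n)} (dXi (indicatorIndex S) a) := by
  unfold dXi
  rw [indicatorIndex_insert hj, foldr_iterate_update
    (fun j (c : 𝓢'(Rn n × Rn n, ℂ)) => ∂_{((0, EuclideanSpace.single j 1) : Rn n × Rn n)} c)
    (fun i j b => distribution_lineDerivOp_comm b _ _) _ _ _ _ (List.nodup_finRange n),
    if_pos (List.mem_finRange j)]

theorem lineDerivOp_tensor (w v : 𝓢(Rn n, ℂ)) (e : Rn n) :
    ∂_{((0, e) : Rn n × Rn n)} (tensor w v) = tensor (∂_{e} w) v := by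
  ext z
  rw [SchwartzMap.lineDerivOp_apply_eq_fderiv, tensor_apply, SchwartzMap.lineDerivOp_apply_eq_fderiv]
  have h1 : HasFDerivAt (fun y : Rn n × Rn n => v y.1)
      ((fderiv ℝ v z.1).comp (ContinuousLinearMap.fst ℝ (Rn n) (Rn n))) z :=
    (v.differentiableAt.hasFDerivAt).comp z hasFDerivAt_fst
  have h2 : HasFDerivAt (fun y : Rn n × Rn n => w y.2)
      ((fderiv ℝ w z.2).comp (ContinuousLinearMap.snd ℝ (Rn n) (Rn n))) z :=
    (w.differentiableAt.hasFDerivAt).comp z hasFDerivAt_snd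
  have h3 : (tensor w v : Rn n × Rn n → ℂ) = fun y => v y.1 * w y.2 := rfl
  rw [h3]
  refine (DFunLike.congr_fun (h1.mul h2).fderiv _).trans ?_
  simp

theorem slice_tensor (w v : 𝓢(Rn n, ℂ)) (ξ : Rn n) : slice ξ (tensor w v) = w ξ • v := by
  ext x
  simp [slice_apply, tensor_apply, mul_comm]

end

/-! ### From the symbol class to a family of partial Fourier transforms. -/

section

variable {n : ℕ} {M : Fin n → ℝ} {p q : ℝ≥0∞}

theorem IsFunction.congr {v : 𝓢'(Rn n, ℂ)} {f g : Rn n → ℂ} (hf : IsFunction v f)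
    (h : f =ᵐ[volume] g) : IsFunction v g := by
  refine ⟨hf.1.congr h, fun φ => ?_⟩
  have h1 : (fun ξ => f ξ * φ ξ) =ᵐ[volume] fun ξ => g ξ * φ ξ := by
    filter_upwards [h] with ξ e; rw [e]
  exact ⟨(hf.2 φ).1.congr h1, (hf.2 φ).2.trans (integral_congr_ae h1)⟩

theorem FL.eLpNorm_eq_ofReal_norm [Fact (1 ≤ p)] {s : ℝ} (u : FL p s M) {f : Rn n → ℂ}
    (hf : IsFunction (fourierD n u.toDist) f) :
    eLpNorm (fun ξ => ((mWeight M ξ ^ s : ℝ) : ℂ) * f ξ) p volume = ENNReal.ofReal ‖u‖ := by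
  have h : eLpNorm (fun ξ => ((mWeight M ξ ^ s : ℝ) : ℂ) * f ξ) p volume
      = eLpNorm (fun ξ => ((mWeight M ξ ^ s : ℝ) : ℂ) * u.hat ξ) p volume :=
    eLpNorm_congr_ae (by filter_upwards [u.hat_unique hf] with ξ e; rw [e])
  rw [u.norm_eq hf, ENNReal.ofReal_toReal]
  rw [h]
  exact u.hat_spec.2.eLpNorm_ne_top

theorem FL.isometry_toLp [Fact (1 ≤ p)] {s : ℝ} :
    Isometry (FL.toLp : FL p s M → Lp ℂ p (volume : Measure (Rn n))) :=
  AddMonoidHomClass.isometry_of_norm _ fun _ => rfl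

theorem FL.exists_measurable_isFunction {A : Rn n → FL (n := n) 1 0 (fun _ => 1)}
    (hA : StronglyMeasurable A) :
    ∃ f : Rn n × Rn n → ℂ, Measurable f ∧
      ∀ ξ, IsFunction (fourierD n (A ξ).toDist) (fun ζ => f (ζ, ξ)) := by
  obtain ⟨f, hf, hfA⟩ := exists_measurable_uncurry_ae_eq
    (FL.isometry_toLp.continuous.comp_stronglyMeasurable hA)
  refine ⟨f, hf, fun ξ => (A ξ).hat_spec.1.congr ?_⟩
  filter_upwards [hfA ξ, (A ξ).hat_spec.2.coeFn_toLp] with ζ h1 h2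
  refine Eq.trans ?_ h1.symm
  refine Eq.trans ?_ h2.symm
  simp

theorem FL.lintegral_enorm_eq (u : FL (n := n) 1 0 (fun _ => 1)) {f : Rn n → ℂ}
    (hf : IsFunction (fourierD n u.toDist) f) : ∫⁻ ζ, ‖f ζ‖ₑ = ENNReal.ofReal ‖u‖ := by
  have := u.eLpNorm_eq_ofReal_norm hf
  rw [← this, eLpNorm_one_eq_lintegral_enorm]
  simp

theorem sliceIntegrable_of_bound (hM : ∀ j, 0 < M j) {f : Rn n × Rn n → ℂ} (hf : Measurable f)
    {C m : ℝ} (hC : 0 ≤ C)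
    (hb : ∀ ξ, ∫⁻ ζ, ‖f (ζ, ξ)‖ₑ ≤ ENNReal.ofReal (C * mWeight M ξ ^ m)) : SliceIntegrable f := by
  obtain ⟨k, K, hK, hw⟩ := exists_mWeight_rpow_le_one_add_norm_pow hM m
  refine ⟨hf, fun R => ⟨ENNReal.ofReal (C * (K * (1 + R) ^ k)), ENNReal.ofReal_ne_top,
    fun ξ hξ => (hb ξ).trans (ENNReal.ofReal_le_ofReal ?_)⟩⟩
  refine mul_le_mul_of_nonneg_left ((hw ξ).trans ?_) hC
  have := norm_nonneg ξ
  gcongr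

/-- Tested on w(ξ) ψ̂(x), the pairing moves the Fourier transform onto the coefficient, so `b`
becomes the double integral of `f` against ψ and w. The distributional derivative then falls on `w`,
with the minus sign. -/
theorem hasWeakDeriv_of_isFamily {b : 𝓢'(Rn n × Rn n, ℂ)} {e : Rn n}
    {A B : Rn n → 𝓢'(Rn n, ℂ)} (hA : IsFamily b A)
    (hB : IsFamily (∂_{((0, e) : Rn n × Rn n)} b) B) {f g : Rn n × Rn n → ℂ}
    (hf : ∀ ξ, IsFunction (fourierD n (A ξ)) (fun ζ => f (ζ, ξ)))
    (hg : ∀ ξ, IsFunction (fourierD n (B ξ)) (fun ζ => g (ζ, ξ))) : HasWeakDeriv f g e := by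
  intro ψ w hψ hψc hw hwc
  have hψc' : HasCompactSupport (fun y => ((ψ y : ℝ) : ℂ)) :=
    hψc.comp_left (g := fun t : ℝ => (t : ℂ)) rfl
  have hψ' : ContDiff ℝ ∞ (fun y => ((ψ y : ℝ) : ℂ)) := Complex.ofRealCLM.contDiff.comp hψ
  have hwc' : HasCompactSupport (fun y => ((w y : ℝ) : ℂ)) :=
    hwc.comp_left (g := fun t : ℝ => (t : ℂ)) rfl
  have hw' : ContDiff ℝ ∞ (fun y => ((w y : ℝ) : ℂ)) := Complex.ofRealCLM.contDiff.comp hw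
  let Ψ : 𝓢(Rn n, ℂ) := hψc'.toSchwartzMap hψ'
  let W : 𝓢(Rn n, ℂ) := hwc'.toSchwartzMap hw'
  have hW : ∀ ξ, (∂_{e} W) ξ = ((fderiv ℝ w ξ e : ℝ) : ℂ) := fun ξ => by
    rw [SchwartzMap.lineDerivOp_apply_eq_fderiv]
    have h1 : HasFDerivAt (fun y => ((w y : ℝ) : ℂ)) (Complex.ofRealCLM.comp (fderiv ℝ w ξ)) ξ :=
      Complex.ofRealCLM.hasFDerivAt.comp ξ
        ((hw.differentiable (by simp)).differentiableAt).hasFDerivAt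
    exact DFunLike.congr_fun h1.fderiv e
  have key : ∀ (c : 𝓢(Rn n, ℂ)) (E : Rn n → 𝓢'(Rn n, ℂ)) (h : Rn n × Rn n → ℂ),
      (∀ ξ, IsFunction (fourierD n (E ξ)) (fun ζ => h (ζ, ξ))) → ∀ ξ,
      E ξ (slice ξ (tensor c (fourierS n Ψ))) = c ξ * ∫ ζ, ψ ζ • h (ζ, ξ) := by
    intro c E h hE ξ
    rw [slice_tensor, map_smul, ← fourierD_apply, (hE ξ).2 Ψ |>.2, smul_eq_mul]
    congr 2
    ext ζ
    rw [Complex.real_smul, mul_comm]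
    rfl
  have h1 := (hB (tensor W (fourierS n Ψ))).2
  rw [TemperedDistribution.lineDerivOp_apply_apply, map_neg, lineDerivOp_tensor,
    (hA (tensor (∂_{e} W) (fourierS n Ψ))).2] at h1
  simp only [key _ A f hf, key _ B g hg, hW] at h1
  simp only [Complex.real_smul] at h1 ⊢
  exact h1.symm

/-- The partial Fourier transforms of the derivatives `∂_ξ^S a` of a symbol. -/
theorem IsSymbol.exists_fourier_family [Fact (1 ≤ p)] (hM : ∀ j, 0 < M j) {r m δ : ℝ} {N : ℕ}
    (hN : n ≤ N) {a : 𝓢'(Rn n × Rn n, ℂ)} (ha : IsSymbol p q r m δ M N a) :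
    ∃ (C : ℝ) (f : Finset (Fin n) → Rn n × Rn n → ℂ) (A : Rn n → 𝓢'(Rn n, ℂ)),
      0 ≤ C ∧ (∀ S, SliceIntegrable (f S)) ∧
      (∀ S j, j ∉ S → HasWeakDeriv (f S) (f (insert j S)) (EuclideanSpace.single j 1)) ∧
      (∀ S ξ, ∫⁻ ζ, ‖f S (ζ, ξ)‖ₑ
        ≤ ENNReal.ofReal (C * mWeight M ξ ^ (m - ∑ j ∈ S, 1 / M j))) ∧
      (∀ ξ, eLpNorm (fun ζ => ((mWeight M ζ ^ r : ℝ) : ℂ) * f ∅ (ζ, ξ)) p volume ≤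
        ENNReal.ofReal (C * mWeight M ξ ^ (m + δ * (r - n / muMin M * (q⁻¹).toReal)))) ∧
      IsFamily a A ∧ ∀ ξ, IsFunction (fourierD n (A ξ)) (fun ζ => f ∅ (ζ, ξ)) := by
  obtain ⟨C, hC, h⟩ := ha
  -- Only multi-indices with entries 0 and 1 enter, and these have length at most `n`.
  choose A₁ A hA hfam hmeas hb hbp using fun S : Finset (Fin n) =>
    h (indicatorIndex S) ((sum_indicatorIndex_le S).trans hN)
  choose f hf hfA₁ using fun S => FL.exists_measurable_isFunction (hmeas S)
  have hfA : ∀ S ξ, IsFunction (fourierD n (A S ξ).toDist) (fun ζ => f S (ζ, ξ)) := fun S ξ =>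
    hA S ξ ▸ hfA₁ S ξ
  have hbound : ∀ S ξ, ∫⁻ ζ, ‖f S (ζ, ξ)‖ₑ
      ≤ ENNReal.ofReal (C * mWeight M ξ ^ (m - ∑ j ∈ S, 1 / M j)) := fun S ξ => by
    rw [(A₁ S ξ).lintegral_enorm_eq (hfA₁ S ξ), ← mOrder_indicatorIndex]
    exact ENNReal.ofReal_le_ofReal (hb S ξ)
  refine ⟨C, f, fun ξ => (A ∅ ξ).toDist, hC.le,
    fun S => sliceIntegrable_of_bound hM (hf S) hC.le (hbound S), fun S j hj => ?_, hbound,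
    fun ξ => ?_, ?_, hfA ∅⟩
  · have h1 := hfam (insert j S)
    rw [dXi_insert a hj] at h1
    exact hasWeakDeriv_of_isFamily (hfam S) h1 (hfA S) (hfA _)
  · rw [(A ∅ ξ).eLpNorm_eq_ofReal_norm (hfA ∅ ξ)]
    have := hbp ∅ ξ
    rw [mOrder_indicatorIndex, Finset.sum_empty, sub_zero] at this
    exact ENNReal.ofReal_le_ofReal this
  · have h1 := hfam ∅
    have h2 : dXi (indicatorIndex (∅ : Finset (Fin n))) a = a := by
      unfold dXi
      induction List.finRange n with
      | nil => rfl
      | cons i l ih => rw [List.foldr_cons, ih]; simp [indicatorIndex]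
    rwa [h2] at h1

end

/-! ### The Fourier–Lebesgue space as an isometric copy of L^p, and operators given by kernels. -/

section

variable {n : ℕ} {M : Fin n → ℝ} {p q : ℝ≥0∞}

/-- The inverse of the Fourier transform `fourierS`. -/
def fourierInvS (n : ℕ) : 𝓢(Rn n, ℂ) →L[ℂ] 𝓢(Rn n, ℂ) :=
  (FourierTransform.fourierCLE ℂ 𝓢(Rn n, ℂ)).symm.toContinuousLinearMap.comp
    (SchwartzMap.compCLMOfContinuousLinearEquiv ℂ (dil n).symm)

theorem fourierS_fourierInvS (φ : 𝓢(Rn n, ℂ)) : fourierS n (fourierInvS n φ) = φ := by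
  have h1 : fourierS n (fourierInvS n φ) = SchwartzMap.compCLMOfContinuousLinearEquiv ℂ (dil n)
      (𝓕 (𝓕⁻ (SchwartzMap.compCLMOfContinuousLinearEquiv ℂ (dil n).symm φ))) := rfl
  rw [h1, FourierTransform.fourier_fourierInv_eq]
  ext x
  simp

theorem fourierInvS_fourierS (φ : 𝓢(Rn n, ℂ)) : fourierInvS n (fourierS n φ) = φ := by
  have h1 : fourierInvS n (fourierS n φ) =
      𝓕⁻ (SchwartzMap.compCLMOfContinuousLinearEquiv ℂ (dil n).symm
        (SchwartzMap.compCLMOfContinuousLinearEquiv ℂ (dil n) (𝓕 φ))) := rfl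
  have h2 : SchwartzMap.compCLMOfContinuousLinearEquiv ℂ (dil n).symm
      (SchwartzMap.compCLMOfContinuousLinearEquiv ℂ (dil n) (𝓕 φ)) = 𝓕 φ := by
    ext x; simp
  rw [h1, h2, FourierTransform.fourierInv_fourier_eq]

theorem fourierD_injective : Function.Injective (fourierD n) := by
  intro u v h
  ext φ
  rw [← fourierS_fourierInvS φ, ← fourierD_apply, h, fourierD_apply]

theorem fourierD_surjective : Function.Surjective (fourierD n) := by
  intro v
  refine ⟨PointwiseConvergenceCLM.precomp ℂ (fourierInvS n) v, ?_⟩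
  ext φ
  rw [fourierD_apply]
  change v (fourierInvS n (fourierS n φ)) = v φ
  rw [fourierInvS_fourierS]

/-- Multiplication by a power of `1 + |ξ|²`. -/
def polyWeight (n k : ℕ) (ξ : Rn n) : ℂ := (((1 + ‖ξ‖ ^ 2) ^ k : ℝ) : ℂ)

theorem hasTemperateGrowth_polyWeight (k : ℕ) : (polyWeight n k).HasTemperateGrowth := by
  have h : (fun ξ : Rn n => (1 + ‖ξ‖ ^ 2) ^ k).HasTemperateGrowth :=
    ((Function.HasTemperateGrowth.const 1).add
      (Function.hasTemperateGrowth_norm_sq (Rn n))).pow k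
  exact (Function.Complex.hasTemperateGrowth_ofReal).comp h

theorem exists_mWeight_rpow_le_polyWeight (hM : ∀ j, 0 < M j) (s : ℝ) :
    ∃ (k : ℕ) (C : ℝ), 0 < C ∧ ∀ ξ : Rn n, mWeight M ξ ^ s ≤ C * ‖polyWeight n k ξ‖ := by
  obtain ⟨k, C, hC, h⟩ := exists_mWeight_rpow_le_one_add_norm_pow hM s
  refine ⟨k, C * 2 ^ k, by positivity, fun ξ => (h ξ).trans ?_⟩
  have h1 : ‖polyWeight n k ξ‖ = (1 + ‖ξ‖ ^ 2) ^ k := by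
    rw [polyWeight, Complex.norm_real, Real.norm_of_nonneg (by positivity)]
  rw [h1, mul_assoc, ← mul_pow]
  have : 1 + ‖ξ‖ ≤ 2 * (1 + ‖ξ‖ ^ 2) := by nlinarith [sq_nonneg (‖ξ‖ - 1)]
  gcongr

theorem polyWeight_ne_zero (k : ℕ) (ξ : Rn n) : polyWeight n k ξ ≠ 0 := by
  rw [polyWeight, Complex.ofReal_ne_zero]; positivity

theorem aestronglyMeasurable_mWeight_rpow (hM : ∀ j, 0 < M j) (s : ℝ) :
    AEStronglyMeasurable (fun ξ : Rn n => ((mWeight M ξ ^ s : ℝ) : ℂ)) volume :=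
  (Complex.measurable_ofReal.comp ((measurable_mWeight hM).pow_const s)).aestronglyMeasurable

theorem norm_mWeight_rpow_mul (s : ℝ) (ξ : Rn n) (z : ℂ) :
    ‖((mWeight M ξ ^ s : ℝ) : ℂ) * z‖ = mWeight M ξ ^ s * ‖z‖ := by
  rw [norm_mul, Complex.norm_real,
    Real.norm_of_nonneg (Real.rpow_nonneg (mWeight_pos M ξ).le s)]

theorem memLp_mWeight_rpow_mul (hM : ∀ j, 0 < M j) (s : ℝ) (φ : 𝓢(Rn n, ℂ)) (p : ℝ≥0∞) :
    MemLp (fun ξ => ((mWeight M ξ ^ s : ℝ) : ℂ) * φ ξ) p volume := by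
  obtain ⟨k, C, hC, h⟩ := exists_mWeight_rpow_le_polyWeight (n := n) hM s
  refine ((SchwartzMap.smulLeftCLM ℂ (polyWeight n k) φ).memLp p volume).of_le_mul (c := C)
    ((aestronglyMeasurable_mWeight_rpow hM s).mul φ.continuous.aestronglyMeasurable)
    (Filter.Eventually.of_forall fun ξ => ?_)
  rw [SchwartzMap.smulLeftCLM_apply_apply (hasTemperateGrowth_polyWeight k),
    norm_mWeight_rpow_mul, norm_smul, ← mul_assoc]
  exact mul_le_mul_of_nonneg_right (h ξ) (norm_nonneg _)

/-- Dividing by a power of 1 + |ξ|² that dominates ⟨·⟩^{-s} puts `g` in L^p, hence among the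
tempered distributions; the polynomial is restored by letting it act on the test function. -/
theorem exists_isFunction_of_memLp [hp : Fact (1 ≤ p)] (hM : ∀ j, 0 < M j) {s : ℝ} {g : Rn n → ℂ}
    (hg : AEStronglyMeasurable g volume)
    (hgp : MemLp (fun ξ => ((mWeight M ξ ^ s : ℝ) : ℂ) * g ξ) p volume) :
    ∃ v, IsFunction v g := by
  obtain ⟨k, C, hC, h⟩ := exists_mWeight_rpow_le_polyWeight (n := n) hM (-s)
  have hPm : AEStronglyMeasurable (polyWeight n k) volume :=
    (hasTemperateGrowth_polyWeight k).1.continuous.aestronglyMeasurable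
  have hh : MemLp (fun ξ => (polyWeight n k ξ)⁻¹ * g ξ) p volume := by
    refine hgp.of_le_mul (c := C) (hPm.inv₀.mul hg) (Filter.Eventually.of_forall fun ξ => ?_)
    have hw := Real.rpow_pos_of_pos (mWeight_pos M ξ) s
    have hP : 0 < ‖polyWeight n k ξ‖ := norm_pos_iff.2 (polyWeight_ne_zero k ξ)
    rw [norm_mWeight_rpow_mul, norm_mul, norm_inv, ← mul_assoc]
    refine mul_le_mul_of_nonneg_right ?_ (norm_nonneg _)
    have h1 := h ξ
    rw [Real.rpow_neg (mWeight_pos M ξ).le, inv_le_iff_one_le_mul₀ hw] at h1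
    rw [inv_le_iff_one_le_mul₀ hP]
    linarith
  let T := (SchwartzMap.smulLeftCLM ℂ (polyWeight n k) : 𝓢(Rn n, ℂ) →L[ℂ] 𝓢(Rn n, ℂ))
  refine ⟨PointwiseConvergenceCLM.precomp ℂ T (Lp.toTemperedDistribution (hh.toLp _)), hg,
    fun φ => ?_⟩
  have hT : ∀ ξ, T φ ξ = polyWeight n k ξ * φ ξ := fun ξ =>
    SchwartzMap.smulLeftCLM_apply_apply (hasTemperateGrowth_polyWeight k) φ ξ
  have he : ∀ ξ, (polyWeight n k ξ)⁻¹ * g ξ * T φ ξ = g ξ * φ ξ := fun ξ => by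
    rw [hT]; field_simp [polyWeight_ne_zero k ξ]
  constructor
  · have hc := ENNReal.HolderConjugate.inv_one_sub_inv' hp.out
    have := hh.integrable_mul ((T φ).memLp (1 - p⁻¹)⁻¹ volume)
    exact this.congr (Filter.Eventually.of_forall he)
  · change Lp.toTemperedDistribution (hh.toLp _) (T φ) = _
    rw [Lp.toTemperedDistribution_apply]
    refine integral_congr_ae ?_
    filter_upwards [hh.coeFn_toLp] with ξ hξ
    rw [hξ, smul_eq_mul, mul_comm, he]

theorem FL.toLp_ae_eq {s : ℝ} (u : FL p s M) {f : Rn n → ℂ}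
    (hf : IsFunction (fourierD n u.toDist) f) :
    (FL.toLp u : Rn n → ℂ) =ᵐ[volume] fun ξ => ((mWeight M ξ ^ s : ℝ) : ℂ) * f ξ := by
  have h1 : (FL.toLp u : Rn n → ℂ) =ᵐ[volume] fun ξ => ((mWeight M ξ ^ s : ℝ) : ℂ) * u.hat ξ :=
    u.hat_spec.2.coeFn_toLp
  filter_upwards [h1, u.hat_unique hf] with ξ e1 e2
  rw [e1, e2]

theorem FL.isFunction_of_toLp_ae_eq {s : ℝ} (u : FL p s M) {f : Rn n → ℂ}
    (hf : (FL.toLp u : Rn n → ℂ) =ᵐ[volume] fun ξ => ((mWeight M ξ ^ s : ℝ) : ℂ) * f ξ) :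
    IsFunction (fourierD n u.toDist) f := by
  refine u.hat_spec.1.congr ?_
  filter_upwards [hf, u.toLp_ae_eq u.hat_spec.1] with ξ e1 e2
  rw [e2] at e1
  exact mul_left_cancel₀ (Complex.ofReal_ne_zero.2
    (Real.rpow_pos_of_pos (mWeight_pos M ξ) s).ne') e1

theorem FL.toLp_surjective [Fact (1 ≤ p)] (hM : ∀ j, 0 < M j) {s : ℝ} :
    Function.Surjective (FL.toLp : FL p s M → Lp ℂ p (volume : Measure (Rn n))) := by
  intro h
  have hw : ∀ ξ, ((mWeight M ξ ^ s : ℝ) : ℂ) * (((mWeight M ξ ^ (-s) : ℝ) : ℂ) * h ξ) = h ξ :=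
    fun ξ => by
      rw [← mul_assoc, ← Complex.ofReal_mul, ← Real.rpow_add (mWeight_pos M ξ)]; simp
  have hg : AEStronglyMeasurable (fun ξ => ((mWeight M ξ ^ (-s) : ℝ) : ℂ) * h ξ) volume :=
    (aestronglyMeasurable_mWeight_rpow hM (-s)).mul (Lp.aestronglyMeasurable h)
  have hgp : MemLp (fun ξ => ((mWeight M ξ ^ s : ℝ) : ℂ) *
      (((mWeight M ξ ^ (-s) : ℝ) : ℂ) * h ξ)) p volume := by
    simp only [hw]; exact Lp.memLp h
  obtain ⟨v, hv⟩ := exists_isFunction_of_memLp hM hg hgp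
  obtain ⟨u, rfl⟩ := fourierD_surjective v
  obtain ⟨w, rfl⟩ := FL.exists_toDist_eq_iff.2 ⟨_, hv, hgp⟩
  refine ⟨w, Lp.ext ?_⟩
  filter_upwards [w.toLp_ae_eq hv] with ξ e
  rw [e, hw]

/-- The isometry `u ↦ ⟨·⟩_M^s û` of `FL^p_{s,M}` onto `L^p`. -/
def FL.equivLp [Fact (1 ≤ p)] (hM : ∀ j, 0 < M j) (s : ℝ) :
    FL p s M ≃ₗᵢ[ℂ] Lp ℂ p (volume : Measure (Rn n)) :=
  LinearIsometryEquiv.ofSurjective ⟨FL.toLp, fun _ => rfl⟩ (FL.toLp_surjective hM)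

theorem ae_lt_top_of_eLpNorm_ne_top {X : Type*} [MeasurableSpace X] {μ : Measure X} (hp : p ≠ 0)
    {F : X → ℝ≥0∞} (hF : AEMeasurable F μ) (h : eLpNorm F p μ ≠ ⊤) : ∀ᵐ x ∂μ, F x < ⊤ := by
  by_cases hp' : p = ⊤
  · subst hp'
    rw [eLpNorm_exponent_top] at h
    filter_upwards [ae_le_eLpNormEssSup (f := F) (μ := μ)] with x hx
    exact (hx.trans_lt (lt_top_iff_ne_top.2 h))
  · have h1 := lintegral_rpow_enorm_lt_top_of_eLpNorm_lt_top hp hp' (lt_top_iff_ne_top.2 h)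
    have hpos := ENNReal.toReal_pos hp hp'
    filter_upwards [ae_lt_top' (hF.pow_const _) h1.ne] with x hx
    by_contra hx'
    rw [not_lt, top_le_iff] at hx'
    simp [hx', hpos] at hx

/-- An absolutely bounded integral kernel defines a bounded operator on `L^p`. -/
theorem exists_continuousLinearMap_of_kernel {X : Type*} [MeasurableSpace X] {μ : Measure X}
    [SFinite μ] [hp : Fact (1 ≤ p)] {K : X × X → ℂ} (hK : Measurable K) {A : ℝ≥0∞} (hA : A ≠ ⊤)
    (h : ∀ V : X → ℝ≥0∞, Measurable V →
      eLpNorm (fun η => ∫⁻ ξ, ‖K (η, ξ)‖ₑ * V ξ ∂μ) p μ ≤ A * eLpNorm V p μ) :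
    ∃ T : Lp ℂ p μ →L[ℂ] Lp ℂ p μ, ∀ g : Lp ℂ p μ,
      (T g : X → ℂ) =ᵐ[μ] fun η => ∫ ξ, K (η, ξ) * g ξ ∂μ := by
  have hp0 : p ≠ 0 := (zero_lt_one.trans_le hp.out).ne'
  have hm : ∀ g : Lp ℂ p μ, Measurable fun z : X × X => K z * g z.2 := fun g =>
    hK.mul ((Lp.stronglyMeasurable g).measurable.comp measurable_snd)
  have hen : ∀ g : Lp ℂ p μ, eLpNorm (fun η => ∫⁻ ξ, ‖K (η, ξ) * g ξ‖ₑ ∂μ) p μ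
      ≤ A * eLpNorm g p μ := fun g => by
    have h1 := h (fun ξ => ‖g ξ‖ₑ) (Lp.stronglyMeasurable g).measurable.enorm
    rw [eLpNorm_enorm] at h1
    simpa only [enorm_mul] using h1
  have hfin : ∀ g : Lp ℂ p μ, A * eLpNorm g p μ ≠ ⊤ := fun g =>
    ENNReal.mul_ne_top hA (Lp.eLpNorm_ne_top g)
  -- Additivity of the Bochner integral needs convergence, which the absolute bound gives for almost
  -- every `η`.
  have hint : ∀ g : Lp ℂ p μ, ∀ᵐ η ∂μ, Integrable (fun ξ => K (η, ξ) * g ξ) μ := fun g => by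
    have hF : Measurable fun η => ∫⁻ ξ, ‖K (η, ξ) * g ξ‖ₑ ∂μ := (hm g).enorm.lintegral_prod_right'
    filter_upwards [ae_lt_top_of_eLpNorm_ne_top hp0 hF.aemeasurable
      (ne_top_of_le_ne_top (hfin g) (hen g))] with η hη
    exact ⟨((hm g).comp measurable_prodMk_left).aestronglyMeasurable, hη⟩
  have hbd : ∀ g : Lp ℂ p μ,
      eLpNorm (fun η => ∫ ξ, K (η, ξ) * g ξ ∂μ) p μ ≤ A * eLpNorm g p μ := fun g =>
    (eLpNorm_mono_enorm fun η => by
      simpa using enorm_integral_le_lintegral_enorm (fun ξ => K (η, ξ) * g ξ)).trans (hen g)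
  have hmem : ∀ g : Lp ℂ p μ, MemLp (fun η => ∫ ξ, K (η, ξ) * g ξ ∂μ) p μ := fun g =>
    ⟨(hm g).stronglyMeasurable.integral_prod_right'.aestronglyMeasurable,
      (hbd g).trans_lt (lt_top_iff_ne_top.2 (hfin g))⟩
  let L : Lp ℂ p μ →ₗ[ℂ] Lp ℂ p μ :=
    { toFun := fun g => (hmem g).toLp _
      map_add' := fun g g' => by
        rw [← MemLp.toLp_add, MemLp.toLp_eq_toLp_iff]
        filter_upwards [hint g, hint g'] with η h1 h2
        rw [Pi.add_apply, ← integral_add h1 h2]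
        refine integral_congr_ae ?_
        filter_upwards [Lp.coeFn_add g g'] with ξ e
        rw [e, Pi.add_apply, mul_add]
      map_smul' := fun c g => by
        rw [RingHom.id_apply, ← MemLp.toLp_const_smul, MemLp.toLp_eq_toLp_iff]
        refine Filter.Eventually.of_forall fun η => ?_
        simp only [Pi.smul_apply, smul_eq_mul]
        rw [← integral_const_mul]
        refine integral_congr_ae ?_
        filter_upwards [Lp.coeFn_smul c g] with ξ e
        rw [e, Pi.smul_apply, smul_eq_mul]
        ring }
  refine ⟨L.mkContinuous A.toReal fun g => ?_, fun g => (hmem g).coeFn_toLp⟩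
  change ‖(hmem g).toLp _‖ ≤ _
  rw [Lp.norm_toLp, Lp.norm_def, ← ENNReal.toReal_mul]
  exact ENNReal.toReal_mono (hfin g) (hbd g)

end

/-! ### The Fourier transform of a(x, D)u. -/

section

variable {n : ℕ} {M : Fin n → ℝ} {p q : ℝ≥0∞}

/-- The transform belongs to the symmetric form (2π)⁻¹ x·ξ, so the general Fubini identity for
Fourier integrals makes it self-adjoint. -/
theorem integral_fourierS_mul (u φ : 𝓢(Rn n, ℂ)) :
    ∫ x, fourierS n u x * φ x = ∫ x, u x * fourierS n φ x := by
  have h : ∀ v : 𝓢(Rn n, ℂ), (fourierS n v : Rn n → ℂ)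
      = VectorFourier.fourierIntegral Real.fourierChar volume ((2 * π)⁻¹ • innerₗ (Rn n)) v := by
    intro v
    ext ξ
    have h1 : fourierS n v ξ = 𝓕 (v : Rn n → ℂ) ((2 * π)⁻¹ • ξ) := rfl
    rw [h1, Real.fourier_eq, VectorFourier.fourierIntegral]
    simp [inner_smul_right]
  have hflip : ((2 * π)⁻¹ • innerₗ (Rn n)).flip = (2 * π)⁻¹ • innerₗ (Rn n) := by
    ext x y; simp [real_inner_comm]
  have := VectorFourier.integral_fourierIntegral_smul_eq_flip (μ := volume) (ν := volume)
    (L := (2 * π)⁻¹ • innerₗ (Rn n)) Real.continuous_fourierChar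
    (by simp only [LinearMap.smul_apply, innerₗ_apply_apply]; fun_prop)
    u.integrable φ.integrable
  rw [hflip, ← h, ← h] at this
  exact this

theorem isFunction_fourierD_toTemperedDistribution (u : 𝓢(Rn n, ℂ)) :
    IsFunction (fourierD n (SchwartzMap.toTemperedDistributionCLM (Rn n) ℂ volume u))
      (fourierS n u) := by
  refine ⟨(fourierS n u).continuous.aestronglyMeasurable, fun φ => ⟨?_, ?_⟩⟩
  · exact ((fourierS n u).memLp 2 volume).integrable_mul (φ.memLp 2 volume)
  · rw [fourierD_apply, SchwartzMap.toTemperedDistributionCLM_apply_apply volume,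
      integral_fourierS_mul]
    simp only [smul_eq_mul, mul_comm]

theorem fourierS_compSubConst (φ : 𝓢(Rn n, ℂ)) (ξ x : Rn n) :
    fourierS n (φ.compSubConstCLM ℂ (-ξ)) x = exp (I * (inner ℝ x ξ : ℝ)) * fourierS n φ x := by
  rw [fourierS_apply, fourierS_apply, ← integral_const_mul,
    ← integral_sub_right_eq_self _ ξ]
  refine integral_congr_ae (Filter.Eventually.of_forall fun y => ?_)
  simp only [SchwartzMap.compSubConstCLM_apply, sub_neg_eq_add, sub_add_cancel, inner_sub_left]
  rw [← mul_assoc, ← Complex.exp_add]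
  congr 2
  push_cast
  rw [real_inner_comm x ξ]
  ring

/-- Multiplying a Fourier transform by e^{ix·ξ} translates the original function by ξ. This is the
origin of the argument η - ξ in the kernel. -/
theorem slice_smulLeft_phase_tensor (u φ : 𝓢(Rn n, ℂ)) (ξ : Rn n) :
    slice ξ (SchwartzMap.smulLeftCLM ℂ (phase n) (tensor u (fourierS n φ)))
      = u ξ • fourierS n (φ.compSubConstCLM ℂ (-ξ)) := by
  ext x
  rw [slice_apply, SchwartzMap.smulLeftCLM_apply_apply (hasTemperateGrowth_phase n), tensor_apply,
    smul_apply, fourierS_compSubConst, phase]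
  simp only [smul_eq_mul]
  ring

/-- The Fourier transform of `a(x, D) u` is `(2π)⁻ⁿ ∫ â(η - ξ, ξ) û(ξ) dξ`. -/
theorem fourierD_psdo_apply {a : 𝓢'(Rn n × Rn n, ℂ)} {A : Rn n → 𝓢'(Rn n, ℂ)}
    (hA : IsFamily a A) {f : Rn n × Rn n → ℂ} (hfm : Measurable f)
    (hf : ∀ ξ, IsFunction (fourierD n (A ξ)) (fun ζ => f (ζ, ξ))) (hM : ∀ j, 0 < M j) {C m : ℝ}
    (hC : 0 ≤ C) (hb : ∀ ξ, ∫⁻ ζ, ‖f (ζ, ξ)‖ₑ ≤ ENNReal.ofReal (C * mWeight M ξ ^ m))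
    (u φ : 𝓢(Rn n, ℂ)) :
    fourierD n (psdo a u) φ =
      ∫ η, ((((2 * π) ^ n : ℝ) : ℂ)⁻¹ * ∫ ξ, f (η - ξ, ξ) * fourierS n u ξ) * φ η := by
  have h1 : ∀ ξ, A ξ (slice ξ (SchwartzMap.smulLeftCLM ℂ (phase n)
      (tensor (fourierS n u) (fourierS n φ))))
      = ∫ η, f (η - ξ, ξ) * fourierS n u ξ * φ η := fun ξ => by
    rw [slice_smulLeft_phase_tensor, map_smul, ← fourierD_apply, ((hf ξ).2 _).2, smul_eq_mul,
      ← integral_const_mul, ← integral_sub_right_eq_self _ ξ]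
    refine integral_congr_ae (Filter.Eventually.of_forall fun η => ?_)
    simp only [SchwartzMap.compSubConstCLM_apply, sub_neg_eq_add, sub_add_cancel]
    ring
  rw [fourierD_apply, psdo_apply, (hA _).2]
  simp only [h1]
  have hmeas : Measurable fun z : Rn n × Rn n =>
      f (z.2 - z.1, z.1) * fourierS n u z.1 * φ z.2 := by
    refine ((hfm.comp (by fun_prop)).mul ?_).mul ?_
    · exact (fourierS n u).continuous.measurable.comp measurable_fst
    · exact φ.continuous.measurable.comp measurable_snd
  let B := ‖φ.toBoundedContinuousFunction‖
  have hB : ∀ η, ‖φ η‖ₑ ≤ ENNReal.ofReal B := fun η => by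
    rw [← ofReal_norm]
    exact ENNReal.ofReal_le_ofReal (φ.toBoundedContinuousFunction.norm_coe_le_norm η)
  -- With `φ` bounded, the integral in η is at most of order ⟨ξ⟩^m, and the rapidly decreasing
  -- factor û(ξ) absorbs this growth.
  have hint : Integrable (fun z : Rn n × Rn n => f (z.2 - z.1, z.1) * fourierS n u z.1 * φ z.2)
      (volume.prod volume) := by
    refine ⟨hmeas.aestronglyMeasurable, ?_⟩
    have hw := (memLp_mWeight_rpow_mul hM m (fourierS n u) 1).eLpNorm_ne_top
    rw [eLpNorm_one_eq_lintegral_enorm] at hw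
    rw [hasFiniteIntegral_iff_enorm, lintegral_prod _ hmeas.enorm.aemeasurable]
    refine lt_of_le_of_lt (b := ∫⁻ ξ, (ENNReal.ofReal C * ENNReal.ofReal B) *
      ‖((mWeight M ξ ^ m : ℝ) : ℂ) * fourierS n u ξ‖ₑ) (lintegral_mono fun ξ => ?_) ?_
    · calc ∫⁻ η, ‖f (η - ξ, ξ) * fourierS n u ξ * φ η‖ₑ
          ≤ ∫⁻ η, ‖f (η - ξ, ξ)‖ₑ * (‖fourierS n u ξ‖ₑ * ENNReal.ofReal B) := by
            refine lintegral_mono fun η => ?_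
            rw [enorm_mul, enorm_mul, mul_assoc]
            gcongr
            exact hB η
        _ = (∫⁻ ζ, ‖f (ζ, ξ)‖ₑ) * (‖fourierS n u ξ‖ₑ * ENNReal.ofReal B) := by
            rw [lintegral_mul_const', lintegral_sub_right_eq_self (fun ζ => ‖f (ζ, ξ)‖ₑ) ξ]
            exact ENNReal.mul_ne_top enorm_ne_top ENNReal.ofReal_ne_top
        _ ≤ ENNReal.ofReal (C * mWeight M ξ ^ m) * (‖fourierS n u ξ‖ₑ * ENNReal.ofReal B) := by
            gcongr
            exact hb ξ
        _ = _ := by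
            have hw0 := Real.rpow_nonneg (mWeight_pos M ξ).le m
            rw [enorm_mul, ENNReal.ofReal_mul hC, ← ofReal_norm ((mWeight M ξ ^ m : ℝ) : ℂ),
              Complex.norm_real, Real.norm_of_nonneg hw0]
            ring
    · rw [lintegral_const_mul']
      · exact ENNReal.mul_lt_top (ENNReal.mul_lt_top ENNReal.ofReal_lt_top ENNReal.ofReal_lt_top)
          (lt_top_iff_ne_top.2 hw)
      · exact ENNReal.mul_ne_top ENNReal.ofReal_ne_top ENNReal.ofReal_ne_top
  rw [integral_integral_swap hint, ← integral_const_mul]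
  refine integral_congr_ae (Filter.Eventually.of_forall fun η => ?_)
  dsimp only
  rw [integral_mul_const, mul_assoc]

end

end QuasiHom

end

/-! ### Assembly: the kernel operator transported to the Fourier–Lebesgue spaces. -/

theorem mainTheorem1 {n : ℕ} (hn : 0 < n) (M : Fin n → ℝ) (hM : ∀ j, 0 < M j)
    (p q : ℝ≥0∞) [Fact (1 ≤ p)] (hpq : p⁻¹ + q⁻¹ = 1)
    (r : ℝ) (hr : n / QuasiHom.muMin M * (q⁻¹).toReal < r)
    (δ : ℝ) (hδ : δ ∈ Set.Icc (0 : ℝ) 1) (m : ℝ) (N : ℕ) (hN : n + 1 < N)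
    (a : 𝓢'(QuasiHom.Rn n × QuasiHom.Rn n, ℂ)) (ha : QuasiHom.IsSymbol p q r m δ M N a)
    (s : ℝ)
    (hs : s ∈ Set.Ioo ((δ - 1) * (r - n / QuasiHom.muMin M * (q⁻¹).toReal)) r ∨
      (δ < 1 ∧ s = r)) :
    ∃ T : QuasiHom.FL p (s + m) M →L[ℂ] QuasiHom.FL p s M,
      ∀ u : 𝓢(QuasiHom.Rn n, ℂ), ∃ w : QuasiHom.FL p (s + m) M,
        w.toDist = SchwartzMap.toTemperedDistributionCLM (QuasiHom.Rn n) ℂ volume u ∧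
          (T w).toDist = QuasiHom.psdo a u := by
  obtain ⟨C, f, A, hC, hf, hd, hb, hbp, hA, hfA⟩ := ha.exists_fourier_family hM (by omega)
  obtain ⟨B, hB, hker⟩ := QuasiHom.exists_eLpNorm_lintegral_kernel_le hn hM hpq hC hr hδ.2 hs hf hd
    hb hbp
  have hb0 : ∀ ξ, ∫⁻ ζ, ‖f ∅ (ζ, ξ)‖ₑ ≤ ENNReal.ofReal (C * QuasiHom.mWeight M ξ ^ m) := by
    simpa using hb ∅
  let K : QuasiHom.Rn n × QuasiHom.Rn n → ℂ := fun z =>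
    ((QuasiHom.mWeight M z.1 ^ s * QuasiHom.mWeight M z.2 ^ (-(s + m)) : ℝ) : ℂ) *
      f ∅ (z.1 - z.2, z.2)
  have hw := QuasiHom.measurable_mWeight hM
  have hK : Measurable K := by
    refine Measurable.mul (Complex.measurable_ofReal.comp ?_) ((hf ∅).measurable.comp (by fun_prop))
    exact ((hw.comp measurable_fst).pow_const s).mul ((hw.comp measurable_snd).pow_const _)
  have hKe : ∀ η ξ, ‖K (η, ξ)‖ₑ = ENNReal.ofReal (QuasiHom.mWeight M η ^ s *
      QuasiHom.mWeight M ξ ^ (-(s + m))) * ‖f ∅ (η - ξ, ξ)‖ₑ := fun η ξ => by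
    have h0 := mul_nonneg (Real.rpow_nonneg (QuasiHom.mWeight_pos M η).le s)
      (Real.rpow_nonneg (QuasiHom.mWeight_pos M ξ).le (-(s + m)))
    rw [enorm_mul, ← ofReal_norm (((_ : ℝ) : ℂ)), Complex.norm_real, Real.norm_of_nonneg h0]
  obtain ⟨T, hT⟩ := QuasiHom.exists_continuousLinearMap_of_kernel hK hB fun V hV => by
    simpa only [hKe] using hker V hV
  let c : ℂ := (((2 * π) ^ n : ℝ) : ℂ)⁻¹
  let E := QuasiHom.FL.equivLp (p := p) hM s
  let E' := QuasiHom.FL.equivLp (p := p) hM (s + m)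
  refine ⟨E.symm.toContinuousLinearEquiv.toContinuousLinearMap.comp
    ((c • T).comp E'.toContinuousLinearEquiv.toContinuousLinearMap), fun u => ?_⟩
  have hu := QuasiHom.isFunction_fourierD_toTemperedDistribution u
  obtain ⟨w, hwu⟩ := QuasiHom.FL.exists_toDist_eq_iff.2
    ⟨_, hu, QuasiHom.memLp_mWeight_rpow_mul hM (s + m) (QuasiHom.fourierS n u) p⟩
  refine ⟨w, hwu, ?_⟩
  set v : QuasiHom.FL p s M := E.symm ((c • T) (E' w)) with hv
  change v.toDist = _
  have hv' : QuasiHom.FL.toLp v = c • T (QuasiHom.FL.toLp w) := E.apply_symm_apply _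
  -- On a Schwartz function the operator on L^p acts on ⟨ξ⟩^{s+m} û(ξ), which cancels the factor
  -- ⟨ξ⟩^{-(s+m)} of the kernel; the factor ⟨η⟩^s is the weight of the target space.
  have hfun : QuasiHom.IsFunction (QuasiHom.fourierD n v.toDist)
      (fun η => c * ∫ ξ, f ∅ (η - ξ, ξ) * QuasiHom.fourierS n u ξ) := by
    refine v.isFunction_of_toLp_ae_eq ?_
    rw [hv']
    filter_upwards [Lp.coeFn_smul c (T (QuasiHom.FL.toLp w)), hT (QuasiHom.FL.toLp w)]
      with η h1 h2
    rw [h1, Pi.smul_apply, h2, smul_eq_mul, mul_left_comm,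
      ← integral_const_mul ((QuasiHom.mWeight M η ^ s : ℝ) : ℂ)]
    congr 1
    refine integral_congr_ae ?_
    filter_upwards [w.toLp_ae_eq (hwu ▸ hu)] with ξ h3
    rw [h3]
    have h4 : QuasiHom.mWeight M ξ ^ (-(s + m)) * QuasiHom.mWeight M ξ ^ (s + m) = 1 := by
      rw [← Real.rpow_add (QuasiHom.mWeight_pos M ξ)]; simp
    have h5 : ((QuasiHom.mWeight M ξ ^ (-(s + m)) : ℝ) : ℂ) *
        ((QuasiHom.mWeight M ξ ^ (s + m) : ℝ) : ℂ) = 1 := by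
      rw [← Complex.ofReal_mul, h4, Complex.ofReal_one]
    simp only [K, Complex.ofReal_mul]
    linear_combination ((QuasiHom.mWeight M η ^ s : ℝ) : ℂ) * f ∅ (η - ξ, ξ) *
      QuasiHom.fourierS n u ξ * h5
  apply QuasiHom.fourierD_injective
  ext φ
  rw [(hfun.2 φ).2, QuasiHom.fourierD_psdo_apply hA (hf ∅).measurable hfA hM hC hb0 u φ]
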